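/- Let $\kappa>0$ and $c\in(0,1)$; if $\kappa>1$ assume moreover $c>c^*$, where $$c^*=\frac{1}{1+\frac{2\sqrt\kappa}{\pi}\ln\frac{\sqrt\kappa+1}{\sqrt\kappa-1}} .$$ Let $\beta_1>0$ and $\beta_0>\tilde\beta_0^*$, where $$\tilde\beta_0^*=\frac{\sqrt\kappa\,\pi}{c}\cdot\frac{\sinh\left(\frac{\pi(1-c)}{2c\sqrt\kappa}\right)}{\kappa+1-(\kappa-1)\cosh\left(\frac{\pi(1-c)}{2c\sqrt\kappa}\right)} .$$ For a measurable set $E\subseteq(0,1)$ put $m_E=\kappa\chi_E-\chi_{(0,1)\setminus E}$. A positive principal eigenvalue for $E$ is a number $\mu>0$ for which the problem $$\varphi''+\mu\, m_E\varphi=0 \text{ in }(0,1),\qquad \varphi'(0)=\beta_0\varphi(0),\qquad \varphi'(1)=-\beta_1\varphi(1)$$ has a weak solution $\varphi\in H^1(0,1)$ with $\varphi>0$ in $(0,1)$. Then, for every $a\in[0,1-c]$, there is exactly one positive principal eigenvalue $\lambda(a)$ for the interval $E=(a,a+c)$, and $\lambda$ is differentiable on $(0,1-c)$. Call $a\in[0,1-c]$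 optimal if $\lambda(a)$ is the smallest of all positive principal eigenvalues for measurable sets $E\subseteq(0,1)$ with $0<|E|\le c$. For $l>0$ put $$\tau(l)=l^{-1/2}\,|\beta_0\beta_1-l|\,\tanh\big(\sqrt l\,(1-c)\big),\qquad a^*(l)=\frac{1}{2\sqrt l}\tanh^{-1}\left(\frac{\sqrt l\,(\beta_1-\beta_0)}{l-\beta_0\beta_1}\right)+\frac{1-c}{2}.$$ **Sign of the derivative at a given position.** For every $a\in(0,1-c)$, writing $\lambda=\lambda(a)$: - if $\beta_0\beta_1=\lambda$, then $\lambda'(a)<0$ when $\beta_0>\beta_1$, $\lambda'(a)>0$ when $\beta_0<\beta_1$, and $\lambda'(a)=0$ when $\beta_0=\beta_1$; - if $\beta_0\beta_1\ne\lambda$, then $\lambda'(a)\ge0$ when $\beta_0-\beta_1<-\tau(\lambda)$, and $\lambda'(a)\le0$ when $\beta_0-\beta_1>\tau(\lambda)$; - if $|\beta_0-\beta_1|\le\tau(\lambda)$ and $\beta_0\beta_1>\lambda$, then $\lambda'(a)\le0$ when $a<a^*(\lambda)$, and $\lambda'(a)\ge0$ when $a>a^*(\lambda)$; if $|\beta_0-\beta_1|\le\tau(\lambda)$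 and $\beta_0\beta_1<\lambda$, both inequalities for $\lambda'(a)$ are reversed. **Monotonicity and optimal position.** 1. Suppose $\beta_0\beta_1=\lambda(a)$ for some $a\in[0,1-c]$. - If $\beta_0>\beta_1$, then $\lambda'<0$ on $(0,1-c)$ and $a=1-c$ is optimal. - If $\beta_0<\beta_1$, then $\lambda'>0$ on $(0,1-c)$ and $a=0$ is optimal. - If $\beta_0=\beta_1$, then $\lambda'=0$ on $(0,1-c)$ and every $a\in[0,1-c]$ is optimal. 2. The case $\beta_0\beta_1>\lambda$. - If $\beta_0\beta_1>\lambda(a)$ and $\beta_0-\beta_1<-\tau(\lambda(a))$ for all $a\in[0,1-c]$, then $\lambda'\ge0$ on $(0,1-c)$ and $a=0$ is optimal. - If $\beta_0\beta_1>\lambda(a)$ and $|\beta_0-\beta_1|\le\tau(\lambda(a))$ for some $a\in[0,1-c]$, then there is $a^*\in[0,1-c]$ with $a^*=a^*(\lambda(a^*))$ such that $\lambda'\le0$ on $(0,a^*)$, $\lambda'\ge0$ on $(a^*,1-c)$, and $a=a^*$ is optimal. - If $\beta_0\beta_1>\lambda(a)$ and $\beta_0-\beta_1>\tau(\lambda(a))$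 for all $a\in[0,1-c]$, then $\lambda'\le0$ on $(0,1-c)$ and $a=1-c$ is optimal. 3. The case $\beta_0\beta_1<\lambda$. - If $\beta_0\beta_1<\lambda(a)$ and $\beta_0-\beta_1<-\tau(\lambda(a))$ for all $a\in[0,1-c]$, then $\lambda'\ge0$ on $(0,1-c)$ and $a=0$ is optimal. - If $\beta_0\beta_1<\lambda(a)$ and $|\beta_0-\beta_1|\le\tau(\lambda(a))$ for some $a\in[0,1-c]$, then there is $a^*\in[0,1-c]$ with $a^*=a^*(\lambda(a^*))$ such that $\lambda'\ge0$ on $(0,a^*)$, $\lambda'\le0$ on $(a^*,1-c)$, and at least one of $a=0$, $a=1-c$ is optimal. - If $\beta_0\beta_1<\lambda(a)$ and $\beta_0-\beta_1>\tau(\lambda(a))$ for all $a\in[0,1-c]$, then $\lambda'\le0$ on $(0,1-c)$ and $a=1-c$ is optimal. -/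

import Mathlib

open Set MeasureTheory

noncomputable section

namespace RobinWeight

/-- `u`, restricted to `[0, 1]`, is the continuous representative of an element of the Sobolev
space `H¹(0, 1)`, and `u'` is its weak derivative: `u' ∈ L²(0, 1)` and `u` is the absolutely
continuous primitive of `u'`. In particular `u 0` and `u 1` are the boundary traces. -/
structure IsH1 (u u' : ℝ → ℝ) : Prop where
  memLp : MemLp u' 2 (volume.restrict (Ioo (0 : ℝ) 1))
  eq_integral : ∀ x ∈ Icc (0 : ℝ) 1, u x = u 0 + ∫ t in (0 : ℝ)..x, u' t

/-- The weight `κ χ_E - χ_{Eᶜ}`. -/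
def weight (κ : ℝ) (E : Set ℝ) (x : ℝ) : ℝ :=
  E.indicator (fun _ => κ) x - Eᶜ.indicator (fun _ => 1) x

/-- `μ` is a positive principal eigenvalue of `φ'' + μ m φ = 0` in `(0, 1)`,
`φ'(0) = β₀ φ(0)`, `φ'(1) = -β₁ φ(1)`: it is positive and has a weak eigenfunction
`φ ∈ H¹(0, 1)` which is positive in `(0, 1)`. -/
def IsPositivePrincipalEigenvalue (m : ℝ → ℝ) (β₀ β₁ μ : ℝ) : Prop :=
  0 < μ ∧ ∃ φ φ' : ℝ → ℝ, IsH1 φ φ' ∧ (∀ x ∈ Ioo (0 : ℝ) 1, 0 < φ x) ∧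
    ∀ v v' : ℝ → ℝ, IsH1 v v' →
      (∫ x in (0 : ℝ)..1, φ' x * v' x) + β₀ * φ 0 * v 0 + β₁ * φ 1 * v 1 =
        μ * ∫ x in (0 : ℝ)..1, m x * φ x * v x

/-- The positive principal eigenvalue `λ(E)` for the weight `κ χ_E - χ_{Eᶜ}`. (For the sets
that occur in the theorem it is part of the conclusion that there is exactly one.) -/
def principalEigenvalue (κ β₀ β₁ : ℝ) (E : Set ℝ) : ℝ :=
  sInf {μ | IsPositivePrincipalEigenvalue (weight κ E) β₀ β₁ μ}

/-- All positive principal eigenvalues for measurable sets `E ⊆ (0, 1)` with `0 < |E| ≤ c`. -/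
def admissibleEigenvalues (κ c β₀ β₁ : ℝ) : Set ℝ :=
  {μ | ∃ E : Set ℝ, MeasurableSet E ∧ E ⊆ Ioo 0 1 ∧ 0 < volume E ∧
    volume E ≤ ENNReal.ofReal c ∧ IsPositivePrincipalEigenvalue (weight κ E) β₀ β₁ μ}

/-- The constant `c*` (used for `κ > 1`). -/
def cStar (κ : ℝ) : ℝ :=
  1 / (1 + 2 * √κ / Real.pi * Real.log ((√κ + 1) / (√κ - 1)))

/-- The lower bound `β̃₀*(c, κ)` for `β₀`. -/
def betaStar (c κ : ℝ) : ℝ :=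
  √κ * Real.pi / c * (Real.sinh (Real.pi * (1 - c) / (2 * c * √κ)) /
    (κ + 1 - (κ - 1) * Real.cosh (Real.pi * (1 - c) / (2 * c * √κ))))

/-- The threshold `l^{-1/2} |β₀ β₁ - l| tanh (√l (1 - c))`. -/
def threshold (c β₀ β₁ l : ℝ) : ℝ :=
  (√l)⁻¹ * |β₀ * β₁ - l| * Real.tanh (√l * (1 - c))

/-- The position `a*`, as a function of the value `l` of the eigenvalue. -/
def aStar (c β₀ β₁ l : ℝ) : ℝ :=
  1 / (2 * √l) * Real.artanh (√l * (β₁ - β₀) / (l - β₀ * β₁)) + (1 - c) / 2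

end RobinWeight

end

noncomputable section

namespace RobinWeight

open Filter Topology

/-! Write λ = w². The slope p = φ'/(wφ) of a positive solution satisfies p' = w(1 - p²) off the
favourable set, while on that set the phase arctan(p/√κ) falls at the constant rate w√κ. The Robin
conditions say that p runs from β₀/w to -β₁/w. For the favourable interval (a, a + c) the problem
thus becomes one scalar equation, `charFn` = 0: the phases at the two edges of the interval add up
to w√κc. Since `charFn` / w strictly decreases in w, there is one positive zero, `freq`. Gluing
explicit solutions gives a positive eigenfunction with λ = `freq`², and Picone's inequality excludes
any other positive principal eigenvalue.

Dependence on a. The implicit function theorem shows that the derivative of `freq` is a positive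
multiple of `freqAsym`, that is, of (w² - β₀β₁) tanh(w(1 - c - 2a)) + w(β₁ - β₀) at w = `freq`. For
fixed w this expression is strictly monotone in a, in the direction given by the sign of β₀β₁ - w².
Hence a critical position with λ < β₀β₁ is a strict global minimum, one with λ > β₀β₁ is a strict
global maximum, and there is at most one of them. If the threshold inequality holds somewhere, a
critical position exists: otherwise `freq` would be monotone, the inequality would carry over to an
endpoint, and `freqAsym` would have the wrong sign there. If λ = β₀β₁ at some position, then w lies
between β₀ and β₁ at every position, and w² - β₀β₁ + w(β₁ - β₀) = (w - β₀)(w + β₁) settles the sign.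

Optimality among all sets. Let w be the least value of `freq`; then `charFn` at w is nonnegative for
every position. Replace the favourable set by one short interval in each cell of a fine grid and run
the Riccati equation from β₀/w. The phase gained on an unfavourable stretch is a unimodal function
of the incoming slope, so additional favourable length does at least as much damage when joined to
the earlier interval or when the whole favourable length is moved to the current point. By induction
p stays above the slope of some one-interval arrangement (`Dominates`). So p does not blow up, it
ends above -β₁/w, and Picone's inequality bounds the Rayleigh quotient below by w². -/

/-- Absolute continuity on an interval depends only on the values there. -/
theorem absolutelyContinuous_congr {f g : ℝ → ℝ} {a b : ℝ}
    (hf : AbsolutelyContinuousOnInterval f a b) (h : ∀ x ∈ uIcc a b, f x = g x) :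
    AbsolutelyContinuousOnInterval g a b := by
  rw [absolutelyContinuousOnInterval_iff] at hf ⊢
  intro ε hε
  obtain ⟨δ, hδ, H⟩ := hf ε hε
  refine ⟨δ, hδ, fun E hE hs => ?_⟩
  rw [show ∑ i ∈ Finset.range E.1, dist (g (E.2 i).1) (g (E.2 i).2) =
    ∑ i ∈ Finset.range E.1, dist (f (E.2 i).1) (f (E.2 i).2) from
      Finset.sum_congr rfl fun i hi => by rw [h _ (hE.1 i hi).1, h _ (hE.1 i hi).2]]
  exact H E hE hs

theorem ae_Ioo_imp_iff {P : ℝ → Prop} {a b : ℝ} (h : ∀ᵐ t, t ∈ Ioo a b → P t) :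
    ∀ᵐ t, t ∈ Ioc a b → P t := by
  have hb : ∀ᵐ t : ℝ, t ≠ b := by simp [ae_iff]
  filter_upwards [h, hb] with t ht hne hmem
  exact ht ⟨hmem.1, lt_of_le_of_ne hmem.2 hne⟩

/-- The fundamental theorem of calculus for an absolutely continuous function and a given
a.e. derivative. -/
theorem integral_eq_sub_of_ac {f f' : ℝ → ℝ} {x y : ℝ} (hxy : x ≤ y)
    (hf : AbsolutelyContinuousOnInterval f x y)
    (h : ∀ᵐ t, t ∈ Ioo x y → HasDerivAt f (f' t) t) :
    IntervalIntegrable f' volume x y ∧ ∫ t in x..y, f' t = f y - f x := by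
  have e : ∀ᵐ t, t ∈ uIoc x y → deriv f t = f' t := by
    rw [uIoc_of_le hxy]
    filter_upwards [ae_Ioo_imp_iff h] with t ht hmem using (ht hmem).deriv
  constructor
  · refine hf.intervalIntegrable_deriv.congr_ae ?_
    exact (ae_restrict_iff' measurableSet_uIoc).2 e
  · rw [← hf.integral_deriv_eq_sub]
    exact (intervalIntegral.integral_congr_ae e).symm

/-! ### Calculus of H¹ functions on (0, 1) and Picone's inequality -/

namespace IsH1

variable {u u' : ℝ → ℝ}

theorem intervalIntegrable (h : IsH1 u u') : IntervalIntegrable u' volume 0 1 := by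
  rw [intervalIntegrable_iff_integrableOn_Ioo_of_le zero_le_one]
  have := h.memLp.mono_exponent (p := 1) one_le_two
  exact memLp_one_iff_integrable.1 this

theorem ac (h : IsH1 u u') : AbsolutelyContinuousOnInterval u 0 1 := by
  have h1 := h.intervalIntegrable.absolutelyContinuousOnInterval_intervalIntegral
    (c := 0) (by simp)
  have h2 : AbsolutelyContinuousOnInterval (fun _ : ℝ => u 0) 0 1 :=
    (LipschitzWith.const (u 0)).lipschitzOnWith.absolutelyContinuousOnInterval
  refine absolutelyContinuous_congr (h2.add h1) fun x hx => ?_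
  rw [uIcc_of_le zero_le_one] at hx
  exact (h.eq_integral x hx).symm

theorem continuousOn (h : IsH1 u u') : ContinuousOn u (Icc 0 1) := by
  simpa using h.ac.continuousOn

theorem ae_hasDerivAt (h : IsH1 u u') : ∀ᵐ x, x ∈ Ioo (0 : ℝ) 1 → HasDerivAt u (u' x) x := by
  filter_upwards [h.intervalIntegrable.ae_hasDerivAt_integral] with x hx hmem
  have := (hx (by rw [uIcc_of_le zero_le_one]; exact Ioo_subset_Icc_self hmem) 0
    (by simp)).const_add (u 0)
  refine this.congr_of_eventuallyEq ?_
  filter_upwards [Ioo_mem_nhds hmem.1 hmem.2] with t ht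
  exact h.eq_integral t (Ioo_subset_Icc_self ht)

theorem of_ac (hf : AbsolutelyContinuousOnInterval u 0 1)
    (hL : MemLp u' 2 (volume.restrict (Ioo (0 : ℝ) 1)))
    (h : ∀ᵐ t, t ∈ Ioo (0 : ℝ) 1 → HasDerivAt u (u' t) t) : IsH1 u u' := by
  refine ⟨hL, fun x hx => ?_⟩
  have := (integral_eq_sub_of_ac (f' := u') hx.1 (hf.mono (by
    rw [uIcc_of_le hx.1, uIcc_of_le zero_le_one]; exact Icc_subset_Icc_right hx.2)) (by
      filter_upwards [h] with t ht hmem using ht ⟨hmem.1, hmem.2.trans_le hx.2⟩)).2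
  rw [this]; ring

theorem sq_intervalIntegrable (h : IsH1 u u') :
    IntervalIntegrable (fun t => u' t ^ 2) volume 0 1 := by
  rw [intervalIntegrable_iff_integrableOn_Ioo_of_le zero_le_one]
  exact h.memLp.integrable_sq

theorem mul_intervalIntegrable {v v' : ℝ → ℝ} (h : IsH1 u u') (hv : IsH1 v v') :
    IntervalIntegrable (fun t => u' t * v' t) volume 0 1 := by
  rw [intervalIntegrable_iff_integrableOn_Ioo_of_le zero_le_one]
  exact h.memLp.integrable_mul hv.memLp

theorem ac_mono (h : IsH1 u u') {x y : ℝ} (hx : 0 ≤ x) (hxy : x ≤ y) (hy : y ≤ 1) :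
    AbsolutelyContinuousOnInterval u x y :=
  h.ac.mono (by rw [uIcc_of_le hxy, uIcc_of_le zero_le_one]; exact Icc_subset_Icc hx hy)

theorem ae_hasDerivAt_mono (h : IsH1 u u') {x y : ℝ} (hx : 0 ≤ x) (hy : y ≤ 1) :
    ∀ᵐ t, t ∈ Ioo x y → HasDerivAt u (u' t) t := by
  filter_upwards [h.ae_hasDerivAt] with t ht hmem
  exact ht ⟨hx.trans_lt hmem.1, hmem.2.trans_le hy⟩

theorem continuousOn_mono (h : IsH1 u u') {x y : ℝ} (hx : 0 ≤ x) (hy : y ≤ 1) :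
    ContinuousOn u (Icc x y) := h.continuousOn.mono (Icc_subset_Icc hx hy)

end IsH1

theorem _root_.IntervalIntegrable.restrict_unit {f : ℝ → ℝ} (h : IntervalIntegrable f volume 0 1)
    {x y : ℝ} (hx : 0 ≤ x) (hxy : x ≤ y) (hy : y ≤ 1) : IntervalIntegrable f volume x y :=
  h.mono_set (by rw [uIcc_of_le hxy, uIcc_of_le zero_le_one]; exact Icc_subset_Icc hx hy)

theorem ac_of_hasDerivAt {f f' : ℝ → ℝ} {x y : ℝ} (hxy : x ≤ y)
    (hf : ∀ t ∈ Icc x y, HasDerivAt f (f' t) t) (hf' : ContinuousOn f' (Icc x y)) :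
    AbsolutelyContinuousOnInterval f x y := by
  obtain ⟨C, hC⟩ := isCompact_Icc.exists_bound_of_continuousOn hf'
  have : LipschitzOnWith C.toNNReal f (Icc x y) := by
    refine (convex_Icc x y).lipschitzOnWith_of_nnnorm_hasDerivWithin_le
      (fun t ht => (hf t ht).hasDerivWithinAt) fun t ht => ?_
    rw [← NNReal.coe_le_coe, coe_nnnorm]
    exact (hC t ht).trans (Real.le_coe_toNNReal C)
  rw [← uIcc_of_le hxy] at this
  exact this.absolutelyContinuousOnInterval

/-- Integration by parts for an `H¹` function and a `C¹` function. -/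
theorem IsH1.integral_parts {v v' f f' : ℝ → ℝ} {x y : ℝ} (hv : IsH1 v v')
    (hx : 0 ≤ x) (hxy : x ≤ y) (hy : y ≤ 1)
    (hf : ∀ t ∈ Icc x y, HasDerivAt f (f' t) t) (hf' : ContinuousOn f' (Icc x y)) :
    ∫ t in x..y, f t * v' t = f y * v y - f x * v x - ∫ t in x..y, f' t * v t := by
  have hc : ContinuousOn f (uIcc x y) := by
    rw [uIcc_of_le hxy]; exact fun t ht => (hf t ht).continuousAt.continuousWithinAt
  have hac := (ac_of_hasDerivAt hxy hf hf').mul (hv.ac_mono hx hxy hy)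
  have h1 := (integral_eq_sub_of_ac (f' := fun t => f' t * v t + f t * v' t) hxy hac (by
    filter_upwards [hv.ae_hasDerivAt_mono hx hy] with t ht hmem
    exact (hf t (Ioo_subset_Icc_self hmem)).mul (ht hmem))).2
  rw [intervalIntegral.integral_add] at h1
  · simp only [Pi.mul_apply] at h1; linarith
  · exact (ContinuousOn.mul hf' (hv.continuousOn_mono hx hy)).intervalIntegrable_of_Icc hxy
  · exact (hv.intervalIntegrable.restrict_unit hx hxy hy).continuousOn_mul hc

/-- Picone's inequality in Riccati form, on an interval where the weight is the constant `m`. -/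
theorem IsH1.riccati_le {v v' p : ℝ → ℝ} {x y m : ℝ} (hv : IsH1 v v')
    (hx : 0 ≤ x) (hxy : x ≤ y) (hy : y ≤ 1)
    (hp : ∀ t ∈ Icc x y, HasDerivAt p (-m - p t ^ 2) t) :
    m * ∫ t in x..y, v t ^ 2 ≤
      (∫ t in x..y, v' t ^ 2) + p x * v x ^ 2 - p y * v y ^ 2 := by
  have hpc : ContinuousOn p (Icc x y) := fun t ht => (hp t ht).continuousAt.continuousWithinAt
  have hvc := hv.continuousOn_mono hx hy
  have hac := (ac_of_hasDerivAt hxy hp (by fun_prop)).mul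
    ((hv.ac_mono hx hxy hy).mul (hv.ac_mono hx hxy hy))
  have h1 := (integral_eq_sub_of_ac
    (f' := fun t => (-m - p t ^ 2) * v t ^ 2 + 2 * p t * v t * v' t) hxy hac (by
    filter_upwards [hv.ae_hasDerivAt_mono hx hy] with t ht hmem
    refine ((hp t (Ioo_subset_Icc_self hmem)).mul ((ht hmem).mul (ht hmem))).congr_deriv ?_
    simp only [Pi.mul_apply]; ring)).2
  simp only [Pi.mul_apply] at h1
  have i1 : IntervalIntegrable (fun t => (-m - p t ^ 2) * v t ^ 2) volume x y :=
    ContinuousOn.intervalIntegrable_of_Icc hxy (by fun_prop)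
  have i2 : IntervalIntegrable (fun t => 2 * p t * v t * v' t) volume x y := by
    refine (hv.intervalIntegrable.restrict_unit hx hxy hy).continuousOn_mul ?_
    rw [uIcc_of_le hxy]; fun_prop
  have i3 := hv.sq_intervalIntegrable.restrict_unit hx hxy hy
  have i4 : IntervalIntegrable (fun t => v t ^ 2) volume x y :=
    ContinuousOn.intervalIntegrable_of_Icc hxy (by fun_prop)
  -- The integrand equals (v' - p v)²; the terms in m cancel by the Riccati equation.
  have h2 : 0 ≤ ∫ t in x..y, (v' t ^ 2 - m * v t ^ 2 -
      ((-m - p t ^ 2) * v t ^ 2 + 2 * p t * v t * v' t)) :=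
    intervalIntegral.integral_nonneg hxy fun t _ => by nlinarith [sq_nonneg (v' t - p t * v t)]
  rw [intervalIntegral.integral_sub (i3.sub (i4.const_mul m)) (i1.add i2), h1,
    intervalIntegral.integral_sub i3 (i4.const_mul m), intervalIntegral.integral_const_mul] at h2
  linarith

/-! ### Auxiliary inequalities for elementary functions -/

/-- This is x f'(x) < f(x) for f = arctan. It makes arctan(x)/x decrease, and it is the source of
the strict inequality behind uniqueness of the frequency. -/
theorem div_one_add_sq_lt_arctan {y : ℝ} (hy : 0 < y) : y / (1 + y ^ 2) < Real.arctan y := by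
  have hd : ∀ x : ℝ, HasDerivAt (fun x => Real.arctan x - x / (1 + x ^ 2))
      (1 / (1 + x ^ 2) - (1 * (1 + x ^ 2) - x * (2 * x)) / (1 + x ^ 2) ^ 2) x := fun x => by
    have h2 : HasDerivAt (fun x : ℝ => 1 + x ^ 2) (2 * x) x := by
      simpa using (hasDerivAt_pow 2 x).const_add 1
    exact (Real.hasDerivAt_arctan x).sub ((hasDerivAt_id x).div h2 (by positivity))
  have hm : StrictMonoOn (fun x => Real.arctan x - x / (1 + x ^ 2)) (Ici 0) := by
    refine strictMonoOn_of_deriv_pos (convex_Ici 0)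
      (fun x _ => (hd x).continuousAt.continuousWithinAt) fun x hx => ?_
    rw [interior_Ici, mem_Ioi] at hx
    rw [(hd x).deriv, show 1 / (1 + x ^ 2) - (1 * (1 + x ^ 2) - x * (2 * x)) / (1 + x ^ 2) ^ 2 =
      2 * x ^ 2 / (1 + x ^ 2) ^ 2 by field_simp; ring]
    positivity
  have := hm self_mem_Ici hy.le hy
  simp at this
  linarith

theorem hasDerivAt_tanh (x : ℝ) : HasDerivAt Real.tanh (1 - Real.tanh x ^ 2) x := by
  have := (Real.hasDerivAt_sinh x).div (Real.hasDerivAt_cosh x) (Real.cosh_pos x).ne'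
  have e : Real.tanh = Real.sinh / Real.cosh := by
    ext y; exact Real.tanh_eq_sinh_div_cosh y
  rw [e]
  refine this.congr_deriv ?_
  have := (Real.cosh_pos x).ne'
  simp only [Pi.div_apply]
  field_simp

theorem le_sinh_mul_cosh {x : ℝ} (hx : 0 ≤ x) : x ≤ Real.sinh x * Real.cosh x := by
  nlinarith [Real.self_le_sinh_iff.2 hx, Real.one_le_cosh x]

theorem strictMono_tanh : StrictMono Real.tanh := by
  refine strictMono_of_deriv_pos fun x => ?_
  rw [(hasDerivAt_tanh x).deriv]
  linarith [Real.tanh_sq_lt_one x]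

theorem tanh_nonneg {x : ℝ} (hx : 0 ≤ x) : 0 ≤ Real.tanh x := by
  simpa using strictMono_tanh.monotone hx

/-- A function `f` with `x f'(x) ≤ f(x)` has a nonincreasing quotient `f(x) / x`. -/
theorem div_self_antitone {f f' : ℝ → ℝ} (hf : ∀ x, 0 < x → HasDerivAt f (f' x) x)
    (h : ∀ x, 0 < x → x * f' x ≤ f x) {x y : ℝ} (hx : 0 < x) (hxy : x ≤ y) :
    f y / y ≤ f x / x := by
  have hd : ∀ x, 0 < x → HasDerivAt (fun x => f x / x) ((f' x * x - f x * 1) / x ^ 2) x :=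
    fun x hx => (hf x hx).div (hasDerivAt_id x) hx.ne'
  have : AntitoneOn (fun x => f x / x) (Ioi 0) := by
    refine antitoneOn_of_deriv_nonpos (convex_Ioi 0)
      (fun x hx => (hd x hx).continuousAt.continuousWithinAt)
      (fun x hx => (hd x (by simpa using hx)).differentiableAt.differentiableWithinAt)
      fun x hx => ?_
    have hx : 0 < x := by simpa using hx
    rw [(hd x hx).deriv]
    exact div_nonpos_of_nonpos_of_nonneg (by linarith [h x hx]) (by positivity)
  exact this hx (hx.trans_le hxy) hxy

theorem div_self_strictAnti {f f' : ℝ → ℝ} (hf : ∀ x, 0 < x → HasDerivAt f (f' x) x)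
    (h : ∀ x, 0 < x → x * f' x < f x) {x y : ℝ} (hx : 0 < x) (hxy : x < y) :
    f y / y < f x / x := by
  have hd : ∀ x, 0 < x → HasDerivAt (fun x => f x / x) ((f' x * x - f x * 1) / x ^ 2) x :=
    fun x hx => (hf x hx).div (hasDerivAt_id x) hx.ne'
  have : StrictAntiOn (fun x => f x / x) (Ioi 0) := by
    refine strictAntiOn_of_deriv_neg (convex_Ioi 0)
      (fun x hx => (hd x hx).continuousAt.continuousWithinAt) fun x hx => ?_
    have hx : 0 < x := by simpa using hx
    rw [(hd x hx).deriv]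
    exact div_neg_of_neg_of_pos (by linarith [h x hx]) (by positivity)
  exact this hx (hx.trans hxy) hxy

theorem tanh_div_antitone {x y : ℝ} (hx : 0 < x) (hxy : x ≤ y) :
    Real.tanh y / y ≤ Real.tanh x / x := by
  refine div_self_antitone (fun x _ => hasDerivAt_tanh x) (fun x hx => ?_) hx hxy
  have hc := Real.cosh_pos x
  have h1 := le_sinh_mul_cosh hx.le
  have h2 := Real.cosh_sq x
  rw [Real.tanh_eq_sinh_div_cosh]
  have : 1 - (Real.sinh x / Real.cosh x) ^ 2 = 1 / Real.cosh x ^ 2 := by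
    field_simp; linarith
  rw [this, mul_one_div, div_le_div_iff₀ (by positivity) hc]
  nlinarith

theorem arctan_div_antitone {x y : ℝ} (hx : 0 < x) (hxy : x ≤ y) :
    Real.arctan y / y ≤ Real.arctan x / x := by
  refine div_self_antitone (fun x _ => Real.hasDerivAt_arctan x) (fun x hx => ?_) hx hxy
  rw [mul_one_div]
  exact (div_one_add_sq_lt_arctan hx).le

/-! ### The logarithmic derivative at the edge of the favourable interval -/

/-- `φ'/(w φ)` at distance `s` from the boundary point, for the solution `φ` of `φ'' = w² φ`
with the Robin condition `φ' = β φ` at the boundary point. -/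
def edgeSlope (β w s : ℝ) : ℝ :=
  (β * Real.cosh (w * s) + w * Real.sinh (w * s)) /
    (w * Real.cosh (w * s) + β * Real.sinh (w * s))

/-- The phase that corresponds to `edgeSlope` for the equation `φ'' = -κ w² φ`. -/
def edgeAngle (κ β w s : ℝ) : ℝ := Real.arctan (edgeSlope β w s / √κ)

/-- The characteristic function of the problem for the favourable interval `(a, a + c)`, where
`l` is the total length of the complement. -/
def charFn (κ c l β₀ β₁ a w : ℝ) : ℝ :=
  edgeAngle κ β₀ w a + edgeAngle κ β₁ w (l - a) - w * √κ * c

/-- The function that determines the sign of the derivative of the eigenvalue. -/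
def asym (l β₀ β₁ a w : ℝ) : ℝ :=
  (w ^ 2 - β₀ * β₁) * Real.tanh (w * (l - 2 * a)) + w * (β₁ - β₀)

section edge

variable {κ β w s : ℝ}

theorem edgeDen_pos (hβ : 0 < β) (hw : 0 < w) (hs : 0 ≤ s) :
    0 < w * Real.cosh (w * s) + β * Real.sinh (w * s) := by
  have := Real.cosh_pos (w * s)
  have := Real.sinh_nonneg_iff.2 (mul_nonneg hw.le hs)
  positivity

theorem edgeNum_pos (hβ : 0 < β) (hw : 0 < w) (hs : 0 ≤ s) :
    0 < β * Real.cosh (w * s) + w * Real.sinh (w * s) := by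
  have := Real.cosh_pos (w * s)
  have := Real.sinh_nonneg_iff.2 (mul_nonneg hw.le hs)
  positivity

theorem edgeSlope_pos (hβ : 0 < β) (hw : 0 < w) (hs : 0 ≤ s) : 0 < edgeSlope β w s :=
  div_pos (edgeNum_pos hβ hw hs) (edgeDen_pos hβ hw hs)

theorem edgeAngle_pos (hκ : 0 < κ) (hβ : 0 < β) (hw : 0 < w) (hs : 0 ≤ s) :
    0 < edgeAngle κ β w s :=
  Real.arctan_pos.2 (div_pos (edgeSlope_pos hβ hw hs) (Real.sqrt_pos.2 hκ))

theorem edgeSlope_zero : edgeSlope β w 0 = β / w := by simp [edgeSlope]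

theorem hasDerivAt_edgeSlope_pos (hβ : 0 < β) (hw : 0 < w) (hs : 0 ≤ s) :
    HasDerivAt (fun s => edgeSlope β w s) (w * (1 - edgeSlope β w s ^ 2)) s := by
  have hl : HasDerivAt (fun s => w * s) w s := by simpa using (hasDerivAt_id s).const_mul w
  have hC : HasDerivAt (fun s => Real.cosh (w * s)) (Real.sinh (w * s) * w) s := hl.cosh
  have hS : HasDerivAt (fun s => Real.sinh (w * s)) (Real.cosh (w * s) * w) s := hl.sinh
  have hD := edgeDen_pos hβ hw hs
  refine (((hC.const_mul β).add (hS.const_mul w)).div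
    ((hC.const_mul w).add (hS.const_mul β)) hD.ne').congr_deriv ?_
  unfold edgeSlope
  simp only [Pi.add_apply]
  field_simp
  ring

theorem hasDerivAt_edgeSlope_freq (hβ : 0 < β) (hw : 0 < w) (hs : 0 ≤ s) :
    HasDerivAt (fun w => edgeSlope β w s) ((s * (w ^ 2 - β ^ 2) - β) /
      (w * Real.cosh (w * s) + β * Real.sinh (w * s)) ^ 2) w := by
  have hl : HasDerivAt (fun w => w * s) s w := by simpa using (hasDerivAt_id w).mul_const s
  have hC : HasDerivAt (fun w => Real.cosh (w * s)) (Real.sinh (w * s) * s) w := hl.cosh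
  have hS : HasDerivAt (fun w => Real.sinh (w * s)) (Real.cosh (w * s) * s) w := hl.sinh
  have hD := edgeDen_pos hβ hw hs
  refine (((hC.const_mul β).add ((hasDerivAt_id w).mul hS)).div
    (((hasDerivAt_id w).mul hC).add (hS.const_mul β)) hD.ne').congr_deriv ?_
  simp only [Pi.add_apply, Pi.mul_apply, id]
  congr 1
  have := Real.cosh_sq (w * s)
  linear_combination (s * (w ^ 2 - β ^ 2) - β) * this

/-- Needed to make `edgeAngle` / w decrease in w. After clearing denominators the only positive term
on the left is w²·(ws), and ws ≤ sinh(ws) cosh(ws) absorbs it. -/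
theorem freq_mul_deriv_edgeSlope_le (hβ : 0 < β) (hw : 0 < w) (hs : 0 ≤ s) :
    w * ((s * (w ^ 2 - β ^ 2) - β) /
      (w * Real.cosh (w * s) + β * Real.sinh (w * s)) ^ 2) ≤ edgeSlope β w s := by
  have hD := edgeDen_pos hβ hw hs
  have hC := Real.cosh_pos (w * s)
  have hS := Real.sinh_nonneg_iff.2 (mul_nonneg hw.le hs)
  unfold edgeSlope
  rw [mul_div_assoc', div_le_div_iff₀ (by positivity) hD]
  have h1 := le_sinh_mul_cosh (mul_nonneg hw.le hs)
  have h2 : w * (s * (w ^ 2 - β ^ 2) - β) ≤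
      (β * Real.cosh (w * s) + w * Real.sinh (w * s)) *
        (w * Real.cosh (w * s) + β * Real.sinh (w * s)) := by
    have e : (β * Real.cosh (w * s) + w * Real.sinh (w * s)) *
        (w * Real.cosh (w * s) + β * Real.sinh (w * s)) =
        (w ^ 2 + β ^ 2) * (Real.sinh (w * s) * Real.cosh (w * s)) +
          w * β * (Real.cosh (w * s) ^ 2 + Real.sinh (w * s) ^ 2) := by ring
    rw [e]
    have h3 : w ^ 2 * (w * s) ≤ w ^ 2 * (Real.sinh (w * s) * Real.cosh (w * s)) := by gcongr
    have h4 : 0 ≤ β ^ 2 * (Real.sinh (w * s) * Real.cosh (w * s)) := by positivity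
    have h5 : 0 ≤ w * β * (Real.cosh (w * s) ^ 2 + Real.sinh (w * s) ^ 2) := by positivity
    have h6 : 0 ≤ β ^ 2 * (w * s) := by positivity
    nlinarith [mul_pos hw hβ]
  nlinarith

theorem hasDerivAt_edgeAngle_pos (hκ : 0 < κ) (hβ : 0 < β) (hw : 0 < w) (hs : 0 ≤ s) :
    HasDerivAt (fun s => edgeAngle κ β w s)
      (w * √κ * ((1 - edgeSlope β w s ^ 2) / (κ + edgeSlope β w s ^ 2))) s := by
  refine ((hasDerivAt_edgeSlope_pos hβ hw hs).div_const √κ).arctan.congr_deriv ?_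
  have h1 := Real.sqrt_pos.2 hκ
  have h2 := Real.sq_sqrt hκ.le
  rw [div_pow, h2]
  field_simp
  rw [h2]
  ring

/-- The derivative of `edgeAngle` with respect to the frequency. -/
def edgeAngleFreqDeriv (κ β w s : ℝ) : ℝ :=
  1 / (1 + (edgeSlope β w s / √κ) ^ 2) * ((s * (w ^ 2 - β ^ 2) - β) /
      (w * Real.cosh (w * s) + β * Real.sinh (w * s)) ^ 2 / √κ)

theorem hasDerivAt_edgeAngle_freq (hβ : 0 < β) (hw : 0 < w) (hs : 0 ≤ s) :
    HasDerivAt (fun w => edgeAngle κ β w s) (edgeAngleFreqDeriv κ β w s) w :=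
  ((hasDerivAt_edgeSlope_freq hβ hw hs).div_const √κ).arctan

/-- With y = `edgeSlope` / √κ, the chain rule bounds the left side by y/(1 + y²), which is below
arctan y. -/
theorem freq_mul_edgeAngleFreqDeriv_lt (hκ : 0 < κ) (hβ : 0 < β) (hw : 0 < w) (hs : 0 ≤ s) :
    w * edgeAngleFreqDeriv κ β w s < edgeAngle κ β w s := by
  have h1 := Real.sqrt_pos.2 hκ
  have h2 := freq_mul_deriv_edgeSlope_le hβ hw hs
  have h3 := edgeSlope_pos hβ hw hs
  refine lt_of_le_of_lt ?_ (div_one_add_sq_lt_arctan (div_pos h3 h1))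
  unfold edgeAngleFreqDeriv
  rw [show ∀ a b : ℝ, w * (1 / (1 + (edgeSlope β w s / √κ) ^ 2) * (a / b)) =
    (w * a / b) / (1 + (edgeSlope β w s / √κ) ^ 2) from fun a b => by ring]
  gcongr

theorem edgeAngle_lt : edgeAngle κ β w s < Real.pi / 2 := Real.arctan_lt_pi_div_two _

/-- From sinh x ≤ x cosh x. The bound grows like 1/w as w → 0, which makes `charFn` nonnegative at
small frequencies. -/
theorem le_edgeSlope (hβ : 0 < β) (hw : 0 < w) (hs : 0 ≤ s) :
    β / (w * (1 + β * s)) ≤ edgeSlope β w s := by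
  have hC := Real.cosh_pos (w * s)
  have hS := Real.sinh_nonneg_iff.2 (mul_nonneg hw.le hs)
  have h1 : Real.sinh (w * s) ≤ w * s * Real.cosh (w * s) := by
    have hd : ∀ x : ℝ, HasDerivAt (fun x => x * Real.cosh x - Real.sinh x)
        (1 * Real.cosh x + x * Real.sinh x - Real.cosh x) x := fun x =>
      ((hasDerivAt_id x).mul (Real.hasDerivAt_cosh x)).sub (Real.hasDerivAt_sinh x)
    have : MonotoneOn (fun x => x * Real.cosh x - Real.sinh x) (Ici 0) := by
      refine monotoneOn_of_deriv_nonneg (convex_Ici 0)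
        (fun x _ => (hd x).continuousAt.continuousWithinAt)
        (fun x _ => (hd x).differentiableAt.differentiableWithinAt) fun x hx => ?_
      rw [interior_Ici, mem_Ioi] at hx
      rw [(hd x).deriv]
      have := Real.sinh_nonneg_iff.2 hx.le
      nlinarith
    have := this self_mem_Ici (mul_nonneg hw.le hs) (mul_nonneg hw.le hs)
    simp at this
    linarith
  unfold edgeSlope
  rw [div_le_div_iff₀ (by positivity) (edgeDen_pos hβ hw hs)]
  have h2 : β * Real.sinh (w * s) ≤ β * (w * s * Real.cosh (w * s)) := by gcongr
  have h3 : 0 ≤ w * Real.sinh (w * s) * (w * (1 + β * s)) := by positivity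
  nlinarith

end edge

/-! ### The characteristic function: its derivatives and its zero -/

section charFn

variable {κ c l β₀ β₁ a w : ℝ}

/-- Over the common denominator the numerator is, by the addition theorems for w(l - a) and wa, a
combination of sinh and cosh of w(l - 2a); factoring out the cosh leaves `asym`. -/
theorem edgeSlope_sub_edgeSlope (h₀ : 0 < β₀) (h₁ : 0 < β₁) (hw : 0 < w) (ha : a ∈ Icc 0 l) :
    edgeSlope β₁ w (l - a) - edgeSlope β₀ w a =
      asym l β₀ β₁ a w * (Real.cosh (w * (l - 2 * a)) /
        ((w * Real.cosh (w * a) + β₀ * Real.sinh (w * a)) *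
          (w * Real.cosh (w * (l - a)) + β₁ * Real.sinh (w * (l - a))))) := by
  have h2 := edgeDen_pos h₀ hw ha.1
  have h3 := edgeDen_pos h₁ hw (sub_nonneg.2 ha.2)
  have h4 := Real.cosh_pos (w * (l - 2 * a))
  have e1 : w * (l - 2 * a) = w * (l - a) - w * a := by ring
  unfold edgeSlope asym
  rw [Real.tanh_eq_sinh_div_cosh]
  rw [div_sub_div _ _ h3.ne' h2.ne', mul_div_assoc', mul_comm (w * Real.cosh (w * a) + _)]
  congr 1
  have e : ∀ x y z : ℝ, (x * (y / Real.cosh (w * (l - 2 * a))) + z) *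
      Real.cosh (w * (l - 2 * a)) = x * y + z * Real.cosh (w * (l - 2 * a)) :=
    fun x y z => by field_simp
  rw [e, e1, Real.sinh_sub, Real.cosh_sub]
  ring

/-- The positive factor between `asym` and the derivative of `charFn` in the position. -/
def slopeFactor (κ l β₀ β₁ a w : ℝ) : ℝ :=
  w * √κ * ((κ + 1) * (edgeSlope β₁ w (l - a) + edgeSlope β₀ w a) /
    ((κ + edgeSlope β₀ w a ^ 2) * (κ + edgeSlope β₁ w (l - a) ^ 2))) *
    (Real.cosh (w * (l - 2 * a)) /
        ((w * Real.cosh (w * a) + β₀ * Real.sinh (w * a)) *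
          (w * Real.cosh (w * (l - a)) + β₁ * Real.sinh (w * (l - a)))))

theorem slopeFactor_pos (hκ : 0 < κ) (h₀ : 0 < β₀) (h₁ : 0 < β₁) (hw : 0 < w)
    (ha : a ∈ Icc 0 l) : 0 < slopeFactor κ l β₀ β₁ a w := by
  have h2 := edgeDen_pos h₀ hw ha.1
  have h3 := edgeDen_pos h₁ hw (sub_nonneg.2 ha.2)
  have h4 := Real.cosh_pos (w * (l - 2 * a))
  have h5 := edgeSlope_pos h₀ hw ha.1
  have h6 := edgeSlope_pos h₁ hw (sub_nonneg.2 ha.2)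
  have h7 := Real.sqrt_pos.2 hκ
  unfold slopeFactor
  positivity

/-- The two phases change at rates h(x) and -h(y), up to the factor w√κ, where h(x) = (1 - x²)/(κ +
x²) and x, y are the slopes at the left and right edges. Here h(x) - h(y) is a positive multiple of
(y + x)(y - x), and y - x is a positive multiple of `asym`. -/
theorem hasDerivAt_charFn_pos (hκ : 0 < κ) (h₀ : 0 < β₀) (h₁ : 0 < β₁) (hw : 0 < w)
    (ha : a ∈ Icc 0 l) : HasDerivAt (fun a => charFn κ c l β₀ β₁ a w)
      (slopeFactor κ l β₀ β₁ a w * asym l β₀ β₁ a w) a := by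
  have hl : HasDerivAt (fun a => l - a) (-1) a := by simpa using (hasDerivAt_id a).const_sub l
  have := ((hasDerivAt_edgeAngle_pos hκ h₁ hw (sub_nonneg.2 ha.2)).comp a hl)
  refine (((hasDerivAt_edgeAngle_pos hκ h₀ hw ha.1).add this).sub_const _).congr_deriv ?_
  have h := edgeSlope_sub_edgeSlope h₀ h₁ hw ha
  trans w * √κ * ((κ + 1) * (edgeSlope β₁ w (l - a) + edgeSlope β₀ w a) /
    ((κ + edgeSlope β₀ w a ^ 2) * (κ + edgeSlope β₁ w (l - a) ^ 2))) *
    (edgeSlope β₁ w (l - a) - edgeSlope β₀ w a)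
  swap
  · rw [h, slopeFactor]; ring
  have : 0 < κ + edgeSlope β₀ w a ^ 2 := by positivity
  have : 0 < κ + edgeSlope β₁ w (l - a) ^ 2 := by positivity
  field_simp
  ring

theorem hasDerivAt_charFn_freq (h₀ : 0 < β₀) (h₁ : 0 < β₁) (hw : 0 < w)
    (ha : a ∈ Icc 0 l) : HasDerivAt (fun w => charFn κ c l β₀ β₁ a w)
      (edgeAngleFreqDeriv κ β₀ w a + edgeAngleFreqDeriv κ β₁ w (l - a) - √κ * c) w := by
  have hl : HasDerivAt (fun w => w * √κ * c) (√κ * c) w := by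
    simpa [mul_assoc] using (hasDerivAt_id w).mul_const (√κ * c)
  exact ((hasDerivAt_edgeAngle_freq h₀ hw ha.1).add
    (hasDerivAt_edgeAngle_freq h₁ hw (sub_nonneg.2 ha.2))).sub hl

theorem freq_mul_deriv_charFn_lt (hκ : 0 < κ) (h₀ : 0 < β₀) (h₁ : 0 < β₁) (hw : 0 < w)
    (ha : a ∈ Icc 0 l) :
    w * (edgeAngleFreqDeriv κ β₀ w a + edgeAngleFreqDeriv κ β₁ w (l - a) - √κ * c) <
      charFn κ c l β₀ β₁ a w := by
  have := freq_mul_edgeAngleFreqDeriv_lt hκ h₀ hw ha.1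
  have := freq_mul_edgeAngleFreqDeriv_lt hκ h₁ hw (sub_nonneg.2 ha.2)
  unfold charFn
  linarith

/-- The edge angles need not be monotone in w, but their quotients by w are, and the remaining term
of `charFn` is linear in w. Hence there is at most one positive zero. -/
theorem charFn_div_lt (hκ : 0 < κ) (h₀ : 0 < β₀) (h₁ : 0 < β₁) (hw : 0 < w)
    (ha : a ∈ Icc 0 l) {w' : ℝ} (hw' : w < w') :
    charFn κ c l β₀ β₁ a w' / w' < charFn κ c l β₀ β₁ a w / w :=
  div_self_strictAnti (fun _ hx => hasDerivAt_charFn_freq h₀ h₁ hx ha)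
    (fun _ hx => freq_mul_deriv_charFn_lt hκ h₀ h₁ hx ha) hw hw'

theorem exists_charFn_eq_zero (hκ : 0 < κ) (hc : 0 < c) (h₀ : 0 < β₀) (h₁ : 0 < β₁)
    (ha : a ∈ Icc 0 l) : ∃ w, 0 < w ∧ charFn κ c l β₀ β₁ a w = 0 := by
  have hk := Real.sqrt_pos.2 hκ
  have hl := sub_nonneg.2 ha.2
  have ha0 := ha.1
  have hpi := Real.pi_pos
  -- Below `w₁` both edge slopes are at least √κ, so each angle is at least π/4, while the linear
  -- term is at most π/2.
  set w₁ := min (min (β₀ / (√κ * (1 + β₀ * a))) (β₁ / (√κ * (1 + β₁ * (l - a)))))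
    (Real.pi / (2 * √κ * c)) with hw₁
  -- Here the linear term is π, more than two angles below π/2 can reach.
  set w₂ := Real.pi / (√κ * c) with hw₂
  have hw₁0 : 0 < w₁ := by
    refine lt_min (lt_min ?_ ?_) ?_ <;> positivity
  have hw₁₂ : w₁ ≤ w₂ := by
    refine (min_le_right _ _).trans ?_
    rw [hw₂]
    gcongr
    nlinarith
  have key : ∀ β s : ℝ, 0 < β → 0 ≤ s → w₁ ≤ β / (√κ * (1 + β * s)) →
      Real.pi / 4 ≤ edgeAngle κ β w₁ s := by
    intro β s hβ hs h
    rw [← Real.arctan_one]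
    refine Real.arctan_strictMono.monotone ?_
    rw [le_div_iff₀ hk, one_mul]
    refine le_trans ?_ (le_edgeSlope hβ hw₁0 hs)
    rw [le_div_iff₀ (by positivity)] at h ⊢
    linarith
  have g₁ : 0 ≤ charFn κ c l β₀ β₁ a w₁ := by
    have e1 := key β₀ a h₀ ha0 ((min_le_left _ _).trans (min_le_left _ _))
    have e2 := key β₁ (l - a) h₁ hl ((min_le_left _ _).trans (min_le_right _ _))
    have e3 : w₁ ≤ Real.pi / (2 * √κ * c) := min_le_right _ _
    rw [le_div_iff₀ (by positivity)] at e3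
    unfold charFn
    nlinarith
  have g₂ : charFn κ c l β₀ β₁ a w₂ ≤ 0 := by
    have e1 := edgeAngle_lt (κ := κ) (β := β₀) (w := w₂) (s := a)
    have e2 := edgeAngle_lt (κ := κ) (β := β₁) (w := w₂) (s := l - a)
    have e3 : w₂ * √κ * c = Real.pi := by rw [hw₂]; field_simp
    unfold charFn
    linarith
  obtain ⟨w, hw, h⟩ := intermediate_value_Icc' hw₁₂ (f := charFn κ c l β₀ β₁ a)
    (fun w hw => (hasDerivAt_charFn_freq h₀ h₁ (hw₁0.trans_le hw.1)
      ha).continuousAt.continuousWithinAt) ⟨g₂, g₁⟩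
  exact ⟨w, hw₁0.trans_le hw.1, h⟩

end charFn

/-! ### The flow of the Riccati equation on the unfavourable set -/

/-- The flow of `r' = w (1 - r²)`. -/
def flow (w t r : ℝ) : ℝ :=
  (r * Real.cosh (w * t) + Real.sinh (w * t)) / (Real.cosh (w * t) + r * Real.sinh (w * t))

/-- The denominator of the flow; the flow from `r` exists up to time `t` if it is positive. -/
def flowDen (w t r : ℝ) : ℝ := Real.cosh (w * t) + r * Real.sinh (w * t)

section flow

variable {κ w t s r r' : ℝ}

theorem flow_eq : flow w t r =
    (r * Real.cosh (w * t) + Real.sinh (w * t)) / flowDen w t r := rfl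

theorem flow_zero : flow w 0 r = r := by simp [flow]

theorem edgeSlope_eq_flow {β : ℝ} (hw : w ≠ 0) : edgeSlope β w s = flow w s (β / w) := by
  have e1 : w * (Real.cosh (w * s) + β / w * Real.sinh (w * s)) =
      w * Real.cosh (w * s) + β * Real.sinh (w * s) := by field_simp
  have e2 : w * (β / w * Real.cosh (w * s) + Real.sinh (w * s)) =
      β * Real.cosh (w * s) + w * Real.sinh (w * s) := by field_simp
  rw [edgeSlope, flow, ← e1, ← e2, mul_div_mul_left _ _ hw]

theorem flowDen_mono (hw : 0 < w) (ht : 0 ≤ t) (h : 0 < flowDen w t r) (hr : r ≤ r') :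
    0 < flowDen w t r' := by
  have := Real.sinh_nonneg_iff.2 (mul_nonneg hw.le ht)
  unfold flowDen at *
  nlinarith

theorem flow_mono (hw : 0 < w) (ht : 0 ≤ t) (h : 0 < flowDen w t r) (hr : r ≤ r') :
    flow w t r ≤ flow w t r' := by
  have h' := flowDen_mono hw ht h hr
  rw [flow_eq, flow_eq, div_le_div_iff₀ h h']
  unfold flowDen
  nlinarith [Real.cosh_sq (w * t)]

/-- A flow that survives up to time t has not blown up before. For r < 0 this uses cosh(wt)·D(s) =
cosh(ws)·D(t) - r sinh(w(t - s)), with D the denominator. -/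
theorem flowDen_antitone (hw : 0 < w) (hs : 0 ≤ s) (hst : s ≤ t) (h : 0 < flowDen w t r) :
    0 < flowDen w s r := by
  have hS := Real.sinh_nonneg_iff.2 (mul_nonneg hw.le hs)
  have hCs := Real.cosh_pos (w * s)
  have hCt := Real.cosh_pos (w * t)
  have h1 : 0 ≤ Real.sinh (w * t - w * s) :=
    Real.sinh_nonneg_iff.2 (by nlinarith)
  rw [Real.sinh_sub] at h1
  unfold flowDen at *
  rcases le_or_gt 0 r with hr | hr
  · positivity
  · have : 0 < Real.cosh (w * t) * (Real.cosh (w * s) + r * Real.sinh (w * s)) := by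
      nlinarith [mul_pos hCs h]
    exact (pos_iff_pos_of_mul_pos this).1 hCt

theorem flowDen_flow (h : flowDen w s r ≠ 0) :
    flowDen w t (flow w s r) = flowDen w (s + t) r / flowDen w s r := by
  rw [eq_div_iff h, flow_eq]
  nth_rw 1 [flowDen]
  rw [add_mul, mul_right_comm, div_mul_cancel₀ _ h]
  unfold flowDen
  rw [mul_add w, Real.cosh_add, Real.sinh_add]
  ring

theorem flow_flow (h : flowDen w s r ≠ 0) :
    flow w t (flow w s r) = flow w (s + t) r := by
  rw [flow_eq (t := t), flowDen_flow h, div_div_eq_mul_div, flow_eq (t := s + t)]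
  congr 1
  rw [flow_eq (t := s), add_mul, mul_right_comm, div_mul_cancel₀ _ h]
  unfold flowDen
  rw [mul_add w, Real.cosh_add, Real.sinh_add]
  ring

theorem hasDerivAt_flow_time (h : flowDen w t r ≠ 0) :
    HasDerivAt (fun t => flow w t r) (w * (1 - flow w t r ^ 2)) t := by
  have hl : HasDerivAt (fun s => w * s) w t := by simpa using (hasDerivAt_id t).const_mul w
  have hC : HasDerivAt (fun s => Real.cosh (w * s)) (Real.sinh (w * t) * w) t := hl.cosh
  have hS : HasDerivAt (fun s => Real.sinh (w * s)) (Real.cosh (w * t) * w) t := hl.sinh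
  unfold flowDen at h
  refine (((hC.const_mul r).add hS).div (hC.add (hS.const_mul r)) h).congr_deriv ?_
  unfold flow
  simp only [Pi.add_apply]
  field_simp
  ring

theorem hasDerivAt_flow_init (h : flowDen w t r ≠ 0) :
    HasDerivAt (fun r => flow w t r) (1 / flowDen w t r ^ 2) r := by
  have h1 : HasDerivAt (fun r => r * Real.cosh (w * t) + Real.sinh (w * t))
      (Real.cosh (w * t)) r := by
    simpa using ((hasDerivAt_id r).mul_const (Real.cosh (w * t))).add_const (Real.sinh (w * t))
  have h2 : HasDerivAt (fun r => flowDen w t r) (Real.sinh (w * t)) r := by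
    refine (((hasDerivAt_id r).mul_const (Real.sinh (w * t))).const_add
      (Real.cosh (w * t))).congr_deriv (one_mul _)
  refine (h1.div h2 h).congr_deriv ?_
  congr 1
  unfold flowDen
  linear_combination Real.cosh_sq (w * t)

/-- The change of phase along the flow. -/
def phaseShift (κ w t r : ℝ) : ℝ := Real.arctan (flow w t r / √κ) - Real.arctan (r / √κ)

/-- The change of phase increases with the initial value where this is negative, and decreases
where it is positive. -/
def pivot (w t r : ℝ) : ℝ := Real.sinh (w * t) * (1 + r ^ 2) + 2 * r * Real.cosh (w * t)

/-- The derivative of `pivot` in r is twice `flowDen`. So `phaseShift` first rises and then falls as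
the initial slope grows. -/
theorem pivot_mono (hw : 0 < w) (ht : 0 ≤ t) (h : 0 < flowDen w t r) (hr : r ≤ r') :
    pivot w t r ≤ pivot w t r' := by
  have h' := flowDen_mono hw ht h hr
  unfold flowDen at *
  unfold pivot
  nlinarith

theorem hasDerivAt_phaseShift (hκ : 0 < κ) (h : flowDen w t r ≠ 0) :
    HasDerivAt (fun r => phaseShift κ w t r)
      (-(Real.sinh (w * t) * pivot w t r) * (√κ * (κ + 1) /
        ((κ * flowDen w t r ^ 2 + (r * Real.cosh (w * t) + Real.sinh (w * t)) ^ 2) *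
          (κ + r ^ 2)))) r := by
  have hk := Real.sqrt_pos.2 hκ
  have h2 := Real.sq_sqrt hκ.le
  have h1 := ((hasDerivAt_flow_init h).div_const √κ).arctan.sub
    ((hasDerivAt_id r).div_const √κ).arctan
  refine h1.congr_deriv ?_
  have e1 : 0 < κ * flowDen w t r ^ 2 + (r * Real.cosh (w * t) + Real.sinh (w * t)) ^ 2 := by
    positivity
  have e2 : 0 < κ + r ^ 2 := by positivity
  have a1 : 1 / (1 + (flow w t r / √κ) ^ 2) * (1 / flowDen w t r ^ 2 / √κ) =
      √κ / (κ * flowDen w t r ^ 2 + (r * Real.cosh (w * t) + Real.sinh (w * t)) ^ 2) := by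
    rw [flow_eq, div_pow, div_pow, h2]
    field_simp
    rw [h2]
  have a2 : 1 / (1 + (id r / √κ) ^ 2) * (1 / √κ) = √κ / (κ + r ^ 2) := by
    rw [id, div_pow, h2]
    field_simp
    rw [h2]
  rw [a1, a2, div_sub_div _ _ e1.ne' e2.ne', mul_div_assoc']
  congr 1
  unfold flowDen pivot
  linear_combination √κ * (-(κ + r ^ 2 * 1)) * Real.cosh_sq (w * t)

/-- Since `pivot` is monotone, its sign at the upper end r' holds on all of [r, r']. Together with
the companion for a nonnegative sign this is the unimodality of `phaseShift`. -/
theorem phaseShift_le_of_pivot_nonpos (hκ : 0 < κ) (hw : 0 < w) (ht : 0 ≤ t)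
    (h : 0 < flowDen w t r) (hr : r ≤ r') (hp : pivot w t r' ≤ 0) :
    phaseShift κ w t r ≤ phaseShift κ w t r' := by
  have hS := Real.sinh_nonneg_iff.2 (mul_nonneg hw.le ht)
  have hd := fun x (hx : x ∈ Icc r r') =>
    hasDerivAt_phaseShift hκ (flowDen_mono hw ht h hx.1).ne'
  have : MonotoneOn (fun r => phaseShift κ w t r) (Icc r r') := by
    refine monotoneOn_of_deriv_nonneg (convex_Icc _ _)
      (fun x hx => (hd x hx).continuousAt.continuousWithinAt)
      (fun x hx => (hd x (interior_subset hx)).differentiableAt.differentiableWithinAt)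
      fun x hx => ?_
    have hx := interior_subset hx
    rw [(hd x hx).deriv]
    have h1 := (pivot_mono hw ht (flowDen_mono hw ht h hx.1) hx.2).trans hp
    exact mul_nonneg (neg_nonneg.2 (mul_nonpos_of_nonneg_of_nonpos hS h1)) (by positivity)
  exact this ⟨le_rfl, hr⟩ ⟨hr, le_rfl⟩ hr

theorem phaseShift_le_of_pivot_nonneg (hκ : 0 < κ) (hw : 0 < w) (ht : 0 ≤ t)
    (h : 0 < flowDen w t r) (hr : r ≤ r') (hp : 0 ≤ pivot w t r) :
    phaseShift κ w t r' ≤ phaseShift κ w t r := by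
  have hS := Real.sinh_nonneg_iff.2 (mul_nonneg hw.le ht)
  have hd := fun x (hx : x ∈ Icc r r') =>
    hasDerivAt_phaseShift hκ (flowDen_mono hw ht h hx.1).ne'
  have : AntitoneOn (fun r => phaseShift κ w t r) (Icc r r') := by
    refine antitoneOn_of_deriv_nonpos (convex_Icc _ _)
      (fun x hx => (hd x hx).continuousAt.continuousWithinAt)
      (fun x hx => (hd x (interior_subset hx)).differentiableAt.differentiableWithinAt)
      fun x hx => ?_
    have hx := interior_subset hx
    rw [(hd x hx).deriv]
    have h1 := hp.trans (pivot_mono hw ht h hx.1)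
    exact mul_nonpos_of_nonpos_of_nonneg (neg_nonpos.2 (mul_nonneg hS h1)) (by positivity)
  exact this ⟨le_rfl, hr⟩ ⟨hr, le_rfl⟩ hr

end flow

/-! ### Comparison with one favourable interval -/

theorem arctan_sqrt_mul_tan {κ θ : ℝ} (hκ : 0 < κ) (h₁ : -(Real.pi / 2) < θ)
    (h₂ : θ < Real.pi / 2) : Real.arctan (√κ * Real.tan θ / √κ) = θ := by
  rw [mul_div_cancel_left₀ _ (Real.sqrt_pos.2 hκ).ne', Real.arctan_tan h₁ h₂]

theorem arctan_div_le_iff {κ x y : ℝ} (hκ : 0 < κ) :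
    Real.arctan (x / √κ) ≤ Real.arctan (y / √κ) ↔ x ≤ y := by
  rw [Real.arctan_strictMono.le_iff_le, div_le_div_iff_of_pos_right (Real.sqrt_pos.2 hκ)]

/-- After spending length `s` in the unfavourable and `e` in the favourable set, the slope `p` is
at least what it would be if the favourable set were one interval. -/
def Dominates (κ β w s e p : ℝ) : Prop :=
  ∃ s' ∈ Icc 0 s, ∃ r, Real.arctan (r / √κ) = edgeAngle κ β w s' - w * √κ * e ∧
    flow w (s - s') r ≤ p

section dominates

variable {κ c l β₀ β₁ w s e t δ p r : ℝ}

/-- The slope `-edgeSlope β₁ w t` is the one that flows through an unfavourable stretch of length t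
to exactly -β₁/w. Nonnegativity of `charFn` says that a single favourable interval leaves the slope
above this critical value. -/
theorem neg_edgeSlope_le (hκ : 0 < κ) (hw : 0 < w)
    (hG : ∀ a ∈ Icc 0 l, 0 ≤ charFn κ c l β₀ β₁ a w) (hs : s ∈ Icc 0 l) (he : e ≤ c)
    (hr : Real.arctan (r / √κ) = edgeAngle κ β₀ w s - w * √κ * e) :
    -edgeSlope β₁ w (l - s) ≤ r := by
  have hk := Real.sqrt_pos.2 hκ
  have h1 := hG s hs
  unfold charFn at h1
  have h2 : w * √κ * e ≤ w * √κ * c := by gcongr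
  rw [← arctan_div_le_iff hκ, neg_div, Real.arctan_neg, hr]
  change -edgeAngle κ β₁ w (l - s) ≤ _
  linarith

theorem flowDen_neg_edgeSlope (h₁ : 0 < β₁) (hw : 0 < w) (ht : 0 ≤ t) :
    flowDen w t (-edgeSlope β₁ w t) =
      w / (w * Real.cosh (w * t) + β₁ * Real.sinh (w * t)) := by
  have h := edgeDen_pos h₁ hw ht
  rw [eq_div_iff h.ne', flowDen, edgeSlope, add_mul, neg_mul, neg_mul, mul_right_comm,
    div_mul_cancel₀ _ h.ne']
  linear_combination w * Real.cosh_sq (w * t)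

theorem flow_neg_edgeSlope (h₁ : 0 < β₁) (hw : 0 < w) (ht : 0 ≤ t) :
    flow w t (-edgeSlope β₁ w t) = -(β₁ / w) := by
  have h := edgeDen_pos h₁ hw ht
  rw [flow_eq, flowDen_neg_edgeSlope h₁ hw ht, div_div_eq_mul_div, ← neg_div]
  congr 1
  rw [edgeSlope, add_mul, mul_right_comm, neg_mul, div_mul_cancel₀ _ h.ne']
  linear_combination (-β₁) * Real.cosh_sq (w * t)

/-- The critical slope `-edgeSlope β₁ w (l - s)` survives for the whole remaining length l - s, and
any larger slope does so as well. -/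
theorem flowDen_pos_of_le (hκ : 0 < κ) (hw : 0 < w) (h₁ : 0 < β₁)
    (hG : ∀ a ∈ Icc 0 l, 0 ≤ charFn κ c l β₀ β₁ a w) (hs : s ∈ Icc 0 l) (he : e ≤ c)
    (hr : Real.arctan (r / √κ) = edgeAngle κ β₀ w s - w * √κ * e) (ht : 0 ≤ t)
    (hst : s + t ≤ l) : 0 < flowDen w t r := by
  have h2 := neg_edgeSlope_le hκ hw hG hs he hr
  have h3 : 0 ≤ l - s := sub_nonneg.2 hs.2
  refine flowDen_antitone hw ht (show t ≤ l - s by linarith) (flowDen_mono hw h3 ?_ h2)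
  rw [flowDen_neg_edgeSlope h₁ hw h3]
  exact div_pos hw (edgeDen_pos h₁ hw h3)

theorem Dominates.zero : Dominates κ β₀ w 0 0 (β₀ / w) :=
  ⟨0, by simp, edgeSlope β₀ w 0, by simp [edgeAngle], by
    rw [sub_zero, flow_zero, edgeSlope_zero]⟩

theorem Dominates.off (hκ : 0 < κ) (hw : 0 < w) (h₁ : 0 < β₁)
    (hG : ∀ a ∈ Icc 0 l, 0 ≤ charFn κ c l β₀ β₁ a w) (h : Dominates κ β₀ w s e p)
    (he : e ≤ c) (ht : 0 ≤ t) (hst : s + t ≤ l) :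
    0 < flowDen w t p ∧ Dominates κ β₀ w (s + t) e (flow w t p) := by
  obtain ⟨s', hs', r, hr, hp⟩ := h
  have hs'l : s' ∈ Icc 0 l := ⟨hs'.1, by linarith [hs'.2]⟩
  have hd1 := flowDen_pos_of_le hκ hw h₁ hG hs'l he hr (t := s - s') (by linarith [hs'.2])
    (by linarith)
  have hd2 := flowDen_pos_of_le hκ hw h₁ hG hs'l he hr (t := s - s' + t) (by linarith [hs'.2])
    (by linarith)
  have hd3 : 0 < flowDen w t (flow w (s - s') r) := by
    rw [flowDen_flow hd1.ne']; exact div_pos hd2 hd1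
  refine ⟨flowDen_mono hw ht hd3 hp, s', ⟨hs'.1, by linarith [hs'.2]⟩, r, hr, ?_⟩
  rw [show s + t - s' = s - s' + t by ring, ← flow_flow hd1.ne']
  exact flow_mono hw ht hd3 hp

/-- The heart of the comparison. Additional favourable length δ arrives after an unfavourable
stretch of length s - s'. By unimodality, the phase shift along that stretch at the present slope r
is at least its value at one of two extremes: r lowered by joining δ to the earlier interval, or r
raised to `edgeSlope` by removing that interval. The sign of `pivot` at r tells which. -/
theorem Dominates.on (hκ : 0 < κ) (hw : 0 < w) (h₀ : 0 < β₀) (h₁ : 0 < β₁)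
    (hG : ∀ a ∈ Icc 0 l, 0 ≤ charFn κ c l β₀ β₁ a w) (h : Dominates κ β₀ w s e p)
    (hsl : s ≤ l) (he : 0 ≤ e) (hδ : 0 ≤ δ) (heδ : e + δ ≤ c) :
    -(Real.pi / 2) < Real.arctan (p / √κ) - w * √κ * δ ∧
      Dominates κ β₀ w s (e + δ) (√κ * Real.tan (Real.arctan (p / √κ) - w * √κ * δ)) := by
  obtain ⟨s', hs', r, hr, hp⟩ := h
  have hk := Real.sqrt_pos.2 hκ
  have hs0 : 0 ≤ s := hs'.1.trans hs'.2
  have hs'l : s' ∈ Icc 0 l := ⟨hs'.1, hs'.2.trans hsl⟩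
  have ht : 0 ≤ s - s' := sub_nonneg.2 hs'.2
  have hkδ : 0 ≤ w * √κ * δ := by positivity
  have hke : 0 ≤ w * √κ * e := by positivity
  have hmul : w * √κ * (e + δ) = w * √κ * e + w * √κ * δ := by ring
  have hd := flowDen_pos_of_le hκ hw h₁ hG hs'l (by linarith) hr ht (by linarith)
  have hp' : Real.arctan (flow w (s - s') r / √κ) ≤ Real.arctan (p / √κ) :=
    (arctan_div_le_iff hκ).2 hp
  have hup : Real.arctan (p / √κ) - w * √κ * δ < Real.pi / 2 := by
    linarith [Real.arctan_lt_pi_div_two (p / √κ)]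
  -- a phase that is compatible with one favourable interval of length `e + δ` is admissible
  have hlow : ∀ x ∈ Icc 0 l, -(Real.pi / 2) < edgeAngle κ β₀ w x - w * √κ * (e + δ) := by
    intro x hx
    have h2 := hG x hx
    have h3 : w * √κ * (e + δ) ≤ w * √κ * c := by gcongr
    have h4 := edgeAngle_lt (κ := κ) (β := β₁) (w := w) (s := l - x)
    unfold charFn at h2
    linarith
  rcases le_total 0 (pivot w (s - s') r) with hv | hv
  · -- moving the whole favourable set to the right end is better
    have hr0 : r ≤ edgeSlope β₀ w s' := by
      rw [← arctan_div_le_iff hκ, hr]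
      change _ ≤ edgeAngle κ β₀ w s'
      linarith
    have h5 := phaseShift_le_of_pivot_nonneg hκ hw ht hd hr0 hv
    have h6 : flow w (s - s') (edgeSlope β₀ w s') = edgeSlope β₀ w s := by
      have hb : ∀ x, 0 ≤ x → flowDen w x (β₀ / w) ≠ 0 := fun x hx => by
        have := Real.sinh_nonneg_iff.2 (mul_nonneg hw.le hx)
        have := Real.cosh_pos (w * x)
        unfold flowDen
        positivity
      rw [edgeSlope_eq_flow hw.ne', edgeSlope_eq_flow hw.ne', flow_flow (hb _ hs'.1),
        add_sub_cancel]
    -- With `h6` this says that the phase after the stretch is at least `edgeAngle` at s minus w√κe,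
    -- as if all favourable length so far were spent at s.
    unfold phaseShift at h5
    rw [h6, hr] at h5
    have h7 := hlow s ⟨hs0, hsl⟩
    have h8 : edgeAngle κ β₀ w s - w * √κ * (e + δ) ≤ Real.arctan (p / √κ) - w * √κ * δ := by
      change edgeAngle κ β₀ w s - edgeAngle κ β₀ w s' ≤ _ at h5
      linarith
    have h9 := h7.trans_le h8
    refine ⟨h9, s, ⟨hs0, le_rfl⟩,
      √κ * Real.tan (edgeAngle κ β₀ w s - w * √κ * (e + δ)), ?_, ?_⟩
    · exact arctan_sqrt_mul_tan hκ h7 (h8.trans_lt hup)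
    · rw [sub_self, flow_zero, ← arctan_div_le_iff hκ, arctan_sqrt_mul_tan hκ h7 (h8.trans_lt hup),
        arctan_sqrt_mul_tan hκ h9 hup]
      exact h8
  · -- extending the favourable interval is better
    have h7 := hlow s' hs'l
    have h10 : edgeAngle κ β₀ w s' - w * √κ * (e + δ) < Real.pi / 2 := by
      linarith [edgeAngle_lt (κ := κ) (β := β₀) (w := w) (s := s')]
    set r' := √κ * Real.tan (edgeAngle κ β₀ w s' - w * √κ * (e + δ)) with hr'
    have h11 : Real.arctan (r' / √κ) = edgeAngle κ β₀ w s' - w * √κ * (e + δ) :=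
      arctan_sqrt_mul_tan hκ h7 h10
    have hd' := flowDen_pos_of_le hκ hw h₁ hG hs'l heδ h11 ht (by linarith)
    have hrr : r' ≤ r := by
      rw [← arctan_div_le_iff hκ, hr, h11]
      linarith
    have h5 := phaseShift_le_of_pivot_nonpos hκ hw ht hd' hrr hv
    unfold phaseShift at h5
    rw [h11, hr] at h5
    have h8 : Real.arctan (flow w (s - s') r' / √κ) ≤ Real.arctan (p / √κ) - w * √κ * δ := by
      linarith
    have h9 := (Real.neg_pi_div_two_lt_arctan _).trans_le h8
    refine ⟨h9, s', hs', r', h11, ?_⟩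
    rw [← arctan_div_le_iff hκ, arctan_sqrt_mul_tan hκ h9 hup]
    exact h8

/-- The comparison slope starts its last unfavourable stretch above the critical slope, which would
end at -β₁/w, and the flow preserves order. -/
theorem Dominates.final (hκ : 0 < κ) (hw : 0 < w) (h₁ : 0 < β₁)
    (hG : ∀ a ∈ Icc 0 l, 0 ≤ charFn κ c l β₀ β₁ a w) (h : Dominates κ β₀ w l c p) :
    -β₁ ≤ w * p := by
  obtain ⟨s', hs', r, hr, hp⟩ := h
  have ht : 0 ≤ l - s' := sub_nonneg.2 hs'.2
  have h2 := neg_edgeSlope_le hκ hw hG hs' le_rfl hr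
  have h3 : 0 < flowDen w (l - s') (-edgeSlope β₁ w (l - s')) := by
    rw [flowDen_neg_edgeSlope h₁ hw ht]
    exact div_pos hw (edgeDen_pos h₁ hw ht)
  have h4 := (flow_mono hw ht h3 h2).trans hp
  rw [flow_neg_edgeSlope h₁ hw ht, neg_le_iff_add_nonneg] at h4
  have : 0 ≤ w * (p + β₁ / w) := by positivity
  rw [mul_add, mul_div_cancel₀ _ hw.ne'] at this
  linarith

end dominates

/-! ### Lower bounds of the Rayleigh quotient for arbitrary favourable sets -/

section energy

variable {κ w x t p : ℝ} {v v' : ℝ → ℝ}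

theorem IsH1.off_le (hv : IsH1 v v') (hw : 0 < w) (hx : 0 ≤ x) (ht : 0 ≤ t) (hxt : x + t ≤ 1)
    (hp : 0 < flowDen w t p) :
    w ^ 2 * (-∫ y in x..x + t, v y ^ 2) ≤ (∫ y in x..x + t, v' y ^ 2) + w * p * v x ^ 2 -
      w * flow w t p * v (x + t) ^ 2 := by
  have := hv.riccati_le (p := fun y => w * flow w (y - x) p) (m := -w ^ 2) hx
    (le_add_of_nonneg_right ht) hxt fun y hy => by
      have h1 := (hasDerivAt_flow_time (flowDen_antitone hw (sub_nonneg.2 hy.1)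
        (by linarith [hy.2]) hp).ne').comp y ((hasDerivAt_id y).sub_const x)
      refine (h1.const_mul w).congr_deriv ?_
      ring
  simp only [sub_self, flow_zero, add_sub_cancel_left] at this
  linarith

/-- Picone's inequality with the Riccati solution w√κ tan(θ - w√κ(y - x)), where θ is the incoming
phase; `hp` keeps the tangent away from its pole. -/
theorem IsH1.on_le (hv : IsH1 v v') (hκ : 0 < κ) (hw : 0 < w) (hx : 0 ≤ x) (ht : 0 ≤ t)
    (hxt : x + t ≤ 1) (hp : -(Real.pi / 2) < Real.arctan (p / √κ) - w * √κ * t) :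
    w ^ 2 * (κ * ∫ y in x..x + t, v y ^ 2) ≤ (∫ y in x..x + t, v' y ^ 2) + w * p * v x ^ 2 -
      w * (√κ * Real.tan (Real.arctan (p / √κ) - w * √κ * t)) * v (x + t) ^ 2 := by
  have hk := Real.sqrt_pos.2 hκ
  have h2 := Real.sq_sqrt hκ.le
  have := hv.riccati_le
    (p := fun y => w * (√κ * Real.tan (Real.arctan (p / √κ) - w * √κ * (y - x))))
    (m := w ^ 2 * κ) hx (le_add_of_nonneg_right ht) hxt fun y hy => by
      have hlo : -(Real.pi / 2) < Real.arctan (p / √κ) - w * √κ * (y - x) := by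
        have : w * √κ * (y - x) ≤ w * √κ * t := by
          gcongr; linarith [hy.2]
        linarith
      have hhi : Real.arctan (p / √κ) - w * √κ * (y - x) < Real.pi / 2 := by
        have : 0 ≤ w * √κ * (y - x) := mul_nonneg (by positivity) (sub_nonneg.2 hy.1)
        linarith [Real.arctan_lt_pi_div_two (p / √κ)]
      have hcos := (Real.cos_pos_of_mem_Ioo ⟨hlo, hhi⟩).ne'
      have h1 := (Real.hasDerivAt_tan hcos).comp y
        ((((hasDerivAt_id y).sub_const x).const_mul (w * √κ)).const_sub (Real.arctan (p / √κ)))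
      refine ((h1.const_mul √κ).const_mul w).congr_deriv ?_
      have h3 := Real.sin_sq_add_cos_sq (Real.arctan (p / √κ) - w * √κ * (y - x))
      simp only [Real.tan_eq_sin_div_cos]
      field_simp
      rw [h2]
      linear_combination κ * h3
  simp only [sub_self, mul_zero, sub_zero, add_sub_cancel_left, Real.tan_arctan,
    mul_div_cancel₀ _ hk.ne'] at this
  linarith

end energy

section grid

variable {κ c β₀ β₁ w : ℝ} {v v' : ℝ → ℝ}

/-- The lower bound of the Rayleigh quotient for a favourable set that consists of one interval of
length `d i` at the beginning of each cell of a uniform grid. -/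
theorem IsH1.grid_le (hκ : 0 < κ) (h₀ : 0 < β₀) (h₁ : 0 < β₁) (hw : 0 < w)
    (hG : ∀ a ∈ Icc 0 (1 - c), 0 ≤ charFn κ c (1 - c) β₀ β₁ a w) (hv : IsH1 v v')
    {N : ℕ} {h : ℝ} (hN : N * h = 1) {d : ℕ → ℝ} (hd0 : ∀ i, 0 ≤ d i)
    (hdh : ∀ i, d i ≤ h) (hd : ∑ i ∈ Finset.range N, d i = c) :
    w ^ 2 * ∑ i ∈ Finset.range N, (κ * (∫ y in i * h..i * h + d i, v y ^ 2) -
      ∫ y in i * h + d i..(i + 1) * h, v y ^ 2) ≤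
      (∫ y in (0 : ℝ)..1, v' y ^ 2) + β₀ * v 0 ^ 2 + β₁ * v 1 ^ 2 := by
  have hh : 0 ≤ h := (hd0 0).trans (hdh 0)
  set e : ℕ → ℝ := fun n => ∑ i ∈ Finset.range n, d i with he
  set s : ℕ → ℝ := fun n => ∑ i ∈ Finset.range n, (h - d i) with hs
  have hes : ∀ n : ℕ, s n + e n = n * h := fun n => by
    simp [he, hs]
  have he1 : ∀ n, e (n + 1) = e n + d n := fun n => Finset.sum_range_succ _ _
  have hs1 : ∀ n, s (n + 1) = s n + (h - d n) := fun n => Finset.sum_range_succ _ _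
  have hem : Monotone e := monotone_nat_of_le_succ fun n => by rw [he1]; linarith [hd0 n]
  have hsm : Monotone s := monotone_nat_of_le_succ fun n => by rw [hs1]; linarith [hdh n]
  have heN : e N = c := hd
  have hsN : s N = 1 - c := by linarith [hes N]
  -- Each cell consists of a favourable and then an unfavourable step. The boundary terms of the
  -- Picone estimates telescope, leaving only the current slope p.
  have hmain : ∀ n, n ≤ N → ∃ p, Dominates κ β₀ w (s n) (e n) p ∧
      w ^ 2 * ∑ i ∈ Finset.range n, (κ * (∫ y in i * h..i * h + d i, v y ^ 2) -
        ∫ y in i * h + d i..(i + 1) * h, v y ^ 2) ≤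
      (∫ y in (0 : ℝ)..n * h, v' y ^ 2) + β₀ * v 0 ^ 2 - w * p * v (n * h) ^ 2 := by
    intro n
    induction n with
    | zero =>
      intro _
      refine ⟨β₀ / w, by simpa [he, hs] using Dominates.zero, ?_⟩
      simp [mul_div_cancel₀ _ hw.ne']
    | succ n ih =>
      intro hn
      obtain ⟨p, hp, hle⟩ := ih (by omega)
      have hsn : s n ≤ 1 - c := hsN ▸ hsm (by omega : n ≤ N)
      have hsn1 : s (n + 1) ≤ 1 - c := hsN ▸ hsm hn
      have hen1 : e (n + 1) ≤ c := heN ▸ hem hn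
      have he0 : 0 ≤ e n := Finset.sum_nonneg fun i _ => hd0 i
      have hx0 : (0 : ℝ) ≤ n * h := by positivity
      have hx1 : ((n : ℝ) + 1) * h ≤ 1 := by
        exact (mul_le_mul_of_nonneg_right (by exact_mod_cast hn) hh).trans_eq hN
      have hx2 : n * h + d n ≤ ((n : ℝ) + 1) * h := by linarith [hdh n]
      obtain ⟨hlo, hp1⟩ := hp.on hκ hw h₀ h₁ hG hsn he0 (hd0 n) (by rw [← he1]; exact hen1)
      rw [← he1] at hp1
      obtain ⟨hden, hp2⟩ := hp1.off hκ hw h₁ hG hen1 (sub_nonneg.2 (hdh n))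
        (by rw [← hs1]; exact hsn1)
      rw [← hs1] at hp2
      refine ⟨_, hp2, ?_⟩
      have a1 := hv.on_le hκ hw hx0 (hd0 n) (by linarith) hlo
      have a2 := hv.off_le hw (by linarith [hd0 n] : 0 ≤ n * h + d n) (sub_nonneg.2 (hdh n))
        (by linarith) hden
      have hxe : n * h + d n + (h - d n) = ((n : ℝ) + 1) * h := by ring
      rw [hxe] at a2
      have hi : ∀ x y, 0 ≤ x → x ≤ y → y ≤ 1 →
          IntervalIntegrable (fun y => v' y ^ 2) volume x y :=
        fun x y h1 h2 h3 => hv.sq_intervalIntegrable.restrict_unit h1 h2 h3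
      have j1 := intervalIntegral.integral_add_adjacent_intervals
        (hi 0 (n * h) le_rfl hx0 (by linarith [hd0 n]))
        (hi (n * h) (n * h + d n) hx0 (by linarith [hd0 n]) (by linarith))
      have j2 := intervalIntegral.integral_add_adjacent_intervals
        (hi 0 (n * h + d n) le_rfl (by linarith [hd0 n]) (by linarith))
        (hi (n * h + d n) ((n + 1) * h) (by linarith [hd0 n]) hx2 hx1)
      rw [Finset.sum_range_succ, mul_add]
      push_cast
      rw [← j2, ← j1]
      linarith
  obtain ⟨p, hp, hle⟩ := hmain N le_rfl
  rw [hsN, heN] at hp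
  -- This replaces -wp in the last boundary term by β₁.
  have hf := hp.final hκ hw h₁ hG
  rw [hN] at hle
  nlinarith [sq_nonneg (v 1)]

end grid

section rayleigh

variable {κ c β₀ β₁ w : ℝ} {v v' : ℝ → ℝ} {E : Set ℝ}

theorem weight_eq (κ : ℝ) (E : Set ℝ) (x : ℝ) :
    weight κ E x = (κ + 1) * E.indicator 1 x - 1 := by
  by_cases hx : x ∈ E <;> simp [weight, hx]

theorem intervalIntegrable_indicator_mul (hE : MeasurableSet E) {f : ℝ → ℝ} {x y : ℝ}
    (hf : IntervalIntegrable f volume x y) :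
    IntervalIntegrable (fun t => E.indicator 1 t * f t) volume x y := by
  have : (fun t => E.indicator 1 t * f t) = E.indicator f := by
    ext t; by_cases ht : t ∈ E <;> simp [ht]
  rw [this]
  exact ⟨hf.1.indicator hE, hf.2.indicator hE⟩

theorem intervalIntegrable_indicator_one (hE : MeasurableSet E) (x y : ℝ) :
    IntervalIntegrable (fun t => E.indicator (1 : ℝ → ℝ) t) volume x y := by
  simpa using intervalIntegrable_indicator_mul hE
    (intervalIntegrable_const (c := (1 : ℝ)) (a := x) (b := y) (μ := volume))

theorem integral_weight_mul (hE : MeasurableSet E) {f : ℝ → ℝ} {x y : ℝ}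
    (hf : IntervalIntegrable f volume x y) :
    ∫ t in x..y, weight κ E t * f t =
      (κ + 1) * (∫ t in x..y, E.indicator 1 t * f t) - ∫ t in x..y, f t := by
  rw [← intervalIntegral.integral_const_mul, ← intervalIntegral.integral_sub
    ((intervalIntegrable_indicator_mul hE hf).const_mul _) hf]
  refine intervalIntegral.integral_congr fun t _ => ?_
  simp only [weight_eq]
  ring

theorem integral_indicator_unit (hE : MeasurableSet E) (hE01 : E ⊆ Ioo 0 1) :
    ∫ t in (0 : ℝ)..1, E.indicator (1 : ℝ → ℝ) t = volume.real E := by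
  rw [intervalIntegral.integral_of_le zero_le_one, integral_indicator_one hE,
    measureReal_restrict_apply hE, inter_eq_left.2 (hE01.trans Ioo_subset_Ioc_self)]

/-- Rearrangement on a grid: up to an error, moving the favourable set within the cells of a
sufficiently fine grid does not decrease the integral of a nonnegative continuous function. -/
theorem integral_indicator_le_grid (hE : MeasurableSet E) {f : ℝ → ℝ}
    (hf : ContinuousOn f (Icc 0 1)) (hf0 : ∀ x, 0 ≤ f x) {N : ℕ} {h ε : ℝ} (hN : N * h = 1)
    (hε : 0 ≤ ε)
    (hfε : ∀ x ∈ Icc (0 : ℝ) 1, ∀ y ∈ Icc (0 : ℝ) 1, |x - y| ≤ h → |f x - f y| ≤ ε)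
    {d : ℕ → ℝ} (hd : ∀ i : ℕ, ∫ t in i * h..(i + 1) * h, E.indicator (1 : ℝ → ℝ) t ≤ d i)
    (hdh : ∀ i, d i ≤ h) (hd0 : ∀ i, 0 ≤ d i) :
    ∫ t in (0 : ℝ)..1, E.indicator 1 t * f t ≤
      ∑ i ∈ Finset.range N, ((∫ t in i * h..i * h + d i, f t) + 2 * ε * d i) := by
  have hh : 0 ≤ h := (hd0 0).trans (hdh 0)
  have hfi : IntervalIntegrable f volume 0 1 := hf.intervalIntegrable_of_Icc zero_le_one
  have hcell : ∀ i < N, (0 : ℝ) ≤ i * h ∧ i * h ≤ ((i : ℝ) + 1) * h ∧ ((i : ℝ) + 1) * h ≤ 1 := by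
    intro i hi
    refine ⟨by positivity, by nlinarith, ?_⟩
    exact (mul_le_mul_of_nonneg_right (by exact_mod_cast hi) hh).trans_eq hN
  have hsum := intervalIntegral.sum_integral_adjacent_intervals (μ := volume) (n := N)
    (f := fun t => E.indicator 1 t * f t) (a := fun i : ℕ => (i : ℝ) * h) fun i hi => by
      obtain ⟨h1, h2, h3⟩ := hcell i hi
      push_cast
      exact intervalIntegrable_indicator_mul hE (hfi.restrict_unit h1 h2 h3)
  simp only [Nat.cast_zero, zero_mul, hN] at hsum
  rw [← hsum]
  refine Finset.sum_le_sum fun i hi => ?_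
  obtain ⟨h1, h2, h3⟩ := hcell i (Finset.mem_range.1 hi)
  have hdi : i * h + d i ≤ ((i : ℝ) + 1) * h := by linarith [hdh i]
  have hx : (i : ℝ) * h ∈ Icc (0 : ℝ) 1 := ⟨h1, h2.trans h3⟩
  have hclose : ∀ t ∈ Icc ((i : ℝ) * h) ((i + 1) * h), |f t - f (i * h)| ≤ ε := fun t ht =>
    hfε t ⟨h1.trans ht.1, ht.2.trans h3⟩ _ hx (by
      rw [abs_of_nonneg (sub_nonneg.2 ht.1)]; linarith [ht.2])
  push_cast
  -- Both integrals over a cell are compared with the value of f at its left end; each comparison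
  -- costs ε per unit of favourable length, whence 2ε.
  have a1 : ∫ t in i * h..((i : ℝ) + 1) * h, E.indicator 1 t * f t ≤
      (∫ t in i * h..((i : ℝ) + 1) * h, E.indicator (1 : ℝ → ℝ) t) * (f (i * h) + ε) := by
    rw [← intervalIntegral.integral_mul_const]
    refine intervalIntegral.integral_mono_on h2
      (intervalIntegrable_indicator_mul hE (hfi.restrict_unit h1 h2 h3))
      ((intervalIntegrable_indicator_one hE _ _).mul_const _) fun t ht => ?_
    have := (abs_le.1 (hclose t ht)).2
    refine mul_le_mul_of_nonneg_left (by linarith) (indicator_nonneg (fun _ _ => by simp) _)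
  have a2 : d i * (f (i * h) - ε) ≤ ∫ t in i * h..i * h + d i, f t := by
    have := intervalIntegral.integral_mono_on (μ := volume) (le_add_of_nonneg_right (hd0 i))
      (f := fun _ => f (i * h) - ε) (g := f) (a := i * h) intervalIntegrable_const
      (hfi.restrict_unit h1 (le_add_of_nonneg_right (hd0 i)) (hdi.trans h3)) fun t ht => by
        have := (abs_le.1 (hclose t ⟨ht.1, ht.2.trans hdi⟩)).1
        linarith
    rwa [intervalIntegral.integral_const, add_sub_cancel_left, smul_eq_mul] at this
  have a3 : (∫ t in i * h..((i : ℝ) + 1) * h, E.indicator (1 : ℝ → ℝ) t) * (f (i * h) + ε) ≤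
      d i * (f (i * h) + ε) :=
    mul_le_mul_of_nonneg_right (hd i) (add_nonneg (hf0 _) hε)
  linarith

/-- The lower bound of the Rayleigh quotient for an arbitrary favourable set. -/
theorem IsH1.rayleigh_le (hκ : 0 < κ) (hc : 0 < c) (hc1 : c < 1) (h₀ : 0 < β₀) (h₁ : 0 < β₁)
    (hw : 0 < w) (hG : ∀ a ∈ Icc 0 (1 - c), 0 ≤ charFn κ c (1 - c) β₀ β₁ a w) (hv : IsH1 v v')
    (hE : MeasurableSet E) (hE01 : E ⊆ Ioo 0 1) (hEc : volume.real E ≤ c) :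
    w ^ 2 * ∫ t in (0 : ℝ)..1, weight κ E t * v t ^ 2 ≤
      (∫ t in (0 : ℝ)..1, v' t ^ 2) + β₀ * v 0 ^ 2 + β₁ * v 1 ^ 2 := by
  set f : ℝ → ℝ := fun t => v t ^ 2 with hf
  have hfc : ContinuousOn f (Icc 0 1) := hv.continuousOn.pow 2
  have hfi : IntervalIntegrable f volume 0 1 := hfc.intervalIntegrable_of_Icc zero_le_one
  have hunif := isCompact_Icc.uniformContinuousOn_of_continuous hfc
  rw [Metric.uniformContinuousOn_iff_le] at hunif
  refine le_of_forall_pos_le_add fun η hη => ?_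
  -- Chosen so that the error 2εc of the rearrangement contributes exactly η.
  set ε := η / (w ^ 2 * (κ + 1) * 2 * c) with hεdef
  have hε : 0 < ε := by positivity
  obtain ⟨δ, hδ, hδε⟩ := hunif ε hε
  obtain ⟨N, hN⟩ := exists_nat_one_div_lt hδ
  set M : ℕ := N + 1
  set h : ℝ := 1 / (M : ℝ) with hh
  have hM : (M : ℝ) * h = 1 := by
    rw [hh, mul_one_div_cancel (Nat.cast_ne_zero.2 N.succ_ne_zero)]
  have hhpos : 0 < h := by positivity
  have hhδ : h ≤ δ := by
    rw [hh]; push_cast [M]; exact hN.le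
  set m := volume.real E
  have hm1 : 0 < 1 - m := by linarith
  -- Filling the fraction τ of the free space in every cell raises the total favourable length from
  -- m to exactly c and keeps it at most h in each cell.
  set τ := (c - m) / (1 - m) with hτ
  have hτ0 : 0 ≤ τ := div_nonneg (by linarith) hm1.le
  have hτ1 : τ ≤ 1 := (div_le_one hm1).2 (by linarith)
  set g : ℕ → ℝ := fun i => ∫ t in i * h..(i + 1) * h, E.indicator (1 : ℝ → ℝ) t with hg
  have hii := fun x y => intervalIntegrable_indicator_one hE x y
  have hcell : ∀ i : ℕ, (i : ℝ) * h ≤ (i + 1) * h := fun i => by nlinarith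
  have hg0 : ∀ i, 0 ≤ g i := fun i =>
    intervalIntegral.integral_nonneg (hcell i) fun t _ => indicator_nonneg (fun _ _ => by simp) _
  have hgh : ∀ i, g i ≤ h := fun i => by
    have := intervalIntegral.integral_mono_on (μ := volume) (hcell i) (hii _ _)
      (g := fun _ => (1 : ℝ)) intervalIntegrable_const fun t _ =>
        indicator_le_self' (fun _ _ => by simp) t
    simp only [intervalIntegral.integral_const, smul_eq_mul, mul_one] at this
    linarith
  have hgs : ∑ i ∈ Finset.range M, g i = m := by
    have := intervalIntegral.sum_integral_adjacent_intervals (μ := volume) (n := M)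
      (f := fun t => E.indicator (1 : ℝ → ℝ) t) (a := fun i : ℕ => (i : ℝ) * h)
      fun i hi => hii _ _
    simp only [Nat.cast_zero, zero_mul, hM] at this
    rw [integral_indicator_unit hE hE01] at this
    refine Eq.trans ?_ this
    push_cast
    rfl
  set d : ℕ → ℝ := fun i => g i + τ * (h - g i) with hd
  have hd0 : ∀ i, 0 ≤ d i := fun i =>
    add_nonneg (hg0 i) (mul_nonneg hτ0 (sub_nonneg.2 (hgh i)))
  have hdh : ∀ i, d i ≤ h := fun i => by
    have := mul_le_mul_of_nonneg_right hτ1 (sub_nonneg.2 (hgh i))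
    simp only [hd]; linarith
  have hgd : ∀ i, g i ≤ d i := fun i =>
    le_add_of_nonneg_right (mul_nonneg hτ0 (sub_nonneg.2 (hgh i)))
  have hds : ∑ i ∈ Finset.range M, d i = c := by
    simp only [hd]
    rw [Finset.sum_add_distrib, ← Finset.mul_sum, Finset.sum_sub_distrib, hgs]
    simp only [Finset.sum_const, Finset.card_range, nsmul_eq_mul, hM]
    rw [hτ, div_mul_cancel₀ _ hm1.ne']
    ring
  have k1 := hv.grid_le hκ h₀ h₁ hw hG hM hd0 hdh hds
  have k2 := integral_indicator_le_grid hE hfc (fun x => sq_nonneg _) hM hε.le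
    (fun x hx y hy hxy => hδε x hx y hy (hxy.trans hhδ)) hgd hdh hd0
  have k3 : ∑ i ∈ Finset.range M, (κ * (∫ y in i * h..i * h + d i, v y ^ 2) -
      ∫ y in i * h + d i..(i + 1) * h, v y ^ 2) =
      (κ + 1) * ∑ i ∈ Finset.range M, (∫ y in i * h..i * h + d i, f y) -
        ∫ y in (0 : ℝ)..1, f y := by
    have hc2 : ∀ i < M, (0 : ℝ) ≤ i * h ∧ ((i : ℝ) + 1) * h ≤ 1 := by
      intro i hi
      refine ⟨by positivity, ?_⟩
      exact (mul_le_mul_of_nonneg_right (by exact_mod_cast hi) hhpos.le).trans_eq hM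
    have := intervalIntegral.sum_integral_adjacent_intervals (μ := volume) (n := M)
      (f := f) (a := fun i : ℕ => (i : ℝ) * h) fun i hi => by
        push_cast
        exact hfi.restrict_unit (hc2 i hi).1 (hcell i) (hc2 i hi).2
    simp only [Nat.cast_zero, zero_mul, hM] at this
    rw [← this, Finset.mul_sum, ← Finset.sum_sub_distrib]
    refine Finset.sum_congr rfl fun i hi => ?_
    have hi := hc2 i (Finset.mem_range.1 hi)
    have hdi : i * h + d i ≤ ((i : ℝ) + 1) * h := by linarith [hdh i]
    push_cast
    rw [← intervalIntegral.integral_add_adjacent_intervals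
      (hfi.restrict_unit hi.1 (le_add_of_nonneg_right (hd0 i)) (hdi.trans hi.2))
      (hfi.restrict_unit (by linarith [hd0 i]) hdi hi.2)]
    simp only [hf]
    ring
  rw [k3] at k1
  rw [Finset.sum_add_distrib, ← Finset.mul_sum, hds] at k2
  rw [integral_weight_mul hE hfi]
  have k4 : w ^ 2 * (κ + 1) * (2 * ε * c) = η := by
    rw [hεdef]; field_simp
  have k5 := mul_le_mul_of_nonneg_left k2 (by positivity : 0 ≤ w ^ 2 * (κ + 1))
  nlinarith

end rayleigh

/-! ### Uniqueness of the positive principal eigenvalue -/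

theorem ContinuousOn.mul_memLp {f g : ℝ → ℝ} (hg : ContinuousOn g (Icc 0 1))
    (hf : MemLp f 2 (volume.restrict (Ioo (0 : ℝ) 1))) :
    MemLp (fun x => g x * f x) 2 (volume.restrict (Ioo (0 : ℝ) 1)) := by
  obtain ⟨C, hC⟩ := isCompact_Icc.exists_bound_of_continuousOn hg
  refine hf.of_le_mul (c := C) (((hg.mono Ioo_subset_Icc_self).aestronglyMeasurable
    measurableSet_Ioo).mul hf.1) ?_
  refine (ae_restrict_iff' measurableSet_Ioo).2 (Eventually.of_forall fun x hx => ?_)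
  rw [norm_mul]
  exact mul_le_mul_of_nonneg_right (hC x (Ioo_subset_Icc_self hx)) (norm_nonneg _)

namespace IsH1

variable {u u' v v' : ℝ → ℝ}

theorem mul (hu : IsH1 u u') (hv : IsH1 v v') :
    IsH1 (fun x => u x * v x) (fun x => v x * u' x + u x * v' x) := by
  refine of_ac (hu.ac.mul hv.ac)
    ((ContinuousOn.mul_memLp hv.continuousOn hu.memLp).add
      (ContinuousOn.mul_memLp hu.continuousOn hv.memLp)) ?_
  filter_upwards [hu.ae_hasDerivAt, hv.ae_hasDerivAt] with t h1 h2 ht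
  exact ((h1 ht).mul (h2 ht)).congr_deriv (by ring)

theorem nonneg (hu : IsH1 u u') (h : ∀ x ∈ Ioo (0 : ℝ) 1, 0 < u x) {x : ℝ}
    (hx : x ∈ Icc (0 : ℝ) 1) : 0 ≤ u x := by
  have hcl : closure (Ioo (0 : ℝ) 1) = Icc 0 1 := closure_Ioo zero_ne_one
  exact le_on_closure (f := fun _ => (0 : ℝ)) (g := u) (fun y hy => (h y hy).le)
    continuousOn_const (hcl ▸ hu.continuousOn) (hcl ▸ hx)

/-- The shift by ε makes v²/(φ + ε) a legitimate H¹ test function although φ is only known to be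
nonnegative at the endpoints. -/
theorem inv_add (hu : IsH1 u u') (h : ∀ x ∈ Icc (0 : ℝ) 1, 0 ≤ u x) {ε : ℝ} (hε : 0 < ε) :
    IsH1 (fun x => (u x + ε)⁻¹) (fun x => -((u x + ε) ^ 2)⁻¹ * u' x) := by
  have hne : ∀ x ∈ Icc (0 : ℝ) 1, (u x + ε) ^ 2 ≠ 0 := fun x hx => by
    have := h x hx; positivity
  refine of_ac ?_ (ContinuousOn.mul_memLp
    (((hu.continuousOn.add continuousOn_const).pow 2).inv₀ hne).neg hu.memLp) ?_
  · have hac := hu.ac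
    rw [absolutelyContinuousOnInterval_iff] at hac ⊢
    intro η hη
    obtain ⟨δ, hδ, H⟩ := hac (η * ε ^ 2) (by positivity)
    refine ⟨δ, hδ, fun E hE hs => ?_⟩
    have h1 := H E hE hs
    refine lt_of_le_of_lt (Finset.sum_le_sum fun i hi => ?_)
      ((Finset.sum_mul _ _ (ε ^ 2)⁻¹).symm.trans_lt ((mul_inv_lt_iff₀ (by positivity)).2 h1))
    have hmem := hE.1 i hi
    rw [uIcc_of_le zero_le_one] at hmem
    have p1 := h _ hmem.1
    have p2 := h _ hmem.2
    rw [Real.dist_eq, Real.dist_eq, inv_sub_inv (by positivity) (by positivity), abs_div,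
      abs_of_pos (by positivity : 0 < (u (E.2 i).1 + ε) * (u (E.2 i).2 + ε)), div_eq_mul_inv,
      add_sub_add_right_eq_sub, abs_sub_comm]
    gcongr
    nlinarith
  · filter_upwards [hu.ae_hasDerivAt] with t ht hmem
    have hpos : u t + ε ≠ 0 := by have := h t (Ioo_subset_Icc_self hmem); positivity
    refine (((ht hmem).add_const ε).inv hpos).congr_deriv ?_
    rw [div_eq_mul_inv]; ring

/-- The quadratic form of the Robin problem is positive definite. -/
theorem energy_pos {β₀ β₁ : ℝ} (h₀ : 0 < β₀) (h₁ : 0 < β₁) (hv : IsH1 v v')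
    (hne : v (1 / 2) ≠ 0) :
    0 < (∫ t in (0 : ℝ)..1, v' t ^ 2) + β₀ * v 0 ^ 2 + β₁ * v 1 ^ 2 := by
  have hI : 0 ≤ ∫ t in (0 : ℝ)..1, v' t ^ 2 :=
    intervalIntegral.integral_nonneg zero_le_one fun t _ => sq_nonneg _
  by_contra hcon
  have p0 : 0 ≤ β₀ * v 0 ^ 2 := by positivity
  have p1 : 0 ≤ β₁ * v 1 ^ 2 := by positivity
  have hv0 : v 0 = 0 := by
    have : β₀ * v 0 ^ 2 = 0 := by linarith
    simpa [h₀.ne'] using this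
  have hI0 : ∫ t in (0 : ℝ)..1, v' t ^ 2 = 0 := by linarith
  rw [intervalIntegral.integral_eq_zero_iff_of_le_of_nonneg_ae zero_le_one
    (Eventually.of_forall fun t => sq_nonneg _) hv.sq_intervalIntegrable] at hI0
  apply hne
  rw [hv.eq_integral (1 / 2) (by norm_num), hv0, zero_add]
  refine (intervalIntegral.integral_congr_ae (g := fun _ => (0 : ℝ)) ?_).trans (by simp)
  filter_upwards [(ae_restrict_iff' measurableSet_Ioc).1 hI0] with t ht hmem
  rw [uIoc_of_le (by norm_num)] at hmem
  have := ht ⟨hmem.1, hmem.2.trans (by norm_num)⟩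
  simpa using this

end IsH1

section uniqueness

variable {κ β₀ β₁ μ ν w c : ℝ} {E : Set ℝ}

theorem abs_weight_le (hκ : 0 < κ) (x : ℝ) : |weight κ E x| ≤ κ + 1 := by
  by_cases hx : x ∈ E
  · simp [weight, hx, abs_of_pos hκ]
  · simp [weight, hx, hκ.le]

theorem measurable_weight (hE : MeasurableSet E) : Measurable (weight κ E) :=
  (measurable_const.indicator hE).sub (measurable_const.indicator hE.compl)

/-- A positive principal eigenvalue bounds the Rayleigh quotient from below (Picone). -/
theorem IsPositivePrincipalEigenvalue.le_energy (hκ : 0 < κ) (hE : MeasurableSet E)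
    (h₀ : 0 < β₀) (h₁ : 0 < β₁) (h : IsPositivePrincipalEigenvalue (weight κ E) β₀ β₁ μ)
    {v v' : ℝ → ℝ} (hv : IsH1 v v') :
    μ * ∫ t in (0 : ℝ)..1, weight κ E t * v t ^ 2 ≤
      (∫ t in (0 : ℝ)..1, v' t ^ 2) + β₀ * v 0 ^ 2 + β₁ * v 1 ^ 2 := by
  obtain ⟨hμ, φ, φ', hφ, hpos, hweak⟩ := h
  have hnn : ∀ x ∈ Icc (0 : ℝ) 1, 0 ≤ φ x := fun x hx => hφ.nonneg hpos hx
  have hstep : ∀ ε : ℝ, 0 < ε →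
      μ * ∫ t in (0 : ℝ)..1, weight κ E t * φ t * (v t * v t * (φ t + ε)⁻¹) ≤
      (∫ t in (0 : ℝ)..1, v' t ^ 2) + β₀ * v 0 ^ 2 + β₁ * v 1 ^ 2 := by
    intro ε hε
    have hz := (hv.mul hv).mul (hφ.inv_add hnn hε)
    rw [← hweak _ _ hz]
    have hb : ∀ x ∈ Icc (0 : ℝ) 1, φ x * (v x * v x * (φ x + ε)⁻¹) ≤ v x ^ 2 := by
      intro x hx
      have h1 := hnn x hx
      have : φ x * (φ x + ε)⁻¹ ≤ 1 := by
        rw [← div_eq_mul_inv, div_le_one (by positivity)]; linarith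
      nlinarith [mul_le_mul_of_nonneg_left this (sq_nonneg (v x))]
    have b0 := mul_le_mul_of_nonneg_left (hb 0 (by simp)) h₀.le
    have b1 := mul_le_mul_of_nonneg_left (hb 1 (by simp)) h₁.le
    have bI := intervalIntegral.integral_mono_on zero_le_one (hφ.mul_intervalIntegrable hz)
      hv.sq_intervalIntegrable fun x hx => by
        have h1 := hnn x hx
        have hne : φ x + ε ≠ 0 := by positivity
        -- Picone's identity for the shifted eigenfunction: the deficit is a perfect square.
        have : v' x ^ 2 - φ' x * ((φ x + ε)⁻¹ * (v x * v' x + v x * v' x) +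
            v x * v x * (-((φ x + ε) ^ 2)⁻¹ * φ' x)) =
            (v' x - φ' x * v x * (φ x + ε)⁻¹) ^ 2 := by
          rw [← inv_pow]; ring
        have := sq_nonneg (v' x - φ' x * v x * (φ x + ε)⁻¹)
        linarith
    linarith
  have hvc := hv.continuousOn
  obtain ⟨C, hC⟩ := isCompact_Icc.exists_bound_of_continuousOn (hvc.pow 2)
  have hlim : Tendsto (fun n : ℕ => ∫ t in (0 : ℝ)..1,
      weight κ E t * φ t * (v t * v t * (φ t + 1 / ((n : ℝ) + 1))⁻¹)) atTop
      (𝓝 (∫ t in (0 : ℝ)..1, weight κ E t * v t ^ 2)) := by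
    -- The factor φ/(φ + ε) tends to 1 only where φ > 0, so the endpoint 1 has to be left out.
    have hne : ∀ᵐ t : ℝ, t ≠ 1 := by simp [ae_iff]
    have hε : ∀ n : ℕ, 0 < 1 / ((n : ℝ) + 1) := fun n => by positivity
    refine intervalIntegral.tendsto_integral_filter_of_dominated_convergence
      (fun _ => (κ + 1) * C) (Eventually.of_forall fun n => ?_)
      (Eventually.of_forall fun n => Eventually.of_forall fun t ht => ?_)
      intervalIntegrable_const ?_
    · rw [uIoc_of_le zero_le_one]
      have hc1 : ContinuousOn (fun t => v t * v t * (φ t + 1 / ((n : ℝ) + 1))⁻¹) (Icc 0 1) :=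
        (hvc.mul hvc).mul ((hφ.continuousOn.add continuousOn_const).inv₀ fun x hx =>
          (add_pos_of_nonneg_of_pos (hnn x hx) (hε n)).ne')
      exact (((measurable_weight hE).aestronglyMeasurable).mul
        ((hφ.continuousOn.mono Ioc_subset_Icc_self).aestronglyMeasurable measurableSet_Ioc)).mul
        ((hc1.mono Ioc_subset_Icc_self).aestronglyMeasurable measurableSet_Ioc)
    · rw [uIoc_of_le zero_le_one] at ht
      have hx := Ioc_subset_Icc_self ht
      have h1 := hnn t hx
      have h2 : φ t * (φ t + 1 / ((n : ℝ) + 1))⁻¹ ≤ 1 := by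
        have := hε n
        rw [← div_eq_mul_inv, div_le_one (by positivity)]; linarith
      have h3 : 0 ≤ φ t * (φ t + 1 / ((n : ℝ) + 1))⁻¹ := by
        have := hε n; positivity
      have h4 := hC t hx
      rw [show weight κ E t * φ t * (v t * v t * (φ t + 1 / ((n : ℝ) + 1))⁻¹) =
        weight κ E t * ((v ^ 2) t * (φ t * (φ t + 1 / ((n : ℝ) + 1))⁻¹)) by
          simp only [Pi.pow_apply]; ring, norm_mul, norm_mul]
      refine mul_le_mul (abs_weight_le hκ t) ?_ (by positivity) (by positivity)
      rw [Real.norm_of_nonneg h3]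
      exact (mul_le_of_le_one_right (norm_nonneg _) h2).trans h4
    · filter_upwards [hne] with t hne ht
      rw [uIoc_of_le zero_le_one] at ht
      have hp := hpos t ⟨ht.1, lt_of_le_of_ne ht.2 hne⟩
      have h1 : Tendsto (fun n : ℕ => φ t + 1 / ((n : ℝ) + 1)) atTop (𝓝 (φ t + 0)) :=
        tendsto_const_nhds.add tendsto_one_div_add_atTop_nhds_zero_nat
      rw [add_zero] at h1
      have h2 := ((h1.inv₀ hp.ne').const_mul (v t * v t)).const_mul (weight κ E t * φ t)
      convert h2 using 2
      field_simp
  refine le_of_tendsto (hlim.const_mul μ) (Eventually.of_forall fun n => hstep _ (by positivity))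

/-- Test the equation with the eigenfunction itself; as the energy is positive and μ > 0, the
weighted integral is positive too. -/
theorem IsPositivePrincipalEigenvalue.exists_energy (h₀ : 0 < β₀) (h₁ : 0 < β₁)
    (h : IsPositivePrincipalEigenvalue (weight κ E) β₀ β₁ μ) :
    0 < μ ∧ ∃ v v', IsH1 v v' ∧ 0 < ∫ t in (0 : ℝ)..1, weight κ E t * v t ^ 2 ∧
      (∫ t in (0 : ℝ)..1, v' t ^ 2) + β₀ * v 0 ^ 2 + β₁ * v 1 ^ 2 =
        μ * ∫ t in (0 : ℝ)..1, weight κ E t * v t ^ 2 := by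
  obtain ⟨hμ, φ, φ', hφ, hpos, hweak⟩ := h
  have h1 := hweak φ φ' hφ
  have e1 : (∫ t in (0 : ℝ)..1, φ' t ^ 2) + β₀ * φ 0 ^ 2 + β₁ * φ 1 ^ 2 =
      μ * ∫ t in (0 : ℝ)..1, weight κ E t * φ t ^ 2 := by
    simpa only [mul_assoc, ← sq] using h1
  have h2 := hφ.energy_pos h₀ h₁ (hpos (1 / 2) (by norm_num)).ne'
  rw [e1] at h2
  exact ⟨hμ, φ, φ', hφ, (pos_iff_pos_of_mul_pos h2).1 hμ, e1⟩

/-- Each of the two eigenvalues bounds the Rayleigh quotient from below, and the eigenfunction of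
the other attains the other as its quotient. -/
theorem IsPositivePrincipalEigenvalue.unique (hκ : 0 < κ) (hE : MeasurableSet E)
    (h₀ : 0 < β₀) (h₁ : 0 < β₁) (h : IsPositivePrincipalEigenvalue (weight κ E) β₀ β₁ μ)
    (h' : IsPositivePrincipalEigenvalue (weight κ E) β₀ β₁ ν) : μ = ν := by
  have key : ∀ {μ ν : ℝ}, IsPositivePrincipalEigenvalue (weight κ E) β₀ β₁ μ →
      IsPositivePrincipalEigenvalue (weight κ E) β₀ β₁ ν → μ ≤ ν := by
    intro μ ν h h'
    obtain ⟨-, v, v', hv, hp, e⟩ := h'.exists_energy h₀ h₁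
    have := h.le_energy hκ hE h₀ h₁ hv
    rw [e] at this
    exact le_of_mul_le_mul_right this hp
  exact le_antisymm (key h h') (key h' h)

theorem IsPositivePrincipalEigenvalue.sq_le (hκ : 0 < κ) (hc : 0 < c) (hc1 : c < 1)
    (h₀ : 0 < β₀) (h₁ : 0 < β₁) (hw : 0 < w)
    (hG : ∀ a ∈ Icc 0 (1 - c), 0 ≤ charFn κ c (1 - c) β₀ β₁ a w)
    (hE : MeasurableSet E) (hE01 : E ⊆ Ioo 0 1) (hEc : volume.real E ≤ c)
    (h : IsPositivePrincipalEigenvalue (weight κ E) β₀ β₁ μ) : w ^ 2 ≤ μ := by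
  obtain ⟨-, v, v', hv, hp, e⟩ := h.exists_energy h₀ h₁
  have := hv.rayleigh_le hκ hc hc1 h₀ h₁ hw hG hE hE01 hEc
  rw [e] at this
  exact le_of_mul_le_mul_right this hp

end uniqueness

/-! ### The eigenfunction for one favourable interval -/

/-- The function that is `f` on `(-∞, a]`, `g` on `(a, b]` and `h` on `(b, ∞)`. -/
def glue (a b : ℝ) (f g h : ℝ → ℝ) (x : ℝ) : ℝ := if x ≤ a then f x else if x ≤ b then g x else h x

section glue

variable {a b : ℝ} {f g h f' g' h' : ℝ → ℝ}

theorem glue_left {x : ℝ} (hx : x ≤ a) : glue a b f g h x = f x := if_pos hx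

theorem glue_mid {x : ℝ} (hx : a ≤ x) (hxb : x ≤ b) (hfg : f a = g a) :
    glue a b f g h x = g x := by
  rcases hx.eq_or_lt with rfl | hx
  · rw [glue_left le_rfl, hfg]
  · simp [glue, not_le.2 hx, hxb]

theorem glue_right {x : ℝ} (hab : a ≤ b) (hx : b ≤ x) (hfg : f a = g a) (hgh : g b = h b) :
    glue a b f g h x = h x := by
  rcases hx.eq_or_lt with rfl | hx
  · rw [glue_mid hab le_rfl hfg, hgh]
  · simp [glue, not_le.2 hx, not_le.2 (hab.trans_lt hx)]

theorem continuous_glue (hab : a ≤ b) (hf : Continuous f) (hg : Continuous g) (hh : Continuous h)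
    (hfg : f a = g a) (hgh : g b = h b) : Continuous (glue a b f g h) := by
  refine hf.if_le (hg.if_le hh continuous_id continuous_const ?_) continuous_id continuous_const ?_
  · rintro x rfl; exact hgh
  · rintro x rfl; rw [if_pos hab, hfg]

theorem isH1_glue (hab : a ≤ b) (hf : ∀ x, HasDerivAt f (f' x) x) (hg : ∀ x, HasDerivAt g (g' x) x)
    (hh : ∀ x, HasDerivAt h (h' x) x) (hf' : Continuous f') (hg' : Continuous g')
    (hh' : Continuous h') (hfg : f a = g a) (hgh : g b = h b) (hfg' : f' a = g' a)
    (hgh' : g' b = h' b) : IsH1 (glue a b f g h) (glue a b f' g' h') := by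
  have hc : ∀ {u u' : ℝ → ℝ}, (∀ x, HasDerivAt u (u' x) x) → Continuous u := fun hu =>
    continuous_iff_continuousAt.2 fun x => (hu x).continuousAt
  have hφ := continuous_glue hab (hc hf) (hc hg) (hc hh) hfg hgh
  have hφ' := continuous_glue hab hf' hg' hh' hfg' hgh'
  constructor
  · have := ContinuousOn.mul_memLp hφ'.continuousOn (memLp_const (1 : ℝ))
    simpa using this
  · intro x hx
    rw [integral_eq_of_hasDerivAt_off_countable_of_le (glue a b f g h) _ hx.1
      (s := {a, b}) (by simp) hφ.continuousOn ?_ (hφ'.intervalIntegrable _ _)]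
    · ring
    · rintro y ⟨-, hy⟩
      simp only [mem_insert_iff, mem_singleton_iff, not_or] at hy
      rcases lt_or_gt_of_ne hy.1 with hya | hya
      · rw [glue_left hya.le]
        refine (hf y).congr_of_eventuallyEq ?_
        filter_upwards [Iio_mem_nhds hya] with z hz using glue_left (le_of_lt hz)
      rcases lt_or_gt_of_ne hy.2 with hyb | hyb
      · rw [glue_mid hya.le hyb.le hfg']
        refine (hg y).congr_of_eventuallyEq ?_
        filter_upwards [Ioo_mem_nhds hya hyb] with z hz using glue_mid hz.1.le hz.2.le hfg
      · rw [glue_right hab hyb.le hfg' hgh']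
        refine (hh y).congr_of_eventuallyEq ?_
        filter_upwards [Ioi_mem_nhds hyb] with z hz using glue_right hab (le_of_lt hz) hfg hgh

/-- Integrate by parts on the three pieces. The boundary terms at a and b cancel because the
derivatives match, and those at 0 and 1 are the Robin terms. -/
theorem weak_glue {κ β₀ β₁ μ : ℝ} (ha : 0 ≤ a) (hab : a ≤ b) (hb : b ≤ 1)
    (hf : ∀ x, HasDerivAt f (f' x) x) (hg : ∀ x, HasDerivAt g (g' x) x)
    (hh : ∀ x, HasDerivAt h (h' x) x) (hf' : ∀ x, HasDerivAt f' (μ * f x) x)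
    (hg' : ∀ x, HasDerivAt g' (-(μ * κ * g x)) x) (hh' : ∀ x, HasDerivAt h' (μ * h x) x)
    (hfg : f a = g a) (hgh : g b = h b) (hfg' : f' a = g' a) (hgh' : g' b = h' b)
    (h0 : f' 0 = β₀ * f 0) (h1 : h' 1 = -(β₁ * h 1)) {v v' : ℝ → ℝ} (hv : IsH1 v v') :
    (∫ x in (0 : ℝ)..1, glue a b f' g' h' x * v' x) + β₀ * glue a b f g h 0 * v 0 +
        β₁ * glue a b f g h 1 * v 1 =
      μ * ∫ x in (0 : ℝ)..1, weight κ (Ioo a b) x * glue a b f g h x * v x := by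
  have hc : ∀ {u u' : ℝ → ℝ}, (∀ x, HasDerivAt u (u' x) x) → Continuous u := fun hu =>
    continuous_iff_continuousAt.2 fun x => (hu x).continuousAt
  have cf := hc hf
  have cg := hc hg
  have ch := hc hh
  have hφ' := continuous_glue hab (hc hf') (hc hg') (hc hh') hfg' hgh'
  have hφ := continuous_glue hab cf cg ch hfg hgh
  have p1 := hv.integral_parts le_rfl ha (hab.trans hb) (fun t _ => hf' t) (by fun_prop)
  have p2 := hv.integral_parts ha hab hb (fun t _ => hg' t) (by fun_prop)
  have p3 := hv.integral_parts (ha.trans hab) hb le_rfl (fun t _ => hh' t) (by fun_prop)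
  have i1 : ∀ x y, 0 ≤ x → x ≤ y → y ≤ 1 →
      IntervalIntegrable (fun t => glue a b f' g' h' t * v' t) volume x y := fun x y hx hxy hy =>
    (hv.intervalIntegrable.restrict_unit hx hxy hy).continuousOn_mul hφ'.continuousOn
  have i2 : ∀ x y, 0 ≤ x → x ≤ y → y ≤ 1 → IntervalIntegrable
      (fun t => weight κ (Ioo a b) t * glue a b f g h t * v t) volume x y := by
    intro x y hx hxy hy
    have hi : IntervalIntegrable (fun t => glue a b f g h t * v t) volume x y :=
      ContinuousOn.intervalIntegrable_of_Icc hxy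
        (hφ.continuousOn.mul (hv.continuousOn_mono hx hy))
    refine (((intervalIntegrable_indicator_mul (measurableSet_Ioo (a := a) (b := b)) hi).const_mul (κ + 1)).sub
      hi).congr fun t _ => ?_
    simp only [weight_eq]
    ring
  rw [← intervalIntegral.integral_add_adjacent_intervals (i1 0 b le_rfl (ha.trans hab) hb)
      (i1 b 1 (ha.trans hab) hb le_rfl),
    ← intervalIntegral.integral_add_adjacent_intervals (i1 0 a le_rfl ha (hab.trans hb))
      (i1 a b ha hab hb),
    ← intervalIntegral.integral_add_adjacent_intervals (i2 0 b le_rfl (ha.trans hab) hb)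
      (i2 b 1 (ha.trans hab) hb le_rfl),
    ← intervalIntegral.integral_add_adjacent_intervals (i2 0 a le_rfl ha (hab.trans hb))
      (i2 a b ha hab hb)]
  have q1 : ∫ t in (0 : ℝ)..a, glue a b f' g' h' t * v' t = ∫ t in (0 : ℝ)..a, f' t * v' t :=
    intervalIntegral.integral_congr_Ioo_of_le ha fun t ht => by
      simp only [glue_left ht.2.le]
  have q2 : ∫ t in a..b, glue a b f' g' h' t * v' t = ∫ t in a..b, g' t * v' t :=
    intervalIntegral.integral_congr_Ioo_of_le hab fun t ht => by
      simp only [glue_mid ht.1.le ht.2.le hfg']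
  have q3 : ∫ t in b..1, glue a b f' g' h' t * v' t = ∫ t in b..1, h' t * v' t :=
    intervalIntegral.integral_congr_Ioo_of_le hb fun t ht => by
      simp only [glue_right hab ht.1.le hfg' hgh']
  have r1 : μ * ∫ t in (0 : ℝ)..a, weight κ (Ioo a b) t * glue a b f g h t * v t =
      -∫ t in (0 : ℝ)..a, μ * f t * v t := by
    rw [← intervalIntegral.integral_const_mul, ← intervalIntegral.integral_neg]
    refine intervalIntegral.integral_congr_Ioo_of_le ha fun t ht => ?_
    have : t ∉ Ioo a b := fun h => lt_asymm h.1 ht.2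
    simp only [glue_left ht.2.le, weight_eq, indicator_of_notMem this]
    ring
  have r2 : μ * ∫ t in a..b, weight κ (Ioo a b) t * glue a b f g h t * v t =
      -∫ t in a..b, -(μ * κ * g t) * v t := by
    rw [← intervalIntegral.integral_const_mul, ← intervalIntegral.integral_neg]
    refine intervalIntegral.integral_congr_Ioo_of_le hab fun t ht => ?_
    simp only [glue_mid ht.1.le ht.2.le hfg, weight_eq, indicator_of_mem ht, Pi.one_apply]
    ring
  have r3 : μ * ∫ t in b..1, weight κ (Ioo a b) t * glue a b f g h t * v t =
      -∫ t in b..1, μ * h t * v t := by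
    rw [← intervalIntegral.integral_const_mul, ← intervalIntegral.integral_neg]
    refine intervalIntegral.integral_congr_Ioo_of_le hb fun t ht => ?_
    have : t ∉ Ioo a b := fun h => lt_asymm h.2 ht.1
    simp only [glue_right hab ht.1.le hfg hgh, weight_eq, indicator_of_notMem this]
    ring
  rw [mul_add, mul_add, r1, r2, r3, q1, q2, q3, p1, p2, p3, glue_left ha,
    glue_right hab hb hfg hgh, h0, h1, hfg', hgh']
  ring

end glue

/-- The eigenfunction is the hyperbolic Robin solution on each side and a cosine in the middle whose
phase falls from θ at a. The equation `charFn` = 0 says that the phase at a + c is -η, which is what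
the right-hand solution requires. -/
theorem isPositivePrincipalEigenvalue_of_charFn_eq_zero {κ c β₀ β₁ a w : ℝ} (hκ : 0 < κ)
    (hc : 0 < c) (h₀ : 0 < β₀) (h₁ : 0 < β₁) (hw : 0 < w) (ha : a ∈ Icc 0 (1 - c))
    (h : charFn κ c (1 - c) β₀ β₁ a w = 0) :
    IsPositivePrincipalEigenvalue (weight κ (Ioo a (a + c))) β₀ β₁ (w ^ 2) := by
  have hk := Real.sqrt_pos.2 hκ
  have hk2 := Real.sq_sqrt hκ.le
  have hr : 0 ≤ 1 - c - a := sub_nonneg.2 ha.2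
  set θ := edgeAngle κ β₀ w a with hθ
  set η := edgeAngle κ β₁ w (1 - c - a) with hη
  have hsum : θ - w * √κ * c = -η := by
    have : θ + η - w * √κ * c = 0 := h
    linarith
  have hθ0 : 0 < θ := edgeAngle_pos hκ h₀ hw ha.1
  have hη0 : 0 < η := edgeAngle_pos hκ h₁ hw hr
  have hθ1 : θ < Real.pi / 2 := edgeAngle_lt
  have hη1 : η < Real.pi / 2 := edgeAngle_lt
  have hcθ : 0 < Real.cos θ := Real.cos_pos_of_mem_Ioo ⟨by linarith, hθ1⟩
  have hcη : 0 < Real.cos η := Real.cos_pos_of_mem_Ioo ⟨by linarith, hη1⟩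
  have hD0 := edgeDen_pos h₀ hw ha.1
  have hD1 := edgeDen_pos h₁ hw hr
  set D₀ := w * Real.cosh (w * a) + β₀ * Real.sinh (w * a) with hD₀
  set D₁ := w * Real.cosh (w * (1 - c - a)) + β₁ * Real.sinh (w * (1 - c - a)) with hD₁
  have hsθ : √κ * Real.sin θ = edgeSlope β₀ w a * Real.cos θ := by
    have : Real.tan θ = edgeSlope β₀ w a / √κ := Real.tan_arctan _
    rw [Real.tan_eq_sin_div_cos] at this
    field_simp at this
    linarith
  have hsη : √κ * Real.sin η = edgeSlope β₁ w (1 - c - a) * Real.cos η := by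
    have : Real.tan η = edgeSlope β₁ w (1 - c - a) / √κ := Real.tan_arctan _
    rw [Real.tan_eq_sin_div_cos] at this
    field_simp at this
    linarith
  have hX0 : edgeSlope β₀ w a * D₀ =
      β₀ * Real.cosh (w * a) + w * Real.sinh (w * a) := div_mul_cancel₀ _ hD0.ne'
  have hX1 : edgeSlope β₁ w (1 - c - a) * D₁ =
      β₁ * Real.cosh (w * (1 - c - a)) + w * Real.sinh (w * (1 - c - a)) :=
    div_mul_cancel₀ _ hD1.ne'
  -- The amplitudes A and B match the values at a and at a + c; the derivatives then match by `hsθ`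
  -- and `hsη`.
  set A := D₀ / Real.cos θ with hA
  set B := A * Real.cos η / D₁ with hB
  have hA0 : 0 < A := div_pos hD0 hcθ
  have hB0 : 0 < B := div_pos (mul_pos hA0 hcη) hD1
  have hAθ : A * Real.cos θ = D₀ := div_mul_cancel₀ _ hcθ.ne'
  have hBD : B * D₁ = A * Real.cos η := div_mul_cancel₀ _ hD1.ne'
  set f : ℝ → ℝ := fun x => w * Real.cosh (w * x) + β₀ * Real.sinh (w * x) with hf
  set f' : ℝ → ℝ := fun x => w * (β₀ * Real.cosh (w * x) + w * Real.sinh (w * x)) with hf'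
  set g : ℝ → ℝ := fun x => A * Real.cos (θ - w * √κ * (x - a)) with hg
  set g' : ℝ → ℝ := fun x => A * (w * √κ * Real.sin (θ - w * √κ * (x - a))) with hg'
  set p : ℝ → ℝ := fun x => B * (w * Real.cosh (w * (1 - x)) + β₁ * Real.sinh (w * (1 - x)))
    with hp
  set p' : ℝ → ℝ := fun x =>
    -(B * (w * (β₁ * Real.cosh (w * (1 - x)) + w * Real.sinh (w * (1 - x))))) with hp'
  have hlin : ∀ x, HasDerivAt (fun x => w * x) w x := fun x => by
    simpa using (hasDerivAt_id x).const_mul w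
  have hlin1 : ∀ x, HasDerivAt (fun x => w * (1 - x)) (-w) x := fun x => by
    simpa using ((hasDerivAt_id x).const_sub 1).const_mul w
  have hlin2 : ∀ x, HasDerivAt (fun x => θ - w * √κ * (x - a)) (-(w * √κ)) x := fun x => by
    simpa using (((hasDerivAt_id x).sub_const a).const_mul (w * √κ)).const_sub θ
  have df : ∀ x, HasDerivAt f (f' x) x := fun x =>
    (((hlin x).cosh.const_mul w).add ((hlin x).sinh.const_mul β₀)).congr_deriv (by
      simp only [hf']; ring)
  have df' : ∀ x, HasDerivAt f' (w ^ 2 * f x) x := fun x =>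
    ((((hlin x).cosh.const_mul β₀).add ((hlin x).sinh.const_mul w)).const_mul w).congr_deriv (by
      simp only [hf]; ring)
  have dg : ∀ x, HasDerivAt g (g' x) x := fun x =>
    ((hlin2 x).cos.const_mul A).congr_deriv (by simp only [hg']; ring)
  have dg' : ∀ x, HasDerivAt g' (-(w ^ 2 * κ * g x)) x := fun x =>
    (((hlin2 x).sin.const_mul (w * √κ)).const_mul A).congr_deriv (by
      simp only [hg]; nth_rw 4 [← hk2]; ring)
  have dp : ∀ x, HasDerivAt p (p' x) x := fun x =>
    ((((hlin1 x).cosh.const_mul w).add ((hlin1 x).sinh.const_mul β₁)).const_mul B).congr_deriv (by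
      simp only [hp']; ring)
  have dp' : ∀ x, HasDerivAt p' (w ^ 2 * p x) x := fun x =>
    (((((hlin1 x).cosh.const_mul β₁).add
      ((hlin1 x).sinh.const_mul w)).const_mul w).const_mul B).neg.congr_deriv (by
      simp only [hp]; ring)
  have e0 : θ - w * √κ * (a - a) = θ := by ring
  have e1 : θ - w * √κ * (a + c - a) = -η := by rw [← hsum]; ring
  have e2 : 1 - (a + c) = 1 - c - a := by ring
  have hfg : f a = g a := by simp only [hf, hg, e0, hAθ, hD₀]
  have hfg' : f' a = g' a := by
    simp only [hf', hg', e0]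
    rw [← hX0, ← hAθ]
    linear_combination (-A * w) * hsθ
  have hgp : g (a + c) = p (a + c) := by
    simp only [hg, hp, e1, e2, Real.cos_neg]
    rw [hBD]
  have hgp' : g' (a + c) = p' (a + c) := by
    simp only [hg', hp', e1, e2, Real.sin_neg]
    rw [← hX1]
    linear_combination (-A * w) * hsη + w * edgeSlope β₁ w (1 - c - a) * hBD
  have hab : a ≤ a + c := by linarith
  have hb : a + c ≤ 1 := by linarith
  have hcont : ∀ {u u' : ℝ → ℝ}, (∀ x, HasDerivAt u (u' x) x) → Continuous u := fun hu =>
    continuous_iff_continuousAt.2 fun x => (hu x).continuousAt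
  refine ⟨by positivity, glue a (a + c) f g p, glue a (a + c) f' g' p',
    isH1_glue hab df dg dp (hcont df') (hcont dg') (hcont dp') hfg hgp hfg' hgp', ?_,
    fun v v' hv => weak_glue ha.1 hab hb df dg dp df' dg' dp' hfg hgp hfg' hgp' ?_ ?_ hv⟩
  · intro x hx
    rcases le_total x a with hxa | hxa
    · rw [glue_left hxa]
      exact edgeDen_pos h₀ hw hx.1.le
    rcases le_total x (a + c) with hxb | hxb
    · rw [glue_mid hxa hxb hfg]
      have u1 : 0 ≤ w * √κ * (x - a) := mul_nonneg (by positivity) (sub_nonneg.2 hxa)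
      have u2 : w * √κ * (x - a) ≤ w * √κ * c :=
        mul_le_mul_of_nonneg_left (by linarith) (by positivity)
      exact mul_pos hA0 (Real.cos_pos_of_mem_Ioo ⟨by linarith, by linarith⟩)
    · rw [glue_right hab hxb hfg hgp]
      exact mul_pos hB0 (edgeDen_pos h₁ hw (sub_nonneg.2 hx.2.le))
  · simp [hf, hf']; ring
  · simp [hp, hp']; ring

/-! ### The frequency as a function of the position -/

/-- The standing assumptions on the parameters. -/
structure Admissible (κ c l β₀ β₁ : ℝ) : Prop where
  hκ : 0 < κ
  hc : 0 < c
  hl : 0 < l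
  h₀ : 0 < β₀
  h₁ : 0 < β₁

/-- The square root of the principal eigenvalue for the favourable interval `(a, a + c)`: the
positive zero of the characteristic function. -/
def freq (κ c l β₀ β₁ a : ℝ) : ℝ :=
  Classical.epsilon fun w => 0 < w ∧ charFn κ c l β₀ β₁ a w = 0

/-- `asym`, evaluated at the frequency. -/
def freqAsym (κ c l β₀ β₁ a : ℝ) : ℝ := asym l β₀ β₁ a (freq κ c l β₀ β₁ a)

theorem contDiffAt_edgeAngle {κ β w s : ℝ} (hβ : 0 < β) (hw : 0 < w) (hs : 0 ≤ s) :
    ContDiffAt ℝ 1 (fun z : ℝ × ℝ => edgeAngle κ β z.1 z.2) (w, s) := by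
  have h1 : ContDiffAt ℝ 1 (fun z : ℝ × ℝ => edgeSlope β z.1 z.2) (w, s) := by
    unfold edgeSlope
    exact ContDiffAt.div (by fun_prop) (by fun_prop) (edgeDen_pos hβ hw hs).ne'
  exact (h1.div_const √κ).arctan

theorem contDiffAt_charFn {κ c l β₀ β₁ a w : ℝ} (h₀ : 0 < β₀) (h₁ : 0 < β₁) (hw : 0 < w)
    (ha : a ∈ Icc 0 l) :
    ContDiffAt ℝ 1 (fun z : ℝ × ℝ => charFn κ c l β₀ β₁ z.1 z.2) (a, w) := by
  have e0 : ContDiffAt ℝ 1 (fun z : ℝ × ℝ => edgeAngle κ β₀ z.2 z.1) (a, w) :=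
    ContDiffAt.comp (g := fun z : ℝ × ℝ => edgeAngle κ β₀ z.1 z.2)
      (f := fun z : ℝ × ℝ => (z.2, z.1)) (a, w) (contDiffAt_edgeAngle h₀ hw ha.1) (by fun_prop)
  have e1 : ContDiffAt ℝ 1 (fun z : ℝ × ℝ => edgeAngle κ β₁ z.2 (l - z.1)) (a, w) :=
    ContDiffAt.comp (g := fun z : ℝ × ℝ => edgeAngle κ β₁ z.1 z.2)
      (f := fun z : ℝ × ℝ => (z.2, l - z.1)) (a, w)
      (contDiffAt_edgeAngle h₁ hw (sub_nonneg.2 ha.2)) (by fun_prop)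
  exact (e0.add e1).sub (by fun_prop)

/-- The implicit function theorem for a scalar equation in two real variables. -/
theorem exists_implicit {G : ℝ × ℝ → ℝ} {a w ga gw : ℝ} (hG : ContDiffAt ℝ 1 G (a, w))
    (h0 : G (a, w) = 0) (ha : HasDerivAt (fun x => G (x, w)) ga a)
    (hw : HasDerivAt (fun y => G (a, y)) gw w) (hne : gw ≠ 0) :
    ∃ ψ : ℝ → ℝ, ψ a = w ∧ HasDerivAt ψ (-ga / gw) a ∧ ∀ᶠ x in 𝓝 a, G (x, ψ x) = 0 := by
  have hs := hG.hasStrictFDerivAt one_ne_zero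
  set G' := fderiv ℝ G (a, w)
  have e1 : G' (1, 0) = ga := (hs.hasFDerivAt.comp_hasDerivAt a
    ((hasDerivAt_id a).prodMk (hasDerivAt_const a w))).unique ha
  have e2 : G' (0, 1) = gw := (hs.hasFDerivAt.comp_hasDerivAt w
    ((hasDerivAt_const w a).prodMk (hasDerivAt_id w))).unique hw
  have hinv : (G' ∘L .inr ℝ ℝ ℝ).IsInvertible := by
    refine ⟨ContinuousLinearEquiv.unitsEquivAut ℝ (Units.mk0 gw hne), ?_⟩
    ext
    simp [e2]
  have hψ := hs.hasStrictFDerivAt_implicitFunctionOfProdDomain hinv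
  have hev := hs.eventually_apply_implicitFunctionOfProdDomain hinv
  have hself := (hs.eventually_apply_eq_iff_implicitFunctionOfProdDomain hinv).self_of_nhds.1 rfl
  set ψ := hs.implicitFunctionOfProdDomain hinv
  have hd := hψ.hasFDerivAt.hasDerivAt
  rw [h0] at hev
  refine ⟨ψ, hself, ?_, hev⟩
  have hself' : ψ a = w := hself
  have hs' : HasFDerivAt G G' (a, ψ a) := by rw [hself']; exact hs.hasFDerivAt
  -- The value of the derivative comes from differentiating x ↦ G(x, ψ x), which is 0 near a.
  have hcomp := hs'.comp_hasDerivAt a ((hasDerivAt_id a).prodMk hd)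
  have hzero : HasDerivAt (G ∘ fun x => (id x, ψ x)) 0 a :=
    (hasDerivAt_const a (0 : ℝ)).congr_of_eventuallyEq hev
  have h2 := hcomp.unique hzero
  refine hd.congr_deriv ?_
  set D := (-(G' ∘L .inr ℝ ℝ ℝ).inverse ∘L (G' ∘L .inl ℝ ℝ ℝ)) 1
  have h3 : ((1 : ℝ), D) = (1, 0) + D • ((0 : ℝ), (1 : ℝ)) := by simp
  have h4 : G' (1, D) = 0 := h2
  rw [h3, map_add, map_smul, e1, e2, smul_eq_mul] at h4
  rw [eq_div_iff hne]
  linarith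

namespace Admissible

variable {κ c l β₀ β₁ a w : ℝ}

theorem freq_spec (H : Admissible κ c l β₀ β₁) (ha : a ∈ Icc 0 l) :
    0 < freq κ c l β₀ β₁ a ∧ charFn κ c l β₀ β₁ a (freq κ c l β₀ β₁ a) = 0 :=
  Classical.epsilon_spec (p := fun w => 0 < w ∧ charFn κ c l β₀ β₁ a w = 0)
    (exists_charFn_eq_zero H.hκ H.hc H.h₀ H.h₁ ha)

theorem freq_pos (H : Admissible κ c l β₀ β₁) (ha : a ∈ Icc 0 l) :
    0 < freq κ c l β₀ β₁ a := (H.freq_spec ha).1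

/-- As `charFn` / w decreases strictly through 0 at the frequency, the sign of `charFn` locates w
relative to it. All comparisons of frequencies at different positions rest on this. -/
theorem lt_freq_of_pos (H : Admissible κ c l β₀ β₁) (ha : a ∈ Icc 0 l) (hw : 0 < w)
    (h : 0 < charFn κ c l β₀ β₁ a w) : w < freq κ c l β₀ β₁ a := by
  obtain ⟨h1, h2⟩ := H.freq_spec ha
  by_contra hcon
  rcases (not_lt.1 hcon).eq_or_lt with h3 | h3
  · rw [← h3, h2] at h; exact h.false
  · have := charFn_div_lt (c := c) H.hκ H.h₀ H.h₁ h1 ha h3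
    rw [h2, zero_div] at this
    exact lt_asymm this (div_pos h hw)

theorem freq_lt_of_neg (H : Admissible κ c l β₀ β₁) (ha : a ∈ Icc 0 l) (hw : 0 < w)
    (h : charFn κ c l β₀ β₁ a w < 0) : freq κ c l β₀ β₁ a < w := by
  obtain ⟨h1, h2⟩ := H.freq_spec ha
  by_contra hcon
  rcases (not_lt.1 hcon).eq_or_lt with h3 | h3
  · rw [h3, h2] at h; exact h.false
  · have := charFn_div_lt (c := c) H.hκ H.h₀ H.h₁ hw ha h3
    rw [h2, zero_div] at this
    exact lt_asymm this (div_neg_of_neg_of_pos h hw)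

theorem charFn_nonneg (H : Admissible κ c l β₀ β₁) (ha : a ∈ Icc 0 l) (hw : 0 < w)
    (h : w ≤ freq κ c l β₀ β₁ a) : 0 ≤ charFn κ c l β₀ β₁ a w :=
  not_lt.1 fun hn => (H.freq_lt_of_neg ha hw hn).not_ge h

theorem freq_eq (H : Admissible κ c l β₀ β₁) (ha : a ∈ Icc 0 l) (hw : 0 < w)
    (h : charFn κ c l β₀ β₁ a w = 0) : freq κ c l β₀ β₁ a = w := by
  obtain ⟨h1, h2⟩ := H.freq_spec ha
  rcases lt_trichotomy (freq κ c l β₀ β₁ a) w with h3 | h3 | h3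
  · have := charFn_div_lt (c := c) H.hκ H.h₀ H.h₁ h1 ha h3
    simp [h, h2] at this
  · exact h3
  · have := charFn_div_lt (c := c) H.hκ H.h₀ H.h₁ hw ha h3
    simp [h, h2] at this

/-- At the zero, w ∂_w `charFn` < `charFn` = 0, so the implicit function theorem applies, and K =
`slopeFactor` / (-∂_w `charFn`). -/
theorem hasDerivWithinAt_freq (H : Admissible κ c l β₀ β₁) (ha : a ∈ Icc 0 l) :
    ∃ K, 0 < K ∧ HasDerivWithinAt (freq κ c l β₀ β₁) (K * freqAsym κ c l β₀ β₁ a)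
      (Icc 0 l) a := by
  obtain ⟨hw, h0⟩ := H.freq_spec ha
  obtain ⟨w, hwdef⟩ : ∃ w, freq κ c l β₀ β₁ a = w := ⟨_, rfl⟩
  rw [hwdef] at hw h0
  have hneg := freq_mul_deriv_charFn_lt (c := c) H.hκ H.h₀ H.h₁ hw ha
  rw [h0] at hneg
  have hgw : edgeAngleFreqDeriv κ β₀ w a + edgeAngleFreqDeriv κ β₁ w (l - a) - √κ * c < 0 :=
    neg_of_mul_neg_right hneg hw.le
  obtain ⟨ψ, hψa, hψ, hev⟩ := exists_implicit (contDiffAt_charFn H.h₀ H.h₁ hw ha) h0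
    (hasDerivAt_charFn_pos (c := c) H.hκ H.h₀ H.h₁ hw ha)
    (hasDerivAt_charFn_freq H.h₀ H.h₁ hw ha) hgw.ne
  refine ⟨slopeFactor κ l β₀ β₁ a w /
    -(edgeAngleFreqDeriv κ β₀ w a + edgeAngleFreqDeriv κ β₁ w (l - a) - √κ * c),
    div_pos (slopeFactor_pos H.hκ H.h₀ H.h₁ hw ha) (neg_pos.2 hgw), ?_⟩
  -- The implicit solution equals `freq` where it is positive, by uniqueness of the zero; that
  -- uniqueness holds only for x in [0, l], hence the derivative within the interval.
  have hpos : ∀ᶠ x in 𝓝 a, 0 < ψ x :=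
    hψ.continuousAt.eventually_const_lt (by rw [hψa]; exact hw)
  have hd := hψ.hasDerivWithinAt (s := Icc 0 l)
  refine (hd.congr_of_eventuallyEq ?_ (by rw [hψa, hwdef])).congr_deriv ?_
  · filter_upwards [self_mem_nhdsWithin, nhdsWithin_le_nhds hev, nhdsWithin_le_nhds hpos]
      with x hx h1 h2
    exact H.freq_eq hx h2 h1
  · rw [freqAsym, hwdef, div_neg, neg_mul, neg_div, div_mul_eq_mul_div]

theorem continuousOn_freq (H : Admissible κ c l β₀ β₁) :
    ContinuousOn (freq κ c l β₀ β₁) (Icc 0 l) := fun _ ha => by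
  obtain ⟨K, -, hd⟩ := H.hasDerivWithinAt_freq ha
  exact hd.continuousWithinAt

theorem continuousOn_freqAsym (H : Admissible κ c l β₀ β₁) :
    ContinuousOn (freqAsym κ c l β₀ β₁) (Icc 0 l) := by
  have h1 := H.continuousOn_freq
  have h2 : Continuous Real.tanh :=
    continuous_iff_continuousAt.2 fun x => (hasDerivAt_tanh x).continuousAt
  unfold freqAsym asym
  have h3 : ContinuousOn (fun a => Real.tanh (freq κ c l β₀ β₁ a * (l - 2 * a))) (Icc 0 l) :=
    h2.comp_continuousOn (by fun_prop)
  fun_prop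

theorem freq_le_freq (H : Admissible κ c l β₀ β₁) {x y : ℝ} (hx : 0 ≤ x) (hxy : x ≤ y)
    (hy : y ≤ l) (h : ∀ a ∈ Ioo x y, 0 ≤ freqAsym κ c l β₀ β₁ a) :
    freq κ c l β₀ β₁ x ≤ freq κ c l β₀ β₁ y := by
  have : MonotoneOn (freq κ c l β₀ β₁) (Icc x y) := by
    have hd : ∀ a ∈ Ioo x y, ∃ K, 0 < K ∧
        HasDerivAt (freq κ c l β₀ β₁) (K * freqAsym κ c l β₀ β₁ a) a := fun a ha => by
      have ha0 : 0 < a := hx.trans_lt ha.1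
      have hal : a < l := ha.2.trans_le hy
      obtain ⟨K, hK, hd⟩ := H.hasDerivWithinAt_freq ⟨ha0.le, hal.le⟩
      exact ⟨K, hK, hd.hasDerivAt (Icc_mem_nhds ha0 hal)⟩
    refine monotoneOn_of_deriv_nonneg (convex_Icc x y)
      (H.continuousOn_freq.mono (Icc_subset_Icc hx hy)) (fun a ha => ?_) fun a ha => ?_
    · rw [interior_Icc] at ha
      obtain ⟨K, -, hd⟩ := hd a ha
      exact hd.differentiableAt.differentiableWithinAt
    · rw [interior_Icc] at ha
      obtain ⟨K, hK, hd⟩ := hd a ha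
      rw [hd.deriv]
      exact mul_nonneg hK.le (h a ha)
  exact this ⟨le_rfl, hxy⟩ ⟨hxy, le_rfl⟩ hxy

theorem freq_le_freq' (H : Admissible κ c l β₀ β₁) {x y : ℝ} (hx : 0 ≤ x) (hxy : x ≤ y)
    (hy : y ≤ l) (h : ∀ a ∈ Ioo x y, freqAsym κ c l β₀ β₁ a ≤ 0) :
    freq κ c l β₀ β₁ y ≤ freq κ c l β₀ β₁ x := by
  have : AntitoneOn (freq κ c l β₀ β₁) (Icc x y) := by
    have hd : ∀ a ∈ Ioo x y, ∃ K, 0 < K ∧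
        HasDerivAt (freq κ c l β₀ β₁) (K * freqAsym κ c l β₀ β₁ a) a := fun a ha => by
      have ha0 : 0 < a := hx.trans_lt ha.1
      have hal : a < l := ha.2.trans_le hy
      obtain ⟨K, hK, hd⟩ := H.hasDerivWithinAt_freq ⟨ha0.le, hal.le⟩
      exact ⟨K, hK, hd.hasDerivAt (Icc_mem_nhds ha0 hal)⟩
    refine antitoneOn_of_deriv_nonpos (convex_Icc x y)
      (H.continuousOn_freq.mono (Icc_subset_Icc hx hy)) (fun a ha => ?_) fun a ha => ?_
    · rw [interior_Icc] at ha
      obtain ⟨K, -, hd⟩ := hd a ha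
      exact hd.differentiableAt.differentiableWithinAt
    · rw [interior_Icc] at ha
      obtain ⟨K, hK, hd⟩ := hd a ha
      rw [hd.deriv]
      exact mul_nonpos_of_nonneg_of_nonpos hK.le (h a ha)
  exact this ⟨le_rfl, hxy⟩ ⟨hxy, le_rfl⟩ hxy

/-! ### Critical points -/

theorem strictMonoOn_charFn (H : Admissible κ c l β₀ β₁) (hw : 0 < w) {x y : ℝ} (hx : 0 ≤ x)
    (hy : y ≤ l) (h : ∀ a ∈ Ioo x y, 0 < asym l β₀ β₁ a w) :
    StrictMonoOn (fun a => charFn κ c l β₀ β₁ a w) (Icc x y) := by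
  have hd := fun a (ha : a ∈ Icc x y) => hasDerivAt_charFn_pos (c := c) H.hκ H.h₀ H.h₁ hw
    (⟨hx.trans ha.1, ha.2.trans hy⟩ : a ∈ Icc 0 l)
  refine strictMonoOn_of_deriv_pos (convex_Icc x y)
    (fun a ha => (hd a ha).continuousAt.continuousWithinAt) fun a ha => ?_
  rw [interior_Icc] at ha
  have ha' := Ioo_subset_Icc_self ha
  rw [(hd a ha').deriv]
  exact mul_pos (slopeFactor_pos H.hκ H.h₀ H.h₁ hw ⟨hx.trans ha'.1, ha'.2.trans hy⟩) (h a ha)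

theorem strictAntiOn_charFn (H : Admissible κ c l β₀ β₁) (hw : 0 < w) {x y : ℝ} (hx : 0 ≤ x)
    (hy : y ≤ l) (h : ∀ a ∈ Ioo x y, asym l β₀ β₁ a w < 0) :
    StrictAntiOn (fun a => charFn κ c l β₀ β₁ a w) (Icc x y) := by
  have hd := fun a (ha : a ∈ Icc x y) => hasDerivAt_charFn_pos (c := c) H.hκ H.h₀ H.h₁ hw
    (⟨hx.trans ha.1, ha.2.trans hy⟩ : a ∈ Icc 0 l)
  refine strictAntiOn_of_deriv_neg (convex_Icc x y)
    (fun a ha => (hd a ha).continuousAt.continuousWithinAt) fun a ha => ?_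
  rw [interior_Icc] at ha
  have ha' := Ioo_subset_Icc_self ha
  rw [(hd a ha').deriv]
  exact mul_neg_of_pos_of_neg
    (slopeFactor_pos H.hκ H.h₀ H.h₁ hw ⟨hx.trans ha'.1, ha'.2.trans hy⟩) (h a ha)

end Admissible

/-- Since tanh(w(l - 2a)) decreases in a, the sign of w² - β₀β₁ fixes the direction of monotonicity;
this separates minima from maxima. -/
theorem asym_lt_asym {l β₀ β₁ x y w : ℝ} (hw : 0 < w) (hxy : x < y) (h : w ^ 2 < β₀ * β₁) :
    asym l β₀ β₁ x w < asym l β₀ β₁ y w := by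
  have : Real.tanh (w * (l - 2 * y)) < Real.tanh (w * (l - 2 * x)) :=
    strictMono_tanh (by nlinarith)
  unfold asym
  nlinarith

theorem asym_lt_asym' {l β₀ β₁ x y w : ℝ} (hw : 0 < w) (hxy : x < y) (h : β₀ * β₁ < w ^ 2) :
    asym l β₀ β₁ y w < asym l β₀ β₁ x w := by
  have : Real.tanh (w * (l - 2 * y)) < Real.tanh (w * (l - 2 * x)) :=
    strictMono_tanh (by nlinarith)
  unfold asym
  nlinarith

namespace Admissible

variable {κ c l β₀ β₁ a w s : ℝ}

/-- A critical point with `λ < β₀ β₁` is a strict global minimum. -/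
theorem freq_lt_of_critical (H : Admissible κ c l β₀ β₁) (hs : s ∈ Icc 0 l)
    (h0 : freqAsym κ c l β₀ β₁ s = 0) (hlt : freq κ c l β₀ β₁ s ^ 2 < β₀ * β₁)
    (ha : a ∈ Icc 0 l) (has : a ≠ s) : freq κ c l β₀ β₁ s < freq κ c l β₀ β₁ a := by
  obtain ⟨hw, hz⟩ := H.freq_spec hs
  rw [freqAsym] at h0
  -- With w frozen at the frequency of s, `charFn` has a strict minimum 0 at s, so it is positive at
  -- a.
  refine H.lt_freq_of_pos ha hw ?_
  rcases lt_or_gt_of_ne has with h | h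
  · have := H.strictAntiOn_charFn (y := s) hw ha.1 hs.2 (fun x hx => by
      rw [← h0]; exact asym_lt_asym hw hx.2 hlt) ⟨le_rfl, h.le⟩ ⟨h.le, le_rfl⟩ h
    simpa only [hz] using this
  · have := H.strictMonoOn_charFn (x := s) hw hs.1 ha.2 (fun x hx => by
      rw [← h0]; exact asym_lt_asym hw hx.1 hlt) ⟨le_rfl, h.le⟩ ⟨h.le, le_rfl⟩ h
    simpa only [hz] using this

/-- A critical point with `λ > β₀ β₁` is a strict global maximum. -/
theorem freq_lt_of_critical' (H : Admissible κ c l β₀ β₁) (hs : s ∈ Icc 0 l)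
    (h0 : freqAsym κ c l β₀ β₁ s = 0) (hlt : β₀ * β₁ < freq κ c l β₀ β₁ s ^ 2)
    (ha : a ∈ Icc 0 l) (has : a ≠ s) : freq κ c l β₀ β₁ a < freq κ c l β₀ β₁ s := by
  obtain ⟨hw, hz⟩ := H.freq_spec hs
  rw [freqAsym] at h0
  refine H.freq_lt_of_neg ha hw ?_
  rcases lt_or_gt_of_ne has with h | h
  · have := H.strictMonoOn_charFn (y := s) hw ha.1 hs.2 (fun x hx => by
      rw [← h0]; exact asym_lt_asym' hw hx.2 hlt) ⟨le_rfl, h.le⟩ ⟨h.le, le_rfl⟩ h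
    simpa only [hz] using this
  · have := H.strictAntiOn_charFn (x := s) hw hs.1 ha.2 (fun x hx => by
      rw [← h0]; exact asym_lt_asym' hw hx.1 hlt) ⟨le_rfl, h.le⟩ ⟨h.le, le_rfl⟩ h
    simpa only [hz] using this

/-- On an interval without critical points, `freqAsym` has constant sign. -/
theorem freqAsym_pos_of_pos (H : Admissible κ c l β₀ β₁) {I : Set ℝ} (hI : I ⊆ Icc 0 l)
    (hIc : OrdConnected I) (hne : ∀ x ∈ I, freqAsym κ c l β₀ β₁ x ≠ 0) {x y : ℝ} (hx : x ∈ I)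
    (hy : y ∈ I) (h : 0 < freqAsym κ c l β₀ β₁ x) : 0 < freqAsym κ c l β₀ β₁ y := by
  by_contra hcon
  obtain ⟨z, hz, hz0⟩ := isPreconnected_iff_ordConnected.2 hIc |>.intermediate_value hy hx
    (H.continuousOn_freqAsym.mono hI) ⟨not_lt.1 hcon, h.le⟩
  exact hne z hz hz0

/-- The sign of `freqAsym` on both sides of a critical point that is a strict global minimum. -/
theorem freqAsym_sign_of_min (H : Admissible κ c l β₀ β₁)
    (hne : ∀ x ∈ Icc 0 l, x ≠ s → freqAsym κ c l β₀ β₁ x ≠ 0) (hs : s ∈ Icc 0 l)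
    (hmin : ∀ a ∈ Icc 0 l, a ≠ s → freq κ c l β₀ β₁ s < freq κ c l β₀ β₁ a) :
    (∀ a ∈ Ico 0 s, freqAsym κ c l β₀ β₁ a ≤ 0) ∧
      ∀ a ∈ Ioc s l, 0 ≤ freqAsym κ c l β₀ β₁ a := by
  constructor
  · intro a ha
    by_contra hcon
    have hmem : a ∈ Icc 0 l := ⟨ha.1, ha.2.le.trans hs.2⟩
    -- A positive sign at a would persist up to s and make `freq` nondecreasing on [a, s], against
    -- strict minimality at s.
    refine (hmin a hmem ha.2.ne).not_ge (H.freq_le_freq ha.1 ha.2.le hs.2 fun x hx => ?_)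
    exact (H.freqAsym_pos_of_pos (I := Ico 0 s) (fun y hy => ⟨hy.1, hy.2.le.trans hs.2⟩)
      inferInstance (fun y hy => hne y ⟨hy.1, hy.2.le.trans hs.2⟩ hy.2.ne) ha
      ⟨ha.1.trans hx.1.le, hx.2⟩ (not_le.1 hcon)).le
  · intro a ha
    by_contra hcon
    have hmem : a ∈ Icc 0 l := ⟨hs.1.trans ha.1.le, ha.2⟩
    refine (hmin a hmem ha.1.ne').not_ge (H.freq_le_freq' hs.1 ha.1.le ha.2 fun x hx => ?_)
    by_contra hx0
    exact hcon (H.freqAsym_pos_of_pos (I := Ioc s l) (fun y hy => ⟨hs.1.trans hy.1.le, hy.2⟩)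
      inferInstance (fun y hy => hne y ⟨hs.1.trans hy.1.le, hy.2⟩ hy.1.ne')
      ⟨hx.1, hx.2.le.trans ha.2⟩ ha (not_le.1 hx0)).le

/-- The sign of `freqAsym` on both sides of a critical point that is a strict global maximum. -/
theorem freqAsym_sign_of_max (H : Admissible κ c l β₀ β₁)
    (hne : ∀ x ∈ Icc 0 l, x ≠ s → freqAsym κ c l β₀ β₁ x ≠ 0) (hs : s ∈ Icc 0 l)
    (hmax : ∀ a ∈ Icc 0 l, a ≠ s → freq κ c l β₀ β₁ a < freq κ c l β₀ β₁ s) :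
    (∀ a ∈ Ico 0 s, 0 ≤ freqAsym κ c l β₀ β₁ a) ∧
      ∀ a ∈ Ioc s l, freqAsym κ c l β₀ β₁ a ≤ 0 := by
  constructor
  · intro a ha
    by_contra hcon
    have hmem : a ∈ Icc 0 l := ⟨ha.1, ha.2.le.trans hs.2⟩
    refine (hmax a hmem ha.2.ne).not_ge (H.freq_le_freq' ha.1 ha.2.le hs.2 fun x hx => ?_)
    by_contra hx0
    exact hcon (H.freqAsym_pos_of_pos (I := Ico 0 s) (fun y hy => ⟨hy.1, hy.2.le.trans hs.2⟩)
      inferInstance (fun y hy => hne y ⟨hy.1, hy.2.le.trans hs.2⟩ hy.2.ne)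
      ⟨ha.1.trans hx.1.le, hx.2⟩ ha (not_le.1 hx0)).le
  · intro a ha
    by_contra hcon
    have hmem : a ∈ Icc 0 l := ⟨hs.1.trans ha.1.le, ha.2⟩
    refine (hmax a hmem ha.1.ne').not_ge (H.freq_le_freq hs.1 ha.1.le ha.2 fun x hx => ?_)
    exact (H.freqAsym_pos_of_pos (I := Ioc s l) (fun y hy => ⟨hs.1.trans hy.1.le, hy.2⟩)
      inferInstance (fun y hy => hne y ⟨hs.1.trans hy.1.le, hy.2⟩ hy.1.ne') ha
      ⟨hx.1, hx.2.le.trans ha.2⟩ (not_le.1 hcon)).le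

end Admissible

/-! ### The threshold and the position `aStar` -/

section threshold

variable {c l β₀ β₁ a w : ℝ}

theorem threshold_sq (hw : 0 < w) :
    threshold c β₀ β₁ (w ^ 2) = w⁻¹ * |β₀ * β₁ - w ^ 2| * Real.tanh (w * (1 - c)) := by
  rw [threshold, Real.sqrt_sq hw.le]

theorem abs_sub_le_threshold_iff (hw : 0 < w) :
    |β₀ - β₁| ≤ threshold c β₀ β₁ (w ^ 2) ↔
      w * |β₀ - β₁| ≤ |β₀ * β₁ - w ^ 2| * Real.tanh (w * (1 - c)) := by
  rw [threshold_sq hw, mul_assoc, inv_mul_eq_div, le_div_iff₀ hw, mul_comm]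

theorem abs_tanh_le (hw : 0 < w) (ha : a ∈ Icc 0 l) :
    |Real.tanh (w * (l - 2 * a))| ≤ Real.tanh (w * l) := by
  obtain ⟨h0, h1⟩ := ha
  rw [abs_le, ← Real.tanh_neg]
  exact ⟨strictMono_tanh.monotone (by nlinarith), strictMono_tanh.monotone (by nlinarith)⟩

theorem abs_mul_tanh_le (hw : 0 < w) (ha : a ∈ Icc 0 l) :
    |(w ^ 2 - β₀ * β₁) * Real.tanh (w * (l - 2 * a))| ≤
      |β₀ * β₁ - w ^ 2| * Real.tanh (w * l) := by
  rw [abs_mul, abs_sub_comm]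
  exact mul_le_mul_of_nonneg_left (abs_tanh_le hw ha) (abs_nonneg _)

/-- The tanh term of `asym` is at most w times `threshold` in absolute value, so w(β₁ - β₀) decides
the sign. -/
theorem asym_nonneg_of_lt_threshold (hw : 0 < w) (ha : a ∈ Icc 0 (1 - c))
    (h : β₀ - β₁ < -threshold c β₀ β₁ (w ^ 2)) : 0 ≤ asym (1 - c) β₀ β₁ a w := by
  have h1 := (abs_le.1 (abs_mul_tanh_le (β₀ := β₀) (β₁ := β₁) hw ha)).1
  rw [threshold_sq hw, mul_assoc] at h
  have h2 := mul_lt_mul_of_pos_left h hw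
  rw [mul_neg, mul_inv_cancel_left₀ hw.ne'] at h2
  unfold asym
  linarith

theorem asym_nonpos_of_threshold_lt (hw : 0 < w) (ha : a ∈ Icc 0 (1 - c))
    (h : threshold c β₀ β₁ (w ^ 2) < β₀ - β₁) : asym (1 - c) β₀ β₁ a w ≤ 0 := by
  have h1 := (abs_le.1 (abs_mul_tanh_le (β₀ := β₀) (β₁ := β₁) hw ha)).2
  rw [threshold_sq hw, mul_assoc] at h
  have h2 := mul_lt_mul_of_pos_left h hw
  rw [mul_inv_cancel_left₀ hw.ne'] at h2
  unfold asym
  linarith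

/-- The threshold inequality puts the argument of artanh into (-1, 1), so that tanh undoes artanh;
`aStar` is then visibly the zero of `asym` at fixed w. -/
theorem asym_eq_of_le_threshold (hw : 0 < w) (hne : w ^ 2 ≠ β₀ * β₁)
    (h : |β₀ - β₁| ≤ threshold c β₀ β₁ (w ^ 2)) :
    asym (1 - c) β₀ β₁ a w = (w ^ 2 - β₀ * β₁) *
      (Real.tanh (w * (2 * aStar c β₀ β₁ (w ^ 2) - (1 - c))) -
        Real.tanh (w * (2 * a - (1 - c)))) := by
  have hd : w ^ 2 - β₀ * β₁ ≠ 0 := sub_ne_zero.2 hne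
  have hd' : 0 < |w ^ 2 - β₀ * β₁| := abs_pos.2 hd
  rw [abs_sub_le_threshold_iff hw] at h
  set z := w * (β₁ - β₀) / (w ^ 2 - β₀ * β₁) with hz
  have hz1 : |z| < 1 := by
    rw [hz, abs_div, abs_mul, abs_of_pos hw, div_lt_one hd', abs_sub_comm β₁]
    refine h.trans_lt ?_
    rw [abs_sub_comm (β₀ * β₁)]
    exact mul_lt_of_lt_one_right hd' (Real.tanh_lt_one _)
  have e1 : w * (2 * aStar c β₀ β₁ (w ^ 2) - (1 - c)) = Real.artanh z := by
    rw [aStar, Real.sqrt_sq hw.le, ← hz]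
    generalize Real.artanh z = t
    field_simp
    ring
  have e2 : w * (1 - c - 2 * a) = -(w * (2 * a - (1 - c))) := by ring
  have e3 : (w ^ 2 - β₀ * β₁) * z = w * (β₁ - β₀) := by
    rw [hz]
    field_simp
  rw [e1, Real.tanh_artanh (abs_lt.1 hz1), asym, e2, Real.tanh_neg]
  linear_combination -e3

/-- The condition `|β₀ - β₁| ≤ τ` for frequencies below `√(β₀ β₁)` carries over to smaller
frequencies. -/
theorem le_threshold_of_le {D P w₀ w₁ : ℝ} (hl : 0 < l) (hw₀ : 0 < w₀) (hw : w₀ ≤ w₁)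
    (hP : w₁ ^ 2 ≤ P) (h : w₁ * D ≤ (P - w₁ ^ 2) * Real.tanh (w₁ * l)) :
    w₀ * D ≤ (P - w₀ ^ 2) * Real.tanh (w₀ * l) := by
  have hw₁ := hw₀.trans_le hw
  -- The inequality reads D ≤ (P - w²)·tanh(wl)/w, a product of two nonnegative factors that both
  -- decrease in w.
  have h1 := tanh_div_antitone (mul_pos hw₀ hl) (mul_le_mul_of_nonneg_right hw hl.le)
  rw [div_le_div_iff₀ (by positivity) (by positivity)] at h1
  have h1' : Real.tanh (w₁ * l) * w₀ ≤ Real.tanh (w₀ * l) * w₁ := by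
    refine le_of_mul_le_mul_right ?_ hl
    linarith
  have h2 : 0 ≤ Real.tanh (w₀ * l) * w₁ := mul_nonneg (tanh_nonneg (by positivity)) hw₁.le
  have h3 : (P - w₁ ^ 2) * (Real.tanh (w₁ * l) * w₀) ≤
      (P - w₁ ^ 2) * (Real.tanh (w₀ * l) * w₁) :=
    mul_le_mul_of_nonneg_left h1' (by linarith)
  have h4 : (P - w₁ ^ 2) * (Real.tanh (w₀ * l) * w₁) ≤
      (P - w₀ ^ 2) * (Real.tanh (w₀ * l) * w₁) := by gcongr
  have h5 := mul_le_mul_of_nonneg_right h hw₀.le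
  refine le_of_mul_le_mul_right ?_ hw₁
  linarith

/-- The condition `|β₀ - β₁| ≤ τ` for frequencies above `√(β₀ β₁)` carries over to larger
frequencies. -/
theorem le_threshold_of_ge {D P w₀ w₁ : ℝ} (hl : 0 < l) (hw₁ : 0 < w₁) (hw : w₁ ≤ w₀)
    (hP0 : 0 ≤ P) (hP : P ≤ w₁ ^ 2) (h : w₁ * D ≤ (w₁ ^ 2 - P) * Real.tanh (w₁ * l)) :
    w₀ * D ≤ (w₀ ^ 2 - P) * Real.tanh (w₀ * l) := by
  have hw₀ := hw₁.trans_le hw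
  have h1 : Real.tanh (w₁ * l) ≤ Real.tanh (w₀ * l) := strictMono_tanh.monotone (by gcongr)
  have h2 : 0 ≤ Real.tanh (w₀ * l) := tanh_nonneg (by positivity)
  have h3 : (w₁ ^ 2 - P) * Real.tanh (w₁ * l) ≤ (w₁ ^ 2 - P) * Real.tanh (w₀ * l) :=
    mul_le_mul_of_nonneg_left h1 (by linarith)
  -- Here the two increasing factors are (w² - P)/w and tanh(wl).
  have h4 : w₀ * (w₁ ^ 2 - P) ≤ w₁ * (w₀ ^ 2 - P) := by
    have : 0 ≤ (w₀ - w₁) * (w₀ * w₁ + P) := mul_nonneg (by linarith) (by positivity)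
    linarith
  have h5 := mul_le_mul_of_nonneg_right h4 h2
  have h6 := mul_le_mul_of_nonneg_left (h.trans h3) hw₀.le
  refine le_of_mul_le_mul_left ?_ hw₁
  linarith

end threshold

/-! ### The range of the frequency if it takes the value `√(β₀ β₁)` -/

section range

variable {κ β r w s : ℝ}

/-- As s grows, `edgeSlope` moves monotonically from β/w towards the equilibrium 1, so a lower bound
r ≤ 1 of the initial slope persists. -/
theorem le_edgeSlope_of_le (hβ : 0 < β) (hw : 0 < w) (hs : 0 ≤ s) (h1 : r ≤ 1)
    (h : r * w ≤ β) : r ≤ edgeSlope β w s := by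
  have hD := edgeDen_pos hβ hw hs
  have hC := Real.cosh_pos (w * s)
  have hS := Real.sinh_nonneg_iff.2 (mul_nonneg hw.le hs)
  have hCS := Real.sinh_lt_cosh (w * s)
  rw [edgeSlope, le_div_iff₀ hD]
  have e1 := mul_le_mul_of_nonneg_right h hC.le
  rcases le_total w β with hwβ | hwβ
  · have e2 := mul_le_mul_of_nonneg_right h1 hD.le
    have e3 : 0 ≤ (β - w) * (Real.cosh (w * s) - Real.sinh (w * s)) :=
      mul_nonneg (by linarith) (by linarith)
    linarith
  · have e2 : r * β ≤ w := by nlinarith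
    have e3 := mul_le_mul_of_nonneg_right e2 hS
    linarith

theorem edgeSlope_le_of_le (hβ : 0 < β) (hw : 0 < w) (hs : 0 ≤ s) (h1 : 1 ≤ r)
    (h : β ≤ r * w) : edgeSlope β w s ≤ r := by
  have hD := edgeDen_pos hβ hw hs
  have hC := Real.cosh_pos (w * s)
  have hS := Real.sinh_nonneg_iff.2 (mul_nonneg hw.le hs)
  have hCS := Real.sinh_lt_cosh (w * s)
  rw [edgeSlope, div_le_iff₀ hD]
  have e1 := mul_le_mul_of_nonneg_right h hC.le
  rcases le_total β w with hwβ | hwβ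
  · have e2 := mul_le_mul_of_nonneg_right h1 hD.le
    have e3 : 0 ≤ (w - β) * (Real.cosh (w * s) - Real.sinh (w * s)) :=
      mul_nonneg (by linarith) (by linarith)
    linarith
  · have e2 : w ≤ r * β := by nlinarith
    have e3 := mul_le_mul_of_nonneg_right e2 hS
    linarith

theorem edgeSlope_lt_one (hβ : 0 < β) (hw : 0 < w) (hs : 0 ≤ s) (h : β < w) :
    edgeSlope β w s < 1 := by
  rw [edgeSlope, div_lt_one (edgeDen_pos hβ hw hs)]
  nlinarith [Real.sinh_lt_cosh (w * s)]

theorem one_lt_edgeSlope (hβ : 0 < β) (hw : 0 < w) (hs : 0 ≤ s) (h : w < β) :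
    1 < edgeSlope β w s := by
  rw [edgeSlope, one_lt_div (edgeDen_pos hβ hw hs)]
  nlinarith [Real.sinh_lt_cosh (w * s)]

/-- As arctan(x)/x decreases, arctan(r/√κ) ≥ r arctan(1/√κ) for r ≤ 1. -/
theorem mul_arctan_le_edgeAngle (hκ : 0 < κ) (hβ : 0 < β) (hw : 0 < w) (hs : 0 ≤ s)
    (hr : 0 < r) (h1 : r ≤ 1) (h : r * w ≤ β) :
    r * Real.arctan (1 / √κ) ≤ edgeAngle κ β w s := by
  have hk := Real.sqrt_pos.2 hκ
  have h2 : Real.arctan (r / √κ) ≤ edgeAngle κ β w s :=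
    (arctan_div_le_iff hκ).2 (le_edgeSlope_of_le hβ hw hs h1 h)
  have h3 := arctan_div_antitone (div_pos hr hk) (div_le_div_of_nonneg_right h1 hk.le)
  rw [div_le_div_iff₀ (by positivity) (by positivity)] at h3
  refine le_trans (le_of_mul_le_mul_right ?_ (by positivity : 0 < 1 / √κ)) h2
  calc _ = Real.arctan (1 / √κ) * (r / √κ) := by ring
    _ ≤ _ := h3

theorem edgeAngle_le_mul_arctan (hκ : 0 < κ) (hβ : 0 < β) (hw : 0 < w) (hs : 0 ≤ s)
    (h1 : 1 ≤ r) (h : β ≤ r * w) : edgeAngle κ β w s ≤ r * Real.arctan (1 / √κ) := by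
  have hk := Real.sqrt_pos.2 hκ
  have h2 : edgeAngle κ β w s ≤ Real.arctan (r / √κ) :=
    (arctan_div_le_iff hκ).2 (edgeSlope_le_of_le hβ hw hs h1 h)
  have hr : 0 < r := by linarith
  have h3 := arctan_div_antitone (one_div_pos.2 hk) (div_le_div_of_nonneg_right h1 hk.le)
  rw [div_le_div_iff₀ (by positivity) (by positivity)] at h3
  refine le_trans h2 (le_of_mul_le_mul_right ?_ (by positivity : 0 < 1 / √κ))
  calc _ ≤ Real.arctan (1 / √κ) * (r / √κ) := h3
    _ = _ := by ring

end range

namespace Admissible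

variable {κ c l β₀ β₁ a b s : ℝ}

theorem freq_mul_eq (H : Admissible κ c l β₀ β₁) (ha : a ∈ Icc 0 l) :
    edgeAngle κ β₀ (freq κ c l β₀ β₁ a) a + edgeAngle κ β₁ (freq κ c l β₀ β₁ a) (l - a) =
      freq κ c l β₀ β₁ a * √κ * c := by
  have := (H.freq_spec ha).2
  unfold charFn at this
  linarith

/-- Let M be the maximum and suppose w > M. Both edge slopes at a are then below 1, so w√κc < 2
arctan(1/√κ). At b, where w₁ is the geometric mean of β₀ and β₁, concavity of arctan gives 2
arctan(1/√κ) ≤ M√κc, a contradiction. -/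
theorem freq_le_max (H : Admissible κ c l β₀ β₁) (ha : a ∈ Icc 0 l) (hb : b ∈ Icc 0 l)
    (h : freq κ c l β₀ β₁ b ^ 2 = β₀ * β₁) : freq κ c l β₀ β₁ a ≤ max β₀ β₁ := by
  have h₀ := H.h₀
  have h₁ := H.h₁
  have hk := Real.sqrt_pos.2 H.hκ
  have hc := H.hc
  have ea := H.freq_mul_eq ha
  have eb := H.freq_mul_eq hb
  have hwa := H.freq_pos ha
  have hwb := H.freq_pos hb
  set w := freq κ c l β₀ β₁ a
  set w₁ := freq κ c l β₀ β₁ b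
  set M := max β₀ β₁
  have hM₀ : β₀ ≤ M := le_max_left _ _
  have hM₁ : β₁ ≤ M := le_max_right _ _
  have hM : 0 < M := h₀.trans_le hM₀
  by_contra hcon
  rw [not_le] at hcon
  have hlt : ∀ β s : ℝ, 0 < β → 0 ≤ s → β ≤ M → edgeAngle κ β w s < Real.arctan (1 / √κ) :=
    fun β s hβ hs hβM => Real.arctan_strictMono (div_lt_div_of_pos_right
      (edgeSlope_lt_one hβ hwa hs (hβM.trans_lt hcon)) hk)
  have u0 := hlt β₀ a h₀ ha.1 hM₀
  have u1 := hlt β₁ (l - a) h₁ (sub_nonneg.2 ha.2) hM₁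
  have hw₁M : w₁ ≤ M := by
    by_contra hc'
    nlinarith [mul_le_mul hM₀ hM₁ h₁.le hM.le]
  -- The ratio r = w₁/M fits because w₁² = β₀β₁ gives r w₁ ≤ β₀ and r w₁ ≤ β₁.
  have hr : 0 < w₁ / M := div_pos hwb hM
  have hr1 : w₁ / M ≤ 1 := (div_le_one hM).2 hw₁M
  have r0 : w₁ / M * w₁ ≤ β₀ := by
    rw [div_mul_eq_mul_div, div_le_iff₀ hM]; nlinarith
  have r1 : w₁ / M * w₁ ≤ β₁ := by
    rw [div_mul_eq_mul_div, div_le_iff₀ hM]; nlinarith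
  have v0 := mul_arctan_le_edgeAngle H.hκ h₀ hwb hb.1 hr hr1 r0
  have v1 := mul_arctan_le_edgeAngle H.hκ h₁ hwb (sub_nonneg.2 hb.2) hr hr1 r1
  have h2 : w₁ / M * (2 * Real.arctan (1 / √κ)) ≤ w₁ / M * (M * √κ * c) := by
    have : w₁ / M * (M * √κ * c) = w₁ * √κ * c := by field_simp
    linarith
  have h3 := le_of_mul_le_mul_left h2 hr
  have h4 : M * √κ * c < w * √κ * c := by gcongr
  linarith

theorem min_le_freq (H : Admissible κ c l β₀ β₁) (ha : a ∈ Icc 0 l) (hb : b ∈ Icc 0 l)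
    (h : freq κ c l β₀ β₁ b ^ 2 = β₀ * β₁) : min β₀ β₁ ≤ freq κ c l β₀ β₁ a := by
  have h₀ := H.h₀
  have h₁ := H.h₁
  have hk := Real.sqrt_pos.2 H.hκ
  have hc := H.hc
  have ea := H.freq_mul_eq ha
  have eb := H.freq_mul_eq hb
  have hwa := H.freq_pos ha
  have hwb := H.freq_pos hb
  set w := freq κ c l β₀ β₁ a
  set w₁ := freq κ c l β₀ β₁ b
  set m := min β₀ β₁
  have hm₀ : m ≤ β₀ := min_le_left _ _
  have hm₁ : m ≤ β₁ := min_le_right _ _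
  have hm : 0 < m := lt_min h₀ h₁
  by_contra hcon
  rw [not_le] at hcon
  have hlt : ∀ β s : ℝ, 0 < β → 0 ≤ s → m ≤ β → Real.arctan (1 / √κ) < edgeAngle κ β w s :=
    fun β s hβ hs hβm => Real.arctan_strictMono (div_lt_div_of_pos_right
      (one_lt_edgeSlope hβ hwa hs (hcon.trans_le hβm)) hk)
  have u0 := hlt β₀ a h₀ ha.1 hm₀
  have u1 := hlt β₁ (l - a) h₁ (sub_nonneg.2 ha.2) hm₁
  have hw₁m : m ≤ w₁ := by
    by_contra hc'
    nlinarith [mul_le_mul hm₀ hm₁ hm.le h₀.le]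
  have hr : 0 < w₁ / m := div_pos hwb hm
  have hr1 : 1 ≤ w₁ / m := (one_le_div hm).2 hw₁m
  have r0 : β₀ ≤ w₁ / m * w₁ := by
    rw [div_mul_eq_mul_div, le_div_iff₀ hm]; nlinarith
  have r1 : β₁ ≤ w₁ / m * w₁ := by
    rw [div_mul_eq_mul_div, le_div_iff₀ hm]; nlinarith
  have v0 := edgeAngle_le_mul_arctan H.hκ h₀ hwb hb.1 hr1 r0
  have v1 := edgeAngle_le_mul_arctan H.hκ h₁ hwb (sub_nonneg.2 hb.2) hr1 r1
  have h2 : w₁ / m * (m * √κ * c) ≤ w₁ / m * (2 * Real.arctan (1 / √κ)) := by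
    have : w₁ / m * (m * √κ * c) = w₁ * √κ * c := by field_simp
    linarith
  have h3 := le_of_mul_le_mul_left h2 hr
  have h4 : w * √κ * c < m * √κ * c := by gcongr
  linarith

/-- With w between β₀ and β₁, the signs of (w - β₀)(w + β₁) = w² - β₀β₁ + w(β₁ - β₀) and of (w +
β₀)(w - β₁) give the two bounds. -/
theorem abs_sq_sub_le (H : Admissible κ c l β₀ β₁) (ha : a ∈ Icc 0 l) (hb : b ∈ Icc 0 l)
    (h : freq κ c l β₀ β₁ b ^ 2 = β₀ * β₁) :
    |β₀ * β₁ - freq κ c l β₀ β₁ a ^ 2| ≤ freq κ c l β₀ β₁ a * |β₀ - β₁| := by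
  have h1 := H.freq_le_max ha hb h
  have h2 := H.min_le_freq ha hb h
  have hw := H.freq_pos ha
  have h₀ := H.h₀
  have h₁ := H.h₁
  set w := freq κ c l β₀ β₁ a
  rcases le_total β₀ β₁ with hle | hle
  · rw [max_eq_right hle] at h1
    rw [min_eq_left hle] at h2
    rw [abs_of_nonpos (sub_nonpos.2 hle), abs_le]
    constructor <;> nlinarith
  · rw [max_eq_left hle] at h1
    rw [min_eq_right hle] at h2
    rw [abs_of_nonneg (sub_nonneg.2 hle), abs_le]
    constructor <;> nlinarith

theorem abs_mul_tanh_lt (H : Admissible κ c l β₀ β₁) (ha : a ∈ Icc 0 l) (hb : b ∈ Icc 0 l)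
    (h : freq κ c l β₀ β₁ b ^ 2 = β₀ * β₁) (hne : β₀ ≠ β₁) (t : ℝ) :
    |(freq κ c l β₀ β₁ a ^ 2 - β₀ * β₁) * Real.tanh t| < freq κ c l β₀ β₁ a * |β₀ - β₁| := by
  have h1 := H.abs_sq_sub_le ha hb h
  have hpos : 0 < freq κ c l β₀ β₁ a * |β₀ - β₁| :=
    mul_pos (H.freq_pos ha) (abs_pos.2 (sub_ne_zero.2 hne))
  rw [abs_mul, abs_sub_comm]
  exact (mul_le_mul_of_nonneg_right h1 (abs_nonneg _)).trans_lt
    (mul_lt_of_lt_one_right hpos (Real.abs_tanh_lt_one t))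

theorem freqAsym_neg (H : Admissible κ c l β₀ β₁) (ha : a ∈ Icc 0 l) (hb : b ∈ Icc 0 l)
    (h : freq κ c l β₀ β₁ b ^ 2 = β₀ * β₁) (hlt : β₁ < β₀) : freqAsym κ c l β₀ β₁ a < 0 := by
  have := (abs_lt.1 (H.abs_mul_tanh_lt ha hb h hlt.ne'
    (freq κ c l β₀ β₁ a * (l - 2 * a)))).2
  rw [abs_of_pos (sub_pos.2 hlt)] at this
  unfold freqAsym asym
  linarith

theorem freqAsym_pos (H : Admissible κ c l β₀ β₁) (ha : a ∈ Icc 0 l) (hb : b ∈ Icc 0 l)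
    (h : freq κ c l β₀ β₁ b ^ 2 = β₀ * β₁) (hlt : β₀ < β₁) : 0 < freqAsym κ c l β₀ β₁ a := by
  have := (abs_lt.1 (H.abs_mul_tanh_lt ha hb h hlt.ne
    (freq κ c l β₀ β₁ a * (l - 2 * a)))).1
  rw [abs_of_neg (sub_neg.2 hlt)] at this
  unfold freqAsym asym
  linarith

theorem freq_eq_of_eq (H : Admissible κ c l β₀ β₁) (ha : a ∈ Icc 0 l) (hb : b ∈ Icc 0 l)
    (h : freq κ c l β₀ β₁ b ^ 2 = β₀ * β₁) (heq : β₀ = β₁) : freq κ c l β₀ β₁ a = β₀ := by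
  have h1 := H.freq_le_max ha hb h
  have h2 := H.min_le_freq ha hb h
  rw [← heq] at h1 h2
  simp only [max_self, min_self] at h1 h2
  rw [← heq]
  exact le_antisymm h1 h2

/-- If `|β₀ - β₁| ≤ τ(λ)` at some position with `λ ≠ β₀ β₁`, then `λ ≠ β₀ β₁` everywhere. -/
theorem freq_sq_ne (H : Admissible κ c l β₀ β₁) (ha : a ∈ Icc 0 l)
    (hne : freq κ c l β₀ β₁ a ^ 2 ≠ β₀ * β₁)
    (h : freq κ c l β₀ β₁ a * |β₀ - β₁| ≤ |β₀ * β₁ - freq κ c l β₀ β₁ a ^ 2| *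
      Real.tanh (freq κ c l β₀ β₁ a * l)) (hb : b ∈ Icc 0 l) :
    freq κ c l β₀ β₁ b ^ 2 ≠ β₀ * β₁ := by
  intro hb'
  -- If β₀β₁ were attained, then |β₀β₁ - w²| ≤ w|β₀ - β₁| ≤ |β₀β₁ - w²| tanh(wl), which is
  -- impossible as tanh < 1.
  have h1 := H.abs_sq_sub_le ha hb hb'
  have hpos : 0 < |β₀ * β₁ - freq κ c l β₀ β₁ a ^ 2| := abs_pos.2 (sub_ne_zero.2 hne.symm)
  have := mul_lt_of_lt_one_right hpos (Real.tanh_lt_one (freq κ c l β₀ β₁ a * l))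
  linarith

theorem freq_sq_lt (H : Admissible κ c l β₀ β₁) (ha : a ∈ Icc 0 l)
    (hlt : freq κ c l β₀ β₁ a ^ 2 < β₀ * β₁)
    (hne : ∀ b ∈ Icc 0 l, freq κ c l β₀ β₁ b ^ 2 ≠ β₀ * β₁) (hb : b ∈ Icc 0 l) :
    freq κ c l β₀ β₁ b ^ 2 < β₀ * β₁ := by
  by_contra hcon
  obtain ⟨z, hz, hz0⟩ := isPreconnected_Icc.intermediate_value ha hb
    (H.continuousOn_freq.pow 2) ⟨hlt.le, not_lt.1 hcon⟩
  exact hne z hz hz0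

theorem lt_freq_sq (H : Admissible κ c l β₀ β₁) (ha : a ∈ Icc 0 l)
    (hlt : β₀ * β₁ < freq κ c l β₀ β₁ a ^ 2)
    (hne : ∀ b ∈ Icc 0 l, freq κ c l β₀ β₁ b ^ 2 ≠ β₀ * β₁) (hb : b ∈ Icc 0 l) :
    β₀ * β₁ < freq κ c l β₀ β₁ b ^ 2 := by
  by_contra hcon
  obtain ⟨z, hz, hz0⟩ := isPreconnected_Icc.intermediate_value hb ha
    (H.continuousOn_freq.pow 2) ⟨not_lt.1 hcon, hlt.le⟩
  exact hne z hz hz0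

/-! ### Existence of a critical point -/

theorem freqAsym_left : freqAsym κ c l β₀ β₁ 0 =
    (freq κ c l β₀ β₁ 0 ^ 2 - β₀ * β₁) * Real.tanh (freq κ c l β₀ β₁ 0 * l) +
      freq κ c l β₀ β₁ 0 * (β₁ - β₀) := by
  simp [freqAsym, asym]

theorem freqAsym_right : freqAsym κ c l β₀ β₁ l =
    -((freq κ c l β₀ β₁ l ^ 2 - β₀ * β₁) * Real.tanh (freq κ c l β₀ β₁ l * l)) +
      freq κ c l β₀ β₁ l * (β₁ - β₀) := by
  rw [freqAsym, asym, show freq κ c l β₀ β₁ l * (l - 2 * l) = -(freq κ c l β₀ β₁ l * l) by ring,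
    Real.tanh_neg, mul_neg]

/-- Without a critical point `freqAsym` keeps one sign, read off at the endpoint where both of its
terms have the same sign. Then `freq` is monotone and smallest at the other endpoint, where the
threshold inequality still holds and contradicts that sign. -/
theorem exists_critical_of_lt (H : Admissible κ c l β₀ β₁) (ha : a ∈ Icc 0 l)
    (hlt : ∀ b ∈ Icc 0 l, freq κ c l β₀ β₁ b ^ 2 < β₀ * β₁)
    (h : freq κ c l β₀ β₁ a * |β₀ - β₁| ≤ (β₀ * β₁ - freq κ c l β₀ β₁ a ^ 2) *
      Real.tanh (freq κ c l β₀ β₁ a * l)) :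
    ∃ s ∈ Icc 0 l, freqAsym κ c l β₀ β₁ s = 0 := by
  by_contra! hne
  have hl := H.hl
  have m0 : (0 : ℝ) ∈ Icc 0 l := ⟨le_rfl, hl.le⟩
  have ml : l ∈ Icc 0 l := ⟨hl.le, le_rfl⟩
  have hsign : ∀ {x y}, x ∈ Icc 0 l → y ∈ Icc 0 l → 0 < freqAsym κ c l β₀ β₁ x →
      0 < freqAsym κ c l β₀ β₁ y := fun hx hy =>
    H.freqAsym_pos_of_pos Subset.rfl inferInstance hne hx hy
  have w0 := H.freq_pos m0
  have wl := H.freq_pos ml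
  have t0 := mul_nonneg (sub_nonneg.2 (hlt 0 m0).le) (tanh_nonneg (mul_pos w0 hl).le)
  have tl := mul_nonneg (sub_nonneg.2 (hlt l ml).le) (tanh_nonneg (mul_pos wl hl).le)
  rcases le_total β₀ β₁ with hle | hle
  · have hFl : 0 < freqAsym κ c l β₀ β₁ l := by
      refine lt_of_le_of_ne ?_ (hne l ml).symm
      rw [freqAsym_right]
      linarith [mul_nonneg wl.le (sub_nonneg.2 hle)]
    have h1 := H.freq_le_freq le_rfl ha.1 ha.2 fun x hx =>
      (hsign ml ⟨hx.1.le, hx.2.le.trans ha.2⟩ hFl).le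
    have h2 := le_threshold_of_le hl w0 h1 (hlt a ha).le h
    rw [abs_of_nonpos (sub_nonpos.2 hle)] at h2
    have h3 := hsign ml m0 hFl
    rw [freqAsym_left] at h3
    linarith
  · have hF0 : freqAsym κ c l β₀ β₁ 0 < 0 := by
      refine lt_of_le_of_ne ?_ (hne 0 m0)
      rw [freqAsym_left]
      linarith [mul_nonneg w0.le (sub_nonneg.2 hle)]
    have hF : ∀ x ∈ Icc 0 l, freqAsym κ c l β₀ β₁ x ≤ 0 := fun x hx =>
      not_lt.1 fun hpos => lt_asymm hF0 (hsign hx m0 hpos)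
    have h1 := H.freq_le_freq' ha.1 ha.2 le_rfl fun x hx =>
      hF x ⟨ha.1.trans hx.1.le, hx.2.le⟩
    have h2 := le_threshold_of_le hl wl h1 (hlt a ha).le h
    rw [abs_of_nonneg (sub_nonneg.2 hle)] at h2
    have h3 := lt_of_le_of_ne (hF l ml) (hne l ml)
    rw [freqAsym_right] at h3
    linarith

/-- The endpoints exchange their roles: the threshold inequality now passes to larger frequencies,
so it is carried to the endpoint where `freq` is largest. -/
theorem exists_critical_of_gt (H : Admissible κ c l β₀ β₁) (ha : a ∈ Icc 0 l)
    (hlt : ∀ b ∈ Icc 0 l, β₀ * β₁ < freq κ c l β₀ β₁ b ^ 2)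
    (h : freq κ c l β₀ β₁ a * |β₀ - β₁| ≤ (freq κ c l β₀ β₁ a ^ 2 - β₀ * β₁) *
      Real.tanh (freq κ c l β₀ β₁ a * l)) :
    ∃ s ∈ Icc 0 l, freqAsym κ c l β₀ β₁ s = 0 := by
  by_contra! hne
  have hl := H.hl
  have hP : 0 ≤ β₀ * β₁ := (mul_pos H.h₀ H.h₁).le
  have m0 : (0 : ℝ) ∈ Icc 0 l := ⟨le_rfl, hl.le⟩
  have ml : l ∈ Icc 0 l := ⟨hl.le, le_rfl⟩
  have hsign : ∀ {x y}, x ∈ Icc 0 l → y ∈ Icc 0 l → 0 < freqAsym κ c l β₀ β₁ x →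
      0 < freqAsym κ c l β₀ β₁ y := fun hx hy =>
    H.freqAsym_pos_of_pos Subset.rfl inferInstance hne hx hy
  have w0 := H.freq_pos m0
  have wl := H.freq_pos ml
  have t0 := mul_nonneg (sub_nonneg.2 (hlt 0 m0).le) (tanh_nonneg (mul_pos w0 hl).le)
  have tl := mul_nonneg (sub_nonneg.2 (hlt l ml).le) (tanh_nonneg (mul_pos wl hl).le)
  rcases le_total β₀ β₁ with hle | hle
  · have hF0 : 0 < freqAsym κ c l β₀ β₁ 0 := by
      refine lt_of_le_of_ne ?_ (hne 0 m0).symm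
      rw [freqAsym_left]
      linarith [mul_nonneg w0.le (sub_nonneg.2 hle)]
    have h1 := H.freq_le_freq ha.1 ha.2 le_rfl fun x hx =>
      (hsign m0 ⟨ha.1.trans hx.1.le, hx.2.le⟩ hF0).le
    have h2 := le_threshold_of_ge hl (H.freq_pos ha) h1 hP (hlt a ha).le h
    rw [abs_of_nonpos (sub_nonpos.2 hle)] at h2
    have h3 := hsign m0 ml hF0
    rw [freqAsym_right] at h3
    linarith
  · have hFl : freqAsym κ c l β₀ β₁ l < 0 := by
      refine lt_of_le_of_ne ?_ (hne l ml)
      rw [freqAsym_right]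
      linarith [mul_nonneg wl.le (sub_nonneg.2 hle)]
    have hF : ∀ x ∈ Icc 0 l, freqAsym κ c l β₀ β₁ x ≤ 0 := fun x hx =>
      not_lt.1 fun hpos => lt_asymm hFl (hsign hx ml hpos)
    have h1 := H.freq_le_freq' le_rfl ha.1 ha.2 fun x hx =>
      hF x ⟨hx.1.le, hx.2.le.trans ha.2⟩
    have h2 := le_threshold_of_ge hl (H.freq_pos ha) h1 hP (hlt a ha).le h
    rw [abs_of_nonneg (sub_nonneg.2 hle)] at h2
    have h3 := lt_of_le_of_ne (hF 0 m0) (hne 0 m0)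
    rw [freqAsym_left] at h3
    linarith

/-! ### Optimality -/

theorem isEigenvalue_iff (H : Admissible κ c (1 - c) β₀ β₁) (ha : a ∈ Icc 0 (1 - c)) (μ : ℝ) :
    IsPositivePrincipalEigenvalue (weight κ (Ioo a (a + c))) β₀ β₁ μ ↔
      μ = freq κ c (1 - c) β₀ β₁ a ^ 2 := by
  obtain ⟨hw, h⟩ := H.freq_spec ha
  have hex := isPositivePrincipalEigenvalue_of_charFn_eq_zero H.hκ H.hc H.h₀ H.h₁ hw ha h
  exact ⟨fun hμ => hμ.unique H.hκ measurableSet_Ioo H.h₀ H.h₁ hex, fun hμ => hμ ▸ hex⟩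

theorem principalEigenvalue_eq (H : Admissible κ c (1 - c) β₀ β₁) (ha : a ∈ Icc 0 (1 - c)) :
    principalEigenvalue κ β₀ β₁ (Ioo a (a + c)) = freq κ c (1 - c) β₀ β₁ a ^ 2 := by
  rw [principalEigenvalue, show {μ | IsPositivePrincipalEigenvalue (weight κ (Ioo a (a + c)))
    β₀ β₁ μ} = {freq κ c (1 - c) β₀ β₁ a ^ 2} from ext fun μ => H.isEigenvalue_iff ha μ,
    csInf_singleton]

/-- If the frequency w at s is least, `charFn` at w is nonnegative for every position, which is the
hypothesis of the Rayleigh bound for arbitrary sets. -/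
theorem isLeast_freq_sq (H : Admissible κ c (1 - c) β₀ β₁) (hs : s ∈ Icc 0 (1 - c))
    (h : ∀ a ∈ Icc 0 (1 - c), freq κ c (1 - c) β₀ β₁ s ≤ freq κ c (1 - c) β₀ β₁ a) :
    IsLeast (admissibleEigenvalues κ c β₀ β₁) (freq κ c (1 - c) β₀ β₁ s ^ 2) := by
  have hc := H.hc
  constructor
  · refine ⟨Ioo s (s + c), measurableSet_Ioo, Ioo_subset_Ioo hs.1 (by linarith [hs.2]), ?_, ?_,
      (H.isEigenvalue_iff hs _).2 rfl⟩
    · simp [hc]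
    · simp
  · rintro μ ⟨E, hE, hE01, -, hEc, hμ⟩
    exact hμ.sq_le H.hκ hc (by linarith [H.hl]) H.h₀ H.h₁ (H.freq_pos hs)
      (fun a ha => H.charFn_nonneg ha (H.freq_pos hs) (h a ha)) hE hE01
      (ENNReal.toReal_le_of_le_ofReal hc.le hEc)

end Admissible

/-- Supplies `0 < β₀`. For κ > 1 the condition c > c* is equivalent to x < log((√κ + 1)/(√κ - 1)),
that is cosh x < (κ + 1)/(κ - 1), which makes the denominator positive. -/
theorem betaStar_pos {κ c : ℝ} (hκ : 0 < κ) (hc0 : 0 < c) (hc1 : c < 1)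
    (hcκ : 1 < κ → cStar κ < c) : 0 < betaStar c κ := by
  have hk := Real.sqrt_pos.2 hκ
  have hk2 := Real.sq_sqrt hκ.le
  have hpi := Real.pi_pos
  set x := Real.pi * (1 - c) / (2 * c * √κ) with hx
  have hx0 : 0 < x := div_pos (mul_pos hpi (by linarith)) (by positivity)
  have hs := Real.sinh_pos_iff.2 hx0
  have hden : 0 < κ + 1 - (κ - 1) * Real.cosh x := by
    rcases le_or_gt κ 1 with h | h
    · nlinarith [Real.cosh_pos x]
    · have hk1 : 1 < √κ := by
        rw [Real.lt_sqrt zero_le_one]; simpa using h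
      set y := (√κ + 1) / (√κ - 1) with hy
      have hk1' : 0 < √κ - 1 := by linarith
      have hy0 : 0 < y := by positivity
      have hy1 : 1 < y := (one_lt_div hk1').2 (by linarith)
      have hL := Real.log_pos hy1
      have h1 := hcκ h
      rw [cStar, div_lt_iff₀ (by positivity)] at h1
      have h2 : x < Real.log y := by
        rw [hx, div_lt_iff₀ (by positivity)]
        have : 1 - c < c * (2 * √κ / Real.pi * Real.log y) := by linarith
        have h3 := mul_lt_mul_of_pos_left this hpi
        calc _ < Real.pi * (c * (2 * √κ / Real.pi * Real.log y)) := h3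
          _ = _ := by field_simp
      have h3 : Real.cosh x < Real.cosh (Real.log y) := by
        rw [Real.cosh_lt_cosh, abs_of_pos hx0, abs_of_pos hL]; exact h2
      have h4 : (κ - 1) * Real.cosh (Real.log y) = κ + 1 := by
        rw [Real.cosh_log hy0, hy]
        have hk3 : √κ - 1 ≠ 0 := hk1'.ne'
        have hk4 : √κ + 1 ≠ 0 := by positivity
        rw [show (κ - 1) = (√κ - 1) * (√κ + 1) by linear_combination -hk2]
        field_simp
        linear_combination 2 * hk2
      have h5 := mul_lt_mul_of_pos_left h3 (by linarith : 0 < κ - 1)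
      linarith
  unfold betaStar
  positivity

/-! ### The derivative of the eigenvalue and its critical points -/

section position

variable {κ c β₀ β₁ a s : ℝ}

/-- A zero of `asym` forces the threshold inequality, so `asym` is a difference of two tanh values
and injectivity of tanh identifies s. -/
theorem eq_aStar_of_asym_eq_zero {w : ℝ} (hw : 0 < w) (hs : s ∈ Icc 0 (1 - c))
    (hne : w ^ 2 ≠ β₀ * β₁) (h : asym (1 - c) β₀ β₁ s w = 0) : s = aStar c β₀ β₁ (w ^ 2) := by
  have h1 : w * |β₀ - β₁| ≤ |β₀ * β₁ - w ^ 2| * Real.tanh (w * (1 - c)) := by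
    have h2 := abs_mul_tanh_le (β₀ := β₀) (β₁ := β₁) hw hs
    have h3 : (w ^ 2 - β₀ * β₁) * Real.tanh (w * (1 - c - 2 * s)) = w * (β₀ - β₁) := by
      unfold asym at h
      linarith
    rwa [h3, abs_mul, abs_of_pos hw] at h2
  rw [asym_eq_of_le_threshold hw hne ((abs_sub_le_threshold_iff hw).2 h1)] at h
  have h4 := (mul_eq_zero.1 h).resolve_left (sub_ne_zero.2 hne)
  have h5 := mul_left_cancel₀ hw.ne' (strictMono_tanh.injective (sub_eq_zero.1 h4))
  linarith

namespace Admissible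

theorem exists_hasDerivAt (H : Admissible κ c (1 - c) β₀ β₁) (ha : a ∈ Ioo 0 (1 - c)) :
    ∃ K, 0 < K ∧ HasDerivAt (fun a => principalEigenvalue κ β₀ β₁ (Ioo a (a + c)))
      (K * freqAsym κ c (1 - c) β₀ β₁ a) a := by
  have hm : a ∈ Icc 0 (1 - c) := Ioo_subset_Icc_self ha
  obtain ⟨K, hK, hd⟩ := H.hasDerivWithinAt_freq hm
  have hw := H.freq_pos hm
  refine ⟨2 * freq κ c (1 - c) β₀ β₁ a * K, by positivity, ?_⟩
  have h1 := (hd.hasDerivAt (Icc_mem_nhds ha.1 ha.2)).pow 2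
  refine (h1.congr_of_eventuallyEq ?_).congr_deriv (by push_cast; ring)
  filter_upwards [Icc_mem_nhds ha.1 ha.2] with x hx
  exact H.principalEigenvalue_eq hx

theorem isLeast_principalEigenvalue (H : Admissible κ c (1 - c) β₀ β₁)
    (hs : s ∈ Icc 0 (1 - c))
    (h : ∀ a ∈ Icc 0 (1 - c), freq κ c (1 - c) β₀ β₁ s ≤ freq κ c (1 - c) β₀ β₁ a) :
    IsLeast (admissibleEigenvalues κ c β₀ β₁)
      (principalEigenvalue κ β₀ β₁ (Ioo s (s + c))) := by
  rw [H.principalEigenvalue_eq hs]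
  exact H.isLeast_freq_sq hs h

theorem isLeast_left (H : Admissible κ c (1 - c) β₀ β₁)
    (h : ∀ a ∈ Ioo 0 (1 - c), 0 ≤ freqAsym κ c (1 - c) β₀ β₁ a) :
    IsLeast (admissibleEigenvalues κ c β₀ β₁)
      (principalEigenvalue κ β₀ β₁ (Ioo 0 (0 + c))) :=
  H.isLeast_principalEigenvalue ⟨le_rfl, H.hl.le⟩ fun _ ha =>
    H.freq_le_freq le_rfl ha.1 ha.2 fun x hx => h x ⟨hx.1, hx.2.trans_le ha.2⟩

theorem isLeast_right (H : Admissible κ c (1 - c) β₀ β₁)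
    (h : ∀ a ∈ Ioo 0 (1 - c), freqAsym κ c (1 - c) β₀ β₁ a ≤ 0) :
    IsLeast (admissibleEigenvalues κ c β₀ β₁)
      (principalEigenvalue κ β₀ β₁ (Ioo (1 - c) (1 - c + c))) :=
  H.isLeast_principalEigenvalue ⟨H.hl.le, le_rfl⟩ fun _ ha =>
    H.freq_le_freq' ha.1 ha.2 le_rfl fun x hx => h x ⟨ha.1.trans_lt hx.1, hx.2⟩

theorem eq_aStar (H : Admissible κ c (1 - c) β₀ β₁) (hs : s ∈ Icc 0 (1 - c))
    (hne : freq κ c (1 - c) β₀ β₁ s ^ 2 ≠ β₀ * β₁) (h : freqAsym κ c (1 - c) β₀ β₁ s = 0) :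
    s = aStar c β₀ β₁ (principalEigenvalue κ β₀ β₁ (Ioo s (s + c))) := by
  rw [H.principalEigenvalue_eq hs]
  exact eq_aStar_of_asym_eq_zero (H.freq_pos hs) hs hne h

/-- The threshold inequality at one position excludes λ = β₀β₁ everywhere, so λ < β₀β₁ throughout by
continuity. A second critical point would also be a strict global minimum, so there is only one. -/
theorem exists_minimum (H : Admissible κ c (1 - c) β₀ β₁) (ha : a ∈ Icc 0 (1 - c))
    (hlt : freq κ c (1 - c) β₀ β₁ a ^ 2 < β₀ * β₁)
    (h : |β₀ - β₁| ≤ threshold c β₀ β₁ (freq κ c (1 - c) β₀ β₁ a ^ 2)) :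
    ∃ s ∈ Icc 0 (1 - c), s = aStar c β₀ β₁ (principalEigenvalue κ β₀ β₁ (Ioo s (s + c))) ∧
      (∀ x ∈ Ico 0 s, freqAsym κ c (1 - c) β₀ β₁ x ≤ 0) ∧
      (∀ x ∈ Ioc s (1 - c), 0 ≤ freqAsym κ c (1 - c) β₀ β₁ x) ∧
      ∀ x ∈ Icc 0 (1 - c), freq κ c (1 - c) β₀ β₁ s ≤ freq κ c (1 - c) β₀ β₁ x := by
  have h1 := (abs_sub_le_threshold_iff (H.freq_pos ha)).1 h
  have hall := fun b (hb : b ∈ Icc 0 (1 - c)) =>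
    H.freq_sq_lt ha hlt (fun b hb => H.freq_sq_ne ha hlt.ne h1 hb) hb
  obtain ⟨s, hs, h0⟩ := H.exists_critical_of_lt ha hall
    (by rwa [abs_of_pos (sub_pos.2 hlt)] at h1)
  have hmin := fun b (hb : b ∈ Icc 0 (1 - c)) (hbs : b ≠ s) =>
    H.freq_lt_of_critical hs h0 (hall s hs) hb hbs
  obtain ⟨h2, h3⟩ := H.freqAsym_sign_of_min (fun x hx hxs hx0 => (hmin x hx hxs).not_gt
    (H.freq_lt_of_critical hx hx0 (hall x hx) hs hxs.symm)) hs hmin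
  refine ⟨s, hs, H.eq_aStar hs (hall s hs).ne h0, h2, h3, fun x hx => ?_⟩
  rcases eq_or_ne x s with rfl | hxs
  · exact le_rfl
  · exact (hmin x hx hxs).le

theorem exists_maximum (H : Admissible κ c (1 - c) β₀ β₁) (ha : a ∈ Icc 0 (1 - c))
    (hlt : β₀ * β₁ < freq κ c (1 - c) β₀ β₁ a ^ 2)
    (h : |β₀ - β₁| ≤ threshold c β₀ β₁ (freq κ c (1 - c) β₀ β₁ a ^ 2)) :
    ∃ s ∈ Icc 0 (1 - c), s = aStar c β₀ β₁ (principalEigenvalue κ β₀ β₁ (Ioo s (s + c))) ∧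
      (∀ x ∈ Ico 0 s, 0 ≤ freqAsym κ c (1 - c) β₀ β₁ x) ∧
      ∀ x ∈ Ioc s (1 - c), freqAsym κ c (1 - c) β₀ β₁ x ≤ 0 := by
  have h1 := (abs_sub_le_threshold_iff (H.freq_pos ha)).1 h
  have hall := fun b (hb : b ∈ Icc 0 (1 - c)) =>
    H.lt_freq_sq ha hlt (fun b hb => H.freq_sq_ne ha hlt.ne' h1 hb) hb
  obtain ⟨s, hs, h0⟩ := H.exists_critical_of_gt ha hall
    (by rwa [abs_of_neg (sub_neg.2 hlt), neg_sub] at h1)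
  have hmax := fun b (hb : b ∈ Icc 0 (1 - c)) (hbs : b ≠ s) =>
    H.freq_lt_of_critical' hs h0 (hall s hs) hb hbs
  obtain ⟨h2, h3⟩ := H.freqAsym_sign_of_max (fun x hx hxs hx0 => (hmax x hx hxs).not_gt
    (H.freq_lt_of_critical' hx hx0 (hall x hx) hs hxs.symm)) hs hmax
  exact ⟨s, hs, H.eq_aStar hs (hall s hs).ne' h0, h2, h3⟩

/-- `freq` rises up to s and falls afterwards, so its least value is taken at an endpoint. -/
theorem isLeast_left_or_right (H : Admissible κ c (1 - c) β₀ β₁)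
    (hl : ∀ x ∈ Ico 0 s, 0 ≤ freqAsym κ c (1 - c) β₀ β₁ x)
    (hr : ∀ x ∈ Ioc s (1 - c), freqAsym κ c (1 - c) β₀ β₁ x ≤ 0) :
    IsLeast (admissibleEigenvalues κ c β₀ β₁)
        (principalEigenvalue κ β₀ β₁ (Ioo 0 (0 + c))) ∨
      IsLeast (admissibleEigenvalues κ c β₀ β₁)
        (principalEigenvalue κ β₀ β₁ (Ioo (1 - c) (1 - c + c))) := by
  have key : ∀ a ∈ Icc 0 (1 - c), freq κ c (1 - c) β₀ β₁ 0 ≤ freq κ c (1 - c) β₀ β₁ a ∨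
      freq κ c (1 - c) β₀ β₁ (1 - c) ≤ freq κ c (1 - c) β₀ β₁ a := fun a ha => by
    rcases le_or_gt a s with h | h
    · exact .inl (H.freq_le_freq le_rfl ha.1 ha.2 fun x hx => hl x ⟨hx.1.le, hx.2.trans_le h⟩)
    · exact .inr (H.freq_le_freq' ha.1 ha.2 le_rfl fun x hx => hr x ⟨h.trans hx.1, hx.2.le⟩)
  rcases le_total (freq κ c (1 - c) β₀ β₁ 0) (freq κ c (1 - c) β₀ β₁ (1 - c)) with h | h
  · exact .inl (H.isLeast_principalEigenvalue ⟨le_rfl, H.hl.le⟩ fun a ha =>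
      (key a ha).elim id h.trans)
  · exact .inr (H.isLeast_principalEigenvalue ⟨H.hl.le, le_rfl⟩ fun a ha =>
      (key a ha).elim h.trans id)

end Admissible

end position


end RobinWeight

end

/-! ### The main theorem -/

open RobinWeight

theorem mainTheorem1 (κ c β₀ β₁ : ℝ) (hκ : 0 < κ) (hc0 : 0 < c) (hc1 : c < 1)
    (hcκ : 1 < κ → RobinWeight.cStar κ < c)
    (hβ₀ : RobinWeight.betaStar c κ < β₀) (hβ₁ : 0 < β₁)
    (lam : ℝ → ℝ)
    (hlam : lam = fun a => RobinWeight.principalEigenvalue κ β₀ β₁ (Set.Ioo a (a + c))) :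
    -- `lam a` is the unique positive principal eigenvalue, and it is differentiable in `a`
    (∀ a ∈ Set.Icc 0 (1 - c), ∀ μ : ℝ,
      RobinWeight.IsPositivePrincipalEigenvalue
        (RobinWeight.weight κ (Set.Ioo a (a + c))) β₀ β₁ μ ↔ μ = lam a) ∧
    (∀ a ∈ Set.Ioo 0 (1 - c), DifferentiableAt ℝ lam a) ∧
    -- the sign of the derivative at a given position `a`, in terms of `lam a`
    (∀ a ∈ Set.Ioo 0 (1 - c),
      (β₀ * β₁ = lam a →
        (β₀ > β₁ → deriv lam a < 0) ∧
        (β₀ < β₁ → 0 < deriv lam a) ∧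
        (β₀ = β₁ → deriv lam a = 0)) ∧
      (β₀ * β₁ > lam a →
        (β₀ - β₁ < -RobinWeight.threshold c β₀ β₁ (lam a) → 0 ≤ deriv lam a) ∧
        (|β₀ - β₁| ≤ RobinWeight.threshold c β₀ β₁ (lam a) →
          (a < RobinWeight.aStar c β₀ β₁ (lam a) → deriv lam a ≤ 0) ∧
          (RobinWeight.aStar c β₀ β₁ (lam a) < a → 0 ≤ deriv lam a)) ∧
        (β₀ - β₁ > RobinWeight.threshold c β₀ β₁ (lam a) → deriv lam a ≤ 0)) ∧
      (β₀ * β₁ < lam a →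
        (β₀ - β₁ < -RobinWeight.threshold c β₀ β₁ (lam a) → 0 ≤ deriv lam a) ∧
        (|β₀ - β₁| ≤ RobinWeight.threshold c β₀ β₁ (lam a) →
          (a < RobinWeight.aStar c β₀ β₁ (lam a) → 0 ≤ deriv lam a) ∧
          (RobinWeight.aStar c β₀ β₁ (lam a) < a → deriv lam a ≤ 0)) ∧
        (β₀ - β₁ > RobinWeight.threshold c β₀ β₁ (lam a) → deriv lam a ≤ 0))) ∧
    -- `β₀ β₁ = λ`
    ((∃ a ∈ Set.Icc 0 (1 - c), β₀ * β₁ = lam a) →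
      (β₀ > β₁ → (∀ a ∈ Set.Ioo 0 (1 - c), deriv lam a < 0) ∧
        IsLeast (RobinWeight.admissibleEigenvalues κ c β₀ β₁) (lam (1 - c))) ∧
      (β₀ < β₁ → (∀ a ∈ Set.Ioo 0 (1 - c), 0 < deriv lam a) ∧
        IsLeast (RobinWeight.admissibleEigenvalues κ c β₀ β₁) (lam 0)) ∧
      (β₀ = β₁ → (∀ a ∈ Set.Ioo 0 (1 - c), deriv lam a = 0) ∧
        ∀ a ∈ Set.Icc 0 (1 - c),
          IsLeast (RobinWeight.admissibleEigenvalues κ c β₀ β₁) (lam a))) ∧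
    -- `β₀ β₁ > λ`
    ((∀ a ∈ Set.Icc 0 (1 - c), β₀ * β₁ > lam a ∧
        β₀ - β₁ < -RobinWeight.threshold c β₀ β₁ (lam a)) →
      (∀ a ∈ Set.Ioo 0 (1 - c), 0 ≤ deriv lam a) ∧
        IsLeast (RobinWeight.admissibleEigenvalues κ c β₀ β₁) (lam 0)) ∧
    ((∃ a ∈ Set.Icc 0 (1 - c), β₀ * β₁ > lam a ∧
        |β₀ - β₁| ≤ RobinWeight.threshold c β₀ β₁ (lam a)) →
      ∃ s ∈ Set.Icc 0 (1 - c), s = RobinWeight.aStar c β₀ β₁ (lam s) ∧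
        (∀ a ∈ Set.Ioo 0 s, deriv lam a ≤ 0) ∧
        (∀ a ∈ Set.Ioo s (1 - c), 0 ≤ deriv lam a) ∧
        IsLeast (RobinWeight.admissibleEigenvalues κ c β₀ β₁) (lam s)) ∧
    ((∀ a ∈ Set.Icc 0 (1 - c), β₀ * β₁ > lam a ∧
        β₀ - β₁ > RobinWeight.threshold c β₀ β₁ (lam a)) →
      (∀ a ∈ Set.Ioo 0 (1 - c), deriv lam a ≤ 0) ∧
        IsLeast (RobinWeight.admissibleEigenvalues κ c β₀ β₁) (lam (1 - c))) ∧
    -- `β₀ β₁ < λ`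
    ((∀ a ∈ Set.Icc 0 (1 - c), β₀ * β₁ < lam a ∧
        β₀ - β₁ < -RobinWeight.threshold c β₀ β₁ (lam a)) →
      (∀ a ∈ Set.Ioo 0 (1 - c), 0 ≤ deriv lam a) ∧
        IsLeast (RobinWeight.admissibleEigenvalues κ c β₀ β₁) (lam 0)) ∧
    ((∃ a ∈ Set.Icc 0 (1 - c), β₀ * β₁ < lam a ∧
        |β₀ - β₁| ≤ RobinWeight.threshold c β₀ β₁ (lam a)) →
      ∃ s ∈ Set.Icc 0 (1 - c), s = RobinWeight.aStar c β₀ β₁ (lam s) ∧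
        (∀ a ∈ Set.Ioo 0 s, 0 ≤ deriv lam a) ∧
        (∀ a ∈ Set.Ioo s (1 - c), deriv lam a ≤ 0) ∧
        (IsLeast (RobinWeight.admissibleEigenvalues κ c β₀ β₁) (lam 0) ∨
          IsLeast (RobinWeight.admissibleEigenvalues κ c β₀ β₁) (lam (1 - c)))) ∧
    ((∀ a ∈ Set.Icc 0 (1 - c), β₀ * β₁ < lam a ∧
        β₀ - β₁ > RobinWeight.threshold c β₀ β₁ (lam a)) →
      (∀ a ∈ Set.Ioo 0 (1 - c), deriv lam a ≤ 0) ∧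
        IsLeast (RobinWeight.admissibleEigenvalues κ c β₀ β₁) (lam (1 - c))) := by
  have H : Admissible κ c (1 - c) β₀ β₁ :=
    ⟨hκ, hc0, by linarith, (betaStar_pos hκ hc0 hc1 hcκ).trans hβ₀, hβ₁⟩
  have hl := H.hl
  have e : ∀ a ∈ Icc 0 (1 - c), lam a = freq κ c (1 - c) β₀ β₁ a ^ 2 := fun a ha => by
    rw [hlam]
    exact H.principalEigenvalue_eq ha
  have sub : ∀ a ∈ Ioo 0 (1 - c), a ∈ Icc 0 (1 - c) := fun a ha => Ioo_subset_Icc_self ha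
  have hD : ∀ a ∈ Ioo 0 (1 - c), ∃ K, 0 < K ∧
      HasDerivAt lam (K * freqAsym κ c (1 - c) β₀ β₁ a) a := fun a ha => by
    rw [hlam]
    exact H.exists_hasDerivAt ha
  have dpos : ∀ a ∈ Ioo 0 (1 - c), 0 < freqAsym κ c (1 - c) β₀ β₁ a → 0 < deriv lam a :=
    fun a ha h => by
      obtain ⟨K, hK, hd⟩ := hD a ha
      rw [hd.deriv]
      exact mul_pos hK h
  have dneg : ∀ a ∈ Ioo 0 (1 - c), freqAsym κ c (1 - c) β₀ β₁ a < 0 → deriv lam a < 0 :=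
    fun a ha h => by
      obtain ⟨K, hK, hd⟩ := hD a ha
      rw [hd.deriv]
      exact mul_neg_of_pos_of_neg hK h
  have dzero : ∀ a ∈ Ioo 0 (1 - c), freqAsym κ c (1 - c) β₀ β₁ a = 0 → deriv lam a = 0 :=
    fun a ha h => by
      obtain ⟨K, hK, hd⟩ := hD a ha
      rw [hd.deriv, h, mul_zero]
  have dnonneg : ∀ a ∈ Ioo 0 (1 - c), 0 ≤ freqAsym κ c (1 - c) β₀ β₁ a → 0 ≤ deriv lam a :=
    fun a ha h => h.eq_or_lt.elim (fun h => (dzero a ha h.symm).ge) fun h => (dpos a ha h).le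
  have dnonpos : ∀ a ∈ Ioo 0 (1 - c), freqAsym κ c (1 - c) β₀ β₁ a ≤ 0 → deriv lam a ≤ 0 :=
    fun a ha h => h.eq_or_lt.elim (fun h => (dzero a ha h).le) fun h => (dneg a ha h).le
  have left : (∀ a ∈ Ioo 0 (1 - c), 0 ≤ freqAsym κ c (1 - c) β₀ β₁ a) →
      IsLeast (admissibleEigenvalues κ c β₀ β₁) (lam 0) := fun h => by
    rw [hlam]
    exact H.isLeast_left h
  have right : (∀ a ∈ Ioo 0 (1 - c), freqAsym κ c (1 - c) β₀ β₁ a ≤ 0) →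
      IsLeast (admissibleEigenvalues κ c β₀ β₁) (lam (1 - c)) := fun h => by
    rw [hlam]
    exact H.isLeast_right h
  have below : ∀ a ∈ Icc 0 (1 - c), β₀ - β₁ < -threshold c β₀ β₁ (lam a) →
      0 ≤ freqAsym κ c (1 - c) β₀ β₁ a := fun a ha h =>
    asym_nonneg_of_lt_threshold (H.freq_pos ha) ha (e a ha ▸ h)
  have above : ∀ a ∈ Icc 0 (1 - c), β₀ - β₁ > threshold c β₀ β₁ (lam a) →
      freqAsym κ c (1 - c) β₀ β₁ a ≤ 0 := fun a ha h =>
    asym_nonpos_of_threshold_lt (H.freq_pos ha) ha (e a ha ▸ h)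
  have left' : (∀ a ∈ Icc 0 (1 - c), β₀ - β₁ < -threshold c β₀ β₁ (lam a)) →
      (∀ a ∈ Ioo 0 (1 - c), 0 ≤ deriv lam a) ∧
        IsLeast (admissibleEigenvalues κ c β₀ β₁) (lam 0) := fun h =>
    have h' := fun a ha => below a (sub a ha) (h a (sub a ha))
    ⟨fun a ha => dnonneg a ha (h' a ha), left h'⟩
  have right' : (∀ a ∈ Icc 0 (1 - c), β₀ - β₁ > threshold c β₀ β₁ (lam a)) →
      (∀ a ∈ Ioo 0 (1 - c), deriv lam a ≤ 0) ∧
        IsLeast (admissibleEigenvalues κ c β₀ β₁) (lam (1 - c)) := fun h =>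
    have h' := fun a ha => above a (sub a ha) (h a (sub a ha))
    ⟨fun a ha => dnonpos a ha (h' a ha), right h'⟩
  have star : ∀ a ∈ Icc 0 (1 - c), β₀ * β₁ ≠ lam a →
      |β₀ - β₁| ≤ threshold c β₀ β₁ (lam a) →
      freqAsym κ c (1 - c) β₀ β₁ a = (lam a - β₀ * β₁) *
        (Real.tanh (freq κ c (1 - c) β₀ β₁ a * (2 * aStar c β₀ β₁ (lam a) - (1 - c))) -
          Real.tanh (freq κ c (1 - c) β₀ β₁ a * (2 * a - (1 - c)))) := fun a ha hne h => by
    rw [e a ha] at hne h ⊢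
    exact asym_eq_of_le_threshold (H.freq_pos ha) hne.symm h
  have tanh_le : ∀ a ∈ Icc 0 (1 - c), ∀ x y, x < y →
      Real.tanh (freq κ c (1 - c) β₀ β₁ a * (2 * x - (1 - c))) ≤
        Real.tanh (freq κ c (1 - c) β₀ β₁ a * (2 * y - (1 - c))) := fun a ha x y hxy =>
    strictMono_tanh.monotone (mul_le_mul_of_nonneg_left (by linarith) (H.freq_pos ha).le)
  refine ⟨fun a ha μ => ?_, fun a ha => ?_, fun a ha => ⟨fun h => ?_, fun h => ?_, fun h => ?_⟩,
    ?_, fun h => left' fun a ha => (h a ha).2, ?_, fun h => right' fun a ha => (h a ha).2,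
    fun h => left' fun a ha => (h a ha).2, ?_, fun h => right' fun a ha => (h a ha).2⟩
  · rw [e a ha]
    exact H.isEigenvalue_iff ha μ
  · obtain ⟨K, -, hd⟩ := hD a ha
    exact hd.differentiableAt
  · have hF : freqAsym κ c (1 - c) β₀ β₁ a = freq κ c (1 - c) β₀ β₁ a * (β₁ - β₀) := by
      rw [freqAsym, asym, ← e a (sub a ha), h, sub_self, zero_mul, zero_add]
    have hw := H.freq_pos (sub a ha)
    refine ⟨fun h' => dneg a ha ?_, fun h' => dpos a ha ?_, fun h' => dzero a ha ?_⟩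
    · rw [hF]
      exact mul_neg_of_pos_of_neg hw (by linarith)
    · rw [hF]
      exact mul_pos hw (by linarith)
    · rw [hF, h', sub_self, mul_zero]
  · refine ⟨fun h' => dnonneg a ha (below a (sub a ha) h'), fun h' => ⟨fun h1 => ?_, fun h1 => ?_⟩,
      fun h' => dnonpos a ha (above a (sub a ha) h')⟩
    · refine dnonpos a ha ?_
      rw [star a (sub a ha) h.ne' h']
      exact mul_nonpos_of_nonpos_of_nonneg (by linarith)
        (sub_nonneg.2 (tanh_le a (sub a ha) _ _ h1))
    · refine dnonneg a ha ?_
      rw [star a (sub a ha) h.ne' h']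
      exact mul_nonneg_of_nonpos_of_nonpos (by linarith)
        (sub_nonpos.2 (tanh_le a (sub a ha) _ _ h1))
  · refine ⟨fun h' => dnonneg a ha (below a (sub a ha) h'), fun h' => ⟨fun h1 => ?_, fun h1 => ?_⟩,
      fun h' => dnonpos a ha (above a (sub a ha) h')⟩
    · refine dnonneg a ha ?_
      rw [star a (sub a ha) h.ne h']
      exact mul_nonneg (by linarith) (sub_nonneg.2 (tanh_le a (sub a ha) _ _ h1))
    · refine dnonpos a ha ?_
      rw [star a (sub a ha) h.ne h']
      exact mul_nonpos_of_nonneg_of_nonpos (by linarith)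
        (sub_nonpos.2 (tanh_le a (sub a ha) _ _ h1))
  -- A single position with λ = β₀β₁ confines the frequency at all positions between β₀ and β₁ and
  -- thereby fixes the sign of `freqAsym` everywhere.
  · rintro ⟨b, hb, hbeq⟩
    have hb' : freq κ c (1 - c) β₀ β₁ b ^ 2 = β₀ * β₁ := by rw [hbeq, e b hb]
    refine ⟨fun h => ?_, fun h => ?_, fun h => ⟨fun a ha => ?_, fun a ha => ?_⟩⟩
    · have hF := fun a ha => H.freqAsym_neg (sub a ha) hb hb' h
      exact ⟨fun a ha => dneg a ha (hF a ha), right fun a ha => (hF a ha).le⟩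
    · have hF := fun a ha => H.freqAsym_pos (sub a ha) hb hb' h
      exact ⟨fun a ha => dpos a ha (hF a ha), left fun a ha => (hF a ha).le⟩
    · refine dzero a ha ?_
      rw [freqAsym, asym, H.freq_eq_of_eq (sub a ha) hb hb' h, h]
      ring
    · rw [hlam]
      refine H.isLeast_principalEigenvalue ha fun x hx => ?_
      rw [H.freq_eq_of_eq ha hb hb' h, H.freq_eq_of_eq hx hb hb' h]
  · rintro ⟨b, hb, hlt, hle⟩
    rw [e b hb] at hlt hle
    obtain ⟨s, hs, h1, h2, h3, h4⟩ := H.exists_minimum hb hlt hle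
    refine ⟨s, hs, ?_, fun a ha => dnonpos a ⟨ha.1, ha.2.trans_le hs.2⟩ (h2 a ⟨ha.1.le, ha.2⟩),
      fun a ha => dnonneg a ⟨hs.1.trans_lt ha.1, ha.2⟩ (h3 a ⟨ha.1, ha.2.le⟩), ?_⟩
    · rw [hlam]
      exact h1
    · rw [hlam]
      exact H.isLeast_principalEigenvalue hs h4
  · rintro ⟨b, hb, hlt, hle⟩
    rw [e b hb] at hlt hle
    obtain ⟨s, hs, h1, h2, h3⟩ := H.exists_maximum hb hlt hle
    refine ⟨s, hs, ?_, fun a ha => dnonneg a ⟨ha.1, ha.2.trans_le hs.2⟩ (h2 a ⟨ha.1.le, ha.2⟩),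
      fun a ha => dnonpos a ⟨hs.1.trans_lt ha.1, ha.2⟩ (h3 a ⟨ha.1, ha.2.le⟩), ?_⟩
    · rw [hlam]
      exact h1
    · rw [hlam]
      exact H.isLeast_left_or_right h2 h3
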